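/- **Setting.** Let $\tilde{\mathscr H}\subset\mathscr H\subset\mathscr L$ be real inner product spaces, $\mathscr L$ and $\mathscr H$ complete, with $\|\cdot\|_{\mathscr L}\le\|\cdot\|_{\mathscr H}$ on $\mathscr H$ and $\|\cdot\|_{\mathscr H}\le\|\cdot\|_{\tilde{\mathscr H}}$ on $\tilde{\mathscr H}$. Let $\mathcal E:\mathscr L\to(-\infty,+\infty]$, let $\mathscr F^\pm\subset\mathscr L$ be non-empty, let $a<0$, $r_0^\pm>0$, $C^\pm>1$, and put $m^-=a$, $m^+=0$. Distances without further mention are in $\mathscr L$; let $\mathscr F^\pm_r$ be the set of $v\in\mathscr L$ with $\mathrm{dist}(v,\mathscr F^\pm)\le r$, and $\mathscr F^\pm_{\mathscr H,r}$ the set of $v\in\mathscr H$ whose $\mathscr H$-distance to $\mathscr F^\pm$ is at most $r$. Assume: 1. *(Unbalanced wells.)* $\mathcal E$ is weakly sequentially lower semicontinuous on $\mathscr L$; $\mathscr F^\pm$ are closed in $\mathscr L$; $\mathcal E\ge a$ on $\mathscr L$ and $\mathcal E=a$ on $\mathscr F^-$; $\mathcal E=0$ on $\mathscr F^+$ and every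 point of $\mathscr F^+$ is a local minimizer of $\mathcal E$ in $\mathscr L$; $\mathscr F^+_{r_0^+}\cap\mathscr F^-_{r_0^-}=\emptyset$; $(C^\pm)^{-1}\mathrm{dist}(v,\mathscr F^\pm)^2\le\mathcal E(v)-m^\pm$ for $v\in\mathscr F^\pm_{r_0^\pm}$; every $v\in\mathscr F^\pm_{r_0^\pm}$ has a unique $\mathscr L$-nearest point $P^\pm(v)$ in $\mathscr F^\pm$, and $P^\pm$ is $C^2$ on $\mathscr F^\pm_{r_0^\pm}$ for the $\mathscr L$-norm. 2. *(Smaller spaces.)* $\mathscr H=\{v\in\mathscr L:\mathcal E(v)<+\infty\}$; $\mathcal E$ is $C^1$ on $(\mathscr H,\|\cdot\|_{\mathscr H})$ with differential $D\mathcal E$; there is a continuous $D_{\mathscr L}\mathcal E:\tilde{\mathscr H}\to\mathscr L$ with $\langle D_{\mathscr L}\mathcal E(v),w\rangle_{\mathscr L}=D\mathcal E(v)(w)$ for $v\in\tilde{\mathscr H}$, $w\in\mathscr H$. 3. *(Compactness.)* $\mathscr L$-bounded subsets of $\mathscr F^\pm$ are relatively compact in $\mathscr H$. 4. *(Inverse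 projections.)* For each of the two signs, either $\mathscr F^\pm$ is $\mathscr L$-bounded, or for all $v\in\mathscr F^\pm_{r_0^\pm}$ and $\mathbf v^\pm\in\mathscr F^\pm$ there is a differentiable $\hat P:\mathscr L\to\mathscr L$ with $P^\pm(\hat P(v))=\mathbf v^\pm$ and, for all $w,w_2\in\mathscr L$: $\mathrm{dist}(\hat P(w),\mathscr F^\pm)=\mathrm{dist}(w,\mathscr F^\pm)$, $\|D\hat P(w)w_2\|_{\mathscr L}=\|w_2\|_{\mathscr L}$, and $\mathcal E(\hat P(w))=\mathcal E(w)$. 5. *(Projections in $\mathscr H$.)* Every $v\in\mathscr F^\pm_{\mathscr H,r_0^\pm}$ has a unique $\mathscr H$-nearest point $P^\pm_{\mathscr H}(v)$ in $\mathscr F^\pm$; $P^\pm_{\mathscr H}$ is $C^1$ on $\mathscr F^\pm_{\mathscr H,r_0^\pm}$ for the $\mathscr H$-norm; on this set $\|P^\pm(v)-P^\pm_{\mathscr H}(v)\|_{\mathscr H}\le C^\pm\|v-P^\pm_{\mathscr H}(v)\|_{\mathscr H}$ and $(C^\pm)^{-2}\|v-P^\pm_{\mathscr H}(v)\|_{\mathscr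 H}^2\le\mathcal E(v)-m^\pm\le(C^\pm)^2\|v-P^\pm_{\mathscr H}(v)\|_{\mathscr H}^2$; and for each $r\in(0,r_0^\pm]$ there is given $\beta^\pm(r)>0$ such that $v\in\mathscr F^\pm_{r_0^\pm}$ and $\mathcal E(v)\le m^\pm+\beta^\pm(r)$ imply $v\in\mathscr F^\pm_{\mathscr H,r}$. 6. *(Regularity.)* There is $\mathfrak P:\mathscr L\to\mathscr L$ with $\mathcal E(\mathfrak P(v))\le\mathcal E(v)$ for all $v$; $\mathcal E(\mathfrak P(v))=\mathcal E(v)\Leftrightarrow\mathfrak P(v)=v$ whenever $\mathcal E(v)<+\infty$; $\|\mathfrak P(v_1)-\mathfrak P(v_2)\|_{\mathscr L}\le\|v_1-v_2\|_{\mathscr L}$; $\mathfrak P=\mathrm{Id}$ on $\mathscr F^\pm$. If $c>0$, $I$ is a non-empty bounded open interval, and $\mathbf W\in H^1_{\rm loc}(I,\mathscr L)$ is a local minimizer of $\mathbf E_c(\cdot;I)$ with $\mathfrak P(\mathbf W(t))=\mathbf W(t)$ on $I$, then $\mathbf W\in\mathcal A(I)$ and $\mathbf W''-D_{\mathscr L}\mathcal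 E(\mathbf W)=-c\mathbf W'$ in $I$. Here elements of $H^1_{\rm loc}$ are identified with their continuous representatives, $\mathbf E_c(U;I)=\int_I\big[\tfrac12\|U'(t)\|_{\mathscr L}^2+\mathcal E(U(t))\big]e^{ct}\,dt$, $\mathbf E_c(U)=\mathbf E_c(U;\mathbb R)$, and $\mathcal A(O)=C^2(O,\mathscr L)\cap C^1(O,\mathscr H)\cap C^0(O,\tilde{\mathscr H})$. A local minimizer is a $\mathbf W\in H^1_{\rm loc}(I,\mathscr L)$ such that $\mathbf E_c(\mathbf W;I)$ is well defined and finite and, for some $\delta>0$, $\mathbf E_c(\mathbf W+\phi;I)$ is well defined and $\ge\mathbf E_c(\mathbf W;I)$ for all $\phi\in C^1_c(I,\mathscr H)$ with $\max\|\phi\|_{\mathscr H}<\delta$. Let $\kappa_r^-=\inf\{\mathcal E(v):\mathrm{dist}(v,\mathscr F^-)\in[r,r_0^-]\}$, $\hat r^-=\frac{r_0^-}{C^-+1}$ and $$\eta_0^-=\min\Big\{\sqrt{e^{-1}\tfrac{r_0^-}{4}\sqrt{2(\kappa^-_{r_0^- /4}-a)}},\ \tfrac{r_0^-}{4}\Big\},\qquad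 \mathcal E^-_{\max}=\frac{\min\{(\eta_0^-)^2/4,\ \kappa^-_{\eta_0^-}-a,\ \beta^-(\hat r^-),\ \beta^-(\eta_0^-)\}}{(C^-)^2(C^-+1)},$$ $$\gamma^-=\frac{1}{C^-+\frac12(C^-)^2\big((C^-)^2+(C^-+1)^2\big)},\qquad d_0=\mathrm{dist}_{\mathscr L}\big(\mathscr F^+_{r_0^+/2},\mathscr F^-_{r_0^- /2}\big).$$ 7. *(Level sets.)* $-a<\mathcal E^-_{\max}$ and $\{v\in\mathscr H:\mathcal E(v)<0\}\subset\mathscr F^-_{r_0^- /2}$. 8. *(Convergence.)* $-a<\frac{(d_0\gamma^-)^2}{2}$. Let $X$ be the set of $U\in H^1_{\rm loc}(\mathbb R,\mathscr L)$ for which there is $T\ge1$ with $U(t)\in\mathscr F^+_{r_0^+/2}$ for all $t\ge T$ and $U(t)\in\mathscr F^-_{r_0^- /2}$ for all $t\le-T$. Consider pairs $(c^\star,\mathbf U)$ with $c^\star>0$ and $\mathbf U\in\mathcal A(\mathbb R)\cap X$ such that $$\mathbf U''-D_{\mathscr L}\mathcal E(\mathbf U)=-c^\star\mathbf U'\ \text{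 in }\mathbb R,\qquad(\ast)$$ $\mathbf E_{c^\star}(\mathbf U)=0=\min_X\mathbf E_{c^\star}$, and $\mathfrak P(\mathbf U(t))=\mathbf U(t)$ for all $t$. **Theorem.** Under 1–8 such a pair exists, and for every such pair $(c^\star,\mathbf U)$ the following holds. * If $\tilde{\mathbf U}\in\mathcal A(\mathbb R)\cap X$ and $\mathbf E_{c^\star}(\tilde{\mathbf U})=0$, then $(c^\star,\tilde{\mathbf U})$ solves $(\ast)$, the integral $\int_{\mathbb R}\|\tilde{\mathbf U}'(t)\|_{\mathscr L}^2\,dt$ is finite, and $$c^\star=\frac{-a}{\int_{\mathbb R}\|\tilde{\mathbf U}'(t)\|_{\mathscr L}^2\,dt}.$$ * $c^\star=\sup\{c>0:\inf_{U\in X}\mathbf E_c(U)=-\infty\}=\inf\{c>0:\inf_{U\in X}\mathbf E_c(U)=0\}$. * $\displaystyle c^\star\le\frac{\sqrt{-2a}}{d_0}<\min\Big\{\frac{\sqrt{2\mathcal E^-_{\max}}}{d_0},\ \gamma^-\Big\}.$ -/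

import Mathlib

open Set Filter Topology MeasureTheory

namespace AbstractWave

/-- The data attached to one of the two minimizing sets: the set `F` itself, the radius `r₀`, the
constant `C`, the nearest-point projection `P` for the norm of `L`, the nearest-point projection
`PH` for the norm of `H`, and the function `r ↦ β r`. The projections are only meaningful on the
closed neighbourhoods of radius `r₀` of `F`; what is required of all these data is stated in the
hypotheses below. -/
structure Well (L H : Type*) where
  F : Set L
  r₀ : ℝ
  C : ℝ
  P : L → L
  PH : H → H
  β : ℝ → ℝ

/-- The abstract setting: Hilbert spaces `Ht ⊂ H ⊂ L` (the inclusions being the linear maps `inclt`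
and `incl`), the potential `pot : L → (-∞, +∞]`, its minimum value `a`, the two minimizing sets
with their data, the `L`-gradient `grad` of `pot`, and the map `trunc` of `L` into itself. -/
structure Setting (L H Ht : Type*) [NormedAddCommGroup L] [InnerProductSpace ℝ L]
    [NormedAddCommGroup H] [InnerProductSpace ℝ H]
    [NormedAddCommGroup Ht] [InnerProductSpace ℝ Ht] where
  incl : H →ₗ[ℝ] L
  inclt : Ht →ₗ[ℝ] H
  pot : L → EReal
  a : ℝ
  minus : Well L H
  plus : Well L H
  grad : Ht → L
  trunc : L → L

/-- `U` belongs to `H¹_loc(O, L)` for an open set `O ⊆ ℝ`, `U` being the continuous representative: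
`U` is locally the primitive of a function in `L²_loc(O, L)`. In that case the weak derivative of
`U` is equal almost everywhere in `O` to the pointwise derivative `deriv U`. -/
def MemH1loc {L : Type*} [NormedAddCommGroup L] [NormedSpace ℝ L]
    (U : ℝ → L) (O : Set ℝ) : Prop :=
  ∃ g : ℝ → L, (∀ K : Set ℝ, K ⊆ O → IsCompact K → MemLp g 2 (volume.restrict K)) ∧
    ∀ s t : ℝ, uIcc s t ⊆ O → U t - U s = ∫ x in s..t, g x

namespace Setting

variable {L H Ht : Type*} [NormedAddCommGroup L] [InnerProductSpace ℝ L]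
  [NormedAddCommGroup H] [InnerProductSpace ℝ H]
  [NormedAddCommGroup Ht] [InnerProductSpace ℝ Ht]

/-- The closed neighbourhood of radius `r` of the minimizing set, for the norm of `L`. -/
def nbhd (_S : Setting L H Ht) (w : Well L H) (r : ℝ) : Set L :=
  Metric.cthickening r w.F

/-- The minimizing set, seen as a subset of `H`. -/
def setH (S : Setting L H Ht) (w : Well L H) : Set H :=
  S.incl ⁻¹' w.F

/-- The closed neighbourhood of radius `r` of the minimizing set, for the norm of `H`. -/
def nbhdH (S : Setting L H Ht) (w : Well L H) (r : ℝ) : Set H :=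
  Metric.cthickening r (S.setH w)

/-- The (real-valued) restriction of the potential to `H`. -/
noncomputable def potH (S : Setting L H Ht) (h : H) : ℝ :=
  (S.pot (S.incl h)).toReal

/-! ### The weighted energy -/

/-- The density `[‖U'(t)‖² / 2 + pot (U t)] e^{ct}`. -/
noncomputable def density (S : Setting L H Ht) (c : ℝ) (U : ℝ → L) (t : ℝ) : EReal :=
  (((‖deriv U t‖ ^ 2 / 2 : ℝ) : EReal) + S.pot (U t)) * ((Real.exp (c * t) : ℝ) : EReal)

/-- The integral of the density over `I`, as the integral of its positive part minus the integral
of its negative part. If both are infinite the integral is not well defined, and the value given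
here is `⊥` (this being the value of `⊤ - ⊤` in `EReal`). -/
noncomputable def energyOn (S : Setting L H Ht) (c : ℝ) (U : ℝ → L) (I : Set ℝ) : EReal :=
  ((∫⁻ t in I, (S.density c U t).toENNReal : ENNReal) : EReal)
    - ((∫⁻ t in I, (-S.density c U t).toENNReal : ENNReal) : EReal)

/-- The energy on the whole line. -/
noncomputable def energy (S : Setting L H Ht) (c : ℝ) (U : ℝ → L) : EReal :=
  S.energyOn c U univ

/-- Local minimizers on the bounded open interval `(α, β)`: the energy of `U` on it is well defined
and finite (neither `⊥` nor `⊤`), and it is not larger than the energy of `U + φ` (which is then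
well defined) for all small `φ ∈ C¹_c((α, β), H)`. -/
def IsLocalMinimizer (S : Setting L H Ht) (c α β : ℝ) (U : ℝ → L) : Prop :=
  MemH1loc U (Ioo α β) ∧
  S.energyOn c U (Ioo α β) ≠ ⊥ ∧ S.energyOn c U (Ioo α β) ≠ ⊤ ∧
  ∃ δ : ℝ, 0 < δ ∧ ∀ φ : ℝ → H, ContDiff ℝ 1 φ → HasCompactSupport φ →
    tsupport φ ⊆ Ioo α β → (∀ t, ‖φ t‖ < δ) →
      S.energyOn c U (Ioo α β) ≤ S.energyOn c (fun t => U t + S.incl (φ t)) (Ioo α β)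

/-- The regularity class `C²(O, L) ∩ C¹(O, H) ∩ C⁰(O, Ht)` for an open set `O`. -/
def MemA (S : Setting L H Ht) (O : Set ℝ) (U : ℝ → L) : Prop :=
  ContDiffOn ℝ 2 U O ∧
  ∃ (UH : ℝ → H) (Ut : ℝ → Ht),
    (∀ t ∈ O, S.incl (UH t) = U t) ∧ ContDiffOn ℝ 1 UH O ∧
    (∀ t ∈ O, S.inclt (Ut t) = UH t) ∧ ContinuousOn Ut O

/-- `U'' - grad(U) = -c U'` at every point of the open set `O`, where `U` takes values in `Ht`. -/
def Solves (S : Setting L H Ht) (c : ℝ) (U : ℝ → L) (O : Set ℝ) : Prop :=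
  ∀ t ∈ O, ∃ x : Ht, S.incl (S.inclt x) = U t ∧
    deriv (deriv U) t - S.grad x = -(c • deriv U t)

/-! ### The hypotheses -/

/-- The local requirements on a minimizing set on which the potential is equal to `m`. -/
structure WellHyp (S : Setting L H Ht) (w : Well L H) (m : ℝ) : Prop where
  nonempty : w.F.Nonempty
  isClosed : IsClosed w.F
  r₀_pos : 0 < w.r₀
  one_lt_C : 1 < w.C
  coercive : ∀ v ∈ S.nbhd w w.r₀,
    ((w.C⁻¹ * Metric.infDist v w.F ^ 2 : ℝ) : EReal) ≤ S.pot v - (m : EReal)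
  proj : ∀ v ∈ S.nbhd w w.r₀,
    w.P v ∈ w.F ∧ ‖v - w.P v‖ = Metric.infDist v w.F ∧
      ∀ f ∈ w.F, ‖v - f‖ = Metric.infDist v w.F → f = w.P v
  proj_contDiffOn : ContDiffOn ℝ 2 w.P (S.nbhd w w.r₀)

/-- The potential is an unbalanced double well potential: the levels of the two sets of minimizers
are `a < 0` and `0`, that is, `min {±(-a), 0}`. -/
structure Unbalanced (S : Setting L H Ht) : Prop where
  pot_ne_bot : ∀ v, S.pot v ≠ ⊥
  weakly_lsc : ∀ (u : ℕ → L) (v : L),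
    (∀ y : L, Tendsto (fun n => inner ℝ (u n) y) atTop (𝓝 (inner ℝ v y))) →
      S.pot v ≤ liminf (fun n => S.pot (u n)) atTop
  a_neg : S.a < 0
  a_le : ∀ v, (S.a : EReal) ≤ S.pot v
  pot_minus : ∀ f ∈ S.minus.F, S.pot f = (S.a : EReal)
  pot_plus : ∀ f ∈ S.plus.F, S.pot f = 0 ∧ IsLocalMin S.pot f
  disjoint : Disjoint (S.nbhd S.plus S.plus.r₀) (S.nbhd S.minus S.minus.r₀)
  minus_hyp : S.WellHyp S.minus S.a
  plus_hyp : S.WellHyp S.plus 0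

/-- The relations between `L`, `H`, `Ht` and the potential. -/
structure SmallerSpace (S : Setting L H Ht) : Prop where
  incl_injective : Function.Injective S.incl
  incl_norm_le : ∀ h, ‖S.incl h‖ ≤ ‖h‖
  finite_iff : ∀ v, S.pot v < ⊤ ↔ v ∈ range S.incl
  pot_C1 : ContDiff ℝ 1 S.potH
  inclt_injective : Function.Injective S.inclt
  inclt_norm_le : ∀ x, ‖S.inclt x‖ ≤ ‖x‖
  grad_continuous : Continuous S.grad
  grad_spec : ∀ (x : Ht) (h : H),
    inner ℝ (S.grad x) (S.incl h) = fderiv ℝ S.potH (S.inclt x) h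

/-- `L`-bounded subsets of the minimizing set are (relatively) compact in `H`. -/
def CompactnessAt (S : Setting L H Ht) (w : Well L H) : Prop :=
  ∀ A : Set L, A ⊆ w.F → Bornology.IsBounded A → IsCompact (closure (S.incl ⁻¹' A))

/-- Compactness of both minimizing sets. -/
def Compactness (S : Setting L H Ht) : Prop :=
  S.CompactnessAt S.minus ∧ S.CompactnessAt S.plus

/-- The minimizing set is `L`-bounded, or it is unbounded but its points can be exchanged by maps
`Q` of `L` into itself which preserve the potential, the distance to the set, and the length of
curves. -/
def InverseProjAt (S : Setting L H Ht) (w : Well L H) : Prop :=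
  Bornology.IsBounded w.F ∨
  ∀ v ∈ S.nbhd w w.r₀, ∀ f ∈ w.F, ∃ Q : L → L,
    w.P (Q v) = f ∧
    (∀ x, Metric.infDist (Q x) w.F = Metric.infDist x w.F) ∧
    Differentiable ℝ Q ∧ (∀ x y, ‖fderiv ℝ Q x y‖ = ‖y‖) ∧
    (∀ x, S.pot (Q x) = S.pot x)

/-- The preceding alternative holds for each of the two minimizing sets. -/
def InverseProj (S : Setting L H Ht) : Prop :=
  S.InverseProjAt S.minus ∧ S.InverseProjAt S.plus

/-- Local properties in `H` around a minimizing set on which the potential is equal to `m`. -/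
structure ProjHAt (S : Setting L H Ht) (w : Well L H) (m : ℝ) : Prop where
  proj : ∀ h ∈ S.nbhdH w w.r₀,
    w.PH h ∈ S.setH w ∧ ‖h - w.PH h‖ = Metric.infDist h (S.setH w) ∧
      ∀ f ∈ S.setH w, ‖h - f‖ = Metric.infDist h (S.setH w) → f = w.PH h
  proj_contDiffOn : ContDiffOn ℝ 1 w.PH (S.nbhdH w w.r₀)
  proj_diff : ∀ h ∈ S.nbhdH w w.r₀, ∃ p : H, S.incl p = w.P (S.incl h) ∧
    ‖p - w.PH h‖ ≤ w.C * ‖h - w.PH h‖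
  β_pos : ∀ r ∈ Ioc 0 w.r₀, 0 < w.β r
  β_spec : ∀ r ∈ Ioc 0 w.r₀, ∀ v ∈ S.nbhd w w.r₀,
    S.pot v ≤ ((m + w.β r : ℝ) : EReal) → ∃ h ∈ S.nbhdH w r, S.incl h = v
  local_est : ∀ h ∈ S.nbhdH w w.r₀,
    (w.C ^ 2)⁻¹ * ‖h - w.PH h‖ ^ 2 ≤ S.potH h - m ∧
      S.potH h - m ≤ w.C ^ 2 * ‖h - w.PH h‖ ^ 2

/-- Local properties in `H` around both minimizing sets. -/
def ProjH (S : Setting L H Ht) : Prop :=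
  S.ProjHAt S.minus S.a ∧ S.ProjHAt S.plus 0

/-- The properties of `trunc`, and the regularity of the local minimizers which are fixed by it. -/
structure Regularity (S : Setting L H Ht) : Prop where
  trunc_le : ∀ v, S.pot (S.trunc v) ≤ S.pot v
  trunc_eq_iff : ∀ v, S.pot v < ⊤ → (S.pot (S.trunc v) = S.pot v ↔ S.trunc v = v)
  trunc_lipschitz : ∀ v₁ v₂, ‖S.trunc v₁ - S.trunc v₂‖ ≤ ‖v₁ - v₂‖
  trunc_minus : ∀ f ∈ S.minus.F, S.trunc f = f
  trunc_plus : ∀ f ∈ S.plus.F, S.trunc f = f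
  regular : ∀ c α β : ℝ, 0 < c → α < β → ∀ W : ℝ → L,
    S.IsLocalMinimizer c α β W → (∀ t ∈ Ioo α β, S.trunc (W t) = W t) →
      S.MemA (Ioo α β) W ∧ S.Solves c W (Ioo α β)

/-! ### The constants -/

/-- The infimum of the potential over the points whose distance to the set is in `[r, r₀]`. -/
noncomputable def kappa (S : Setting L H Ht) (w : Well L H) (r : ℝ) : ℝ :=
  (sInf (S.pot '' {v | Metric.infDist v w.F ∈ Icc r w.r₀})).toReal

/-- The constant `η₀⁻`. -/
noncomputable def etaMinus (S : Setting L H Ht) : ℝ :=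
  min (√((Real.exp 1)⁻¹ * (S.minus.r₀ / 4) * √(2 * (S.kappa S.minus (S.minus.r₀ / 4) - S.a))))
    (S.minus.r₀ / 4)

/-- The constant `r̂⁻`. -/
noncomputable def rHatMinus (S : Setting L H Ht) : ℝ :=
  S.minus.r₀ / (S.minus.C + 1)

/-- The constant `𝓔⁻_max`. -/
noncomputable def EmaxMinus (S : Setting L H Ht) : ℝ :=
  1 / (S.minus.C ^ 2 * (S.minus.C + 1)) *
    min (min (S.etaMinus ^ 2 / 4) (S.kappa S.minus S.etaMinus - S.a))
      (min (S.minus.β S.rHatMinus) (S.minus.β S.etaMinus))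

/-- The constant `γ⁻ = 1 / (C⁻ + ½ (C⁻)² ((C⁻)² + (C⁻ + 1)²))`. -/
noncomputable def gammaMinus (S : Setting L H Ht) : ℝ :=
  1 / (S.minus.C + 1 / 2 * S.minus.C ^ 2 * (S.minus.C ^ 2 + (S.minus.C + 1) ^ 2))

/-- The `L`-distance `d₀` between the closed neighbourhoods of radii `r₀^± / 2`. -/
noncomputable def d₀ (S : Setting L H Ht) : ℝ :=
  sInf (image2 dist (S.nbhd S.plus (S.plus.r₀ / 2)) (S.nbhd S.minus (S.minus.r₀ / 2)))

/-- The hypothesis on the level sets of the potential. -/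
structure LevelSets (S : Setting L H Ht) : Prop where
  a_bound : -S.a < S.EmaxMinus
  neg_subset : ∀ h : H, S.pot (S.incl h) < 0 → S.incl h ∈ S.nbhd S.minus (S.minus.r₀ / 2)

/-- The additional upper bound on `-a`. -/
def ConvergenceBound (S : Setting L H Ht) : Prop :=
  -S.a < (S.d₀ * S.gammaMinus) ^ 2 / 2

/-! ### The space of curves and the minimizing waves -/

/-- The space `X`. -/
def X (S : Setting L H Ht) : Set (ℝ → L) :=
  {U | MemH1loc U univ ∧ ∃ T : ℝ, 1 ≤ T ∧
    (∀ t, T ≤ t → Metric.infDist (U t) S.plus.F ≤ S.plus.r₀ / 2) ∧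
    (∀ t, t ≤ -T → Metric.infDist (U t) S.minus.F ≤ S.minus.r₀ / 2)}

/-- The infimum over `X` of the energy with weight `e^{ct}`. -/
noncomputable def infX (S : Setting L H Ht) (c : ℝ) : EReal :=
  ⨅ U ∈ S.X, S.energy c U

/-- `(c, U)` is a travelling wave which globally minimizes the energy: `c > 0`, `U` is of class
`𝓐(ℝ)`, it belongs to `X` (which contains the conditions at infinity), it solves the equation, its
energy is `0` and is minimal in `X`, and it is fixed by `trunc`. -/
structure IsMinimizingWave (S : Setting L H Ht) (c : ℝ) (U : ℝ → L) : Prop where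
  pos : 0 < c
  memA : S.MemA univ U
  memX : U ∈ S.X
  solves : S.Solves c U univ
  energy_eq : S.energy c U = 0
  minimal : ∀ V ∈ S.X, S.energy c U ≤ S.energy c V
  fixed : ∀ t, S.trunc (U t) = U t

end Setting

end AbstractWave

/-! The energy is written as `kin` + `potE` minus the integral of `-a e^{ct}` up to a time after
which the potential is nonnegative along the curve. Passing from `U(t)` to `U(lt + b)` and from
speed `c` to `cl` multiplies all three terms by one positive factor, except that `kin` also picks up
`l²`. Three facts follow. By translation, one negative energy at speed `c` makes the infimum `-∞`
(`infX_eq_bot_iff`). A nonpositive energy at `c` gives a negative one at every smaller speed,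
because a curve joining the two wells has nonzero kinetic energy (`exists_neg_of_lt`). A negative
energy at `c` persists at slightly larger speeds (`exists_gt_neg`). The speeds with infimum `-∞`
therefore form an interval `(0, c₀)`, and `c₀` is the only possible speed. The interval is nonempty
(`exists_speed`) and bounded by `√(-2a) / d₀`: after the last time of negative potential the curve
must still travel the distance `d₀`, and Cauchy-Schwarz limits what the available kinetic energy can
achieve (`speed_le`).

At `c₀` no energy is negative, and the value zero is attained by a weak limit of curves of negative
energy at speeds tending to `c₀` (`exists_minimizer`). Two normalizations prevent the loss of
compactness. Length-preserving maps bring the curves through a bounded region (`exists_anchored`).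
The curves are also altered so that they stay near `F⁻` up to some time, the potential being
nonnegative afterwards (`exists_modification`). The alteration does not raise the energy: an
excursion away from `F⁻` that ends at nonpositive potential costs at least as much as resting at a
point of `F⁻` and then following a segment. This comparison is where `-a < EmaxMinus` and `c <
gammaMinus` are needed. Compactness of the wells makes their neighbourhoods weakly closed, so that
the limit curve belongs to `X`.

Truncation lowers the energy, so minimizers are fixed by it and the regularity hypothesis applies to
them. For the speed formula, the Hamiltonian `q = pot(U) - ‖U'‖² / 2` satisfies `q' = c ‖U'‖²`, so
that `c ∫ ‖U'‖²` is the total increase of `q`. Finiteness of the energy forces `q → 0` at `+∞`, and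
the same comparison with a segment forces `q → a` at `-∞` (`hamiltonian_integral`). -/

namespace AbstractWave

/-! ### Weak sequential compactness in Hilbert spaces -/

/-- Bounded sequences in a Hilbert space have weakly convergent subsequences. -/
theorem exists_subseq_tendsto_inner {G : Type*} [NormedAddCommGroup G] [InnerProductSpace ℝ G]
    [CompleteSpace G] (u : ℕ → G) (M : ℝ) (hu : ∀ n, ‖u n‖ ≤ M) :
    ∃ v : G, ∃ φ : ℕ → ℕ, StrictMono φ ∧
      ∀ y : G, Tendsto (fun n => inner ℝ (u (φ n)) y) atTop (𝓝 (inner ℝ v y)) := by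
  -- Sequential Banach-Alaoglu needs separability, so the argument runs in the closed span of the
  -- sequence. Projecting a test vector onto it does not change inner products with its elements.
  let K : Submodule ℝ G := (Submodule.span ℝ (range u)).topologicalClosure
  have hKsep : TopologicalSpace.IsSeparable (K : Set G) := by
    rw [Submodule.topologicalClosure_coe]
    exact ((countable_range u).isSeparable.span (R := ℝ)).closure
  have hsep : TopologicalSpace.SeparableSpace K := hKsep.separableSpace
  have hcl : IsClosed (K : Set G) := Submodule.isClosed_topologicalClosure _
  have hcomp : CompleteSpace K := hcl.completeSpace_coe
  have hmem : ∀ n, u n ∈ K := fun n =>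
    Submodule.le_topologicalClosure _ (Submodule.subset_span (mem_range_self n))
  let u' : ℕ → K := fun n => ⟨u n, hmem n⟩
  have hball : ∀ n, StrongDual.toWeakDual (InnerProductSpace.toDual ℝ K (u' n)) ∈
      WeakDual.toStrongDual ⁻¹' Metric.closedBall (0 : StrongDual ℝ K) M := by
    intro n
    rw [mem_preimage, Metric.mem_closedBall]
    have : ‖InnerProductSpace.toDual ℝ K (u' n)‖ = ‖u n‖ := by
      rw [LinearIsometryEquiv.norm_map]; rfl
    exact (dist_zero_right (InnerProductSpace.toDual ℝ K (u' n))).trans_le (this ▸ hu n)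
  obtain ⟨l, -, φ, hφ, hl⟩ := WeakDual.isSeqCompact_closedBall ℝ K 0 M hball
  let v : K := (InnerProductSpace.toDual ℝ K).symm (WeakDual.toStrongDual l)
  refine ⟨v, φ, hφ, fun y => ?_⟩
  have h1 := ((WeakDual.eval_continuous (𝕜 := ℝ) (E := K) (K.orthogonalProjectionOnto y)).tendsto l).comp hl
  have e1 : ∀ x : K, inner ℝ (x : G) y = inner ℝ x (K.orthogonalProjectionOnto y) := fun x => by
    rw [Submodule.inner_orthogonalProjectionOnto_eq_of_mem_left]
  have e2 : inner ℝ (v : G) y = l (K.orthogonalProjectionOnto y) := by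
    rw [e1, ← InnerProductSpace.toDual_apply_apply (𝕜 := ℝ)]
    simp only [v, LinearIsometryEquiv.apply_symm_apply]
    rfl
  rw [e2]
  refine h1.congr fun n => ?_
  have : inner ℝ (u (φ n)) y = inner ℝ (u' (φ n)) (K.orthogonalProjectionOnto y) := e1 (u' (φ n))
  rw [this, ← InnerProductSpace.toDual_apply_apply (𝕜 := ℝ)]
  rfl

/-- Weak lower semicontinuity of the norm, by testing against `v` itself. -/
theorem norm_le_of_tendsto_inner {G ι : Type*} [NormedAddCommGroup G] [InnerProductSpace ℝ G]
    {l : Filter ι} [l.NeBot] {u : ι → G} {v : G} {k : ι → ℝ} {K : ℝ}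
    (h : ∀ y : G, Tendsto (fun n => inner ℝ (u n) y) l (𝓝 (inner ℝ v y)))
    (hu : ∀ n, ‖u n‖ ≤ k n) (hk : Tendsto k l (𝓝 K)) : ‖v‖ ≤ K := by
  have h1 : ‖v‖ * ‖v‖ ≤ K * ‖v‖ := by
    rw [← real_inner_self_eq_norm_mul_norm]
    exact le_of_tendsto_of_tendsto' (h v) (hk.mul_const _) fun n =>
      (real_inner_le_norm _ _).trans (mul_le_mul_of_nonneg_right (hu n) (norm_nonneg _))
  by_cases hv : ‖v‖ = 0
  · rw [hv]; exact ge_of_tendsto' hk fun n => (norm_nonneg _).trans (hu n)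
  · exact le_of_mul_le_mul_right h1 (lt_of_le_of_ne (norm_nonneg _) (Ne.symm hv))

/-! ### Calculus of curves in `H¹_loc` -/

section H1loc

theorem MemH1loc.mono {L : Type*} [NormedAddCommGroup L] [InnerProductSpace ℝ L]
    {U : ℝ → L} (h : MemH1loc U univ) (O : Set ℝ) : MemH1loc U O := by
  obtain ⟨g, hg, hU⟩ := h
  exact ⟨g, fun K _ hK => hg K (subset_univ _) hK, fun s t _ => hU s t (subset_univ _)⟩

variable {L : Type*} [NormedAddCommGroup L] [InnerProductSpace ℝ L] [CompleteSpace L]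

/-- The density may change with `R`, but by Lebesgue differentiation each one equals `deriv U`
almost everywhere on its interval. Thus `deriv U` serves on the whole line. -/
theorem MemH1loc.of_local {U : ℝ → L}
    (h : ∀ R : ℝ, 0 < R → ∃ g : ℝ → L, MemLp g 2 (volume.restrict (Icc (-R) R)) ∧
      ∀ s ∈ Icc (-R) R, ∀ t ∈ Icc (-R) R, U t - U s = ∫ x in s..t, g x) :
    (∀ᵐ t, HasDerivAt U (deriv U t) t) ∧ LocallyIntegrable (deriv U) ∧
    (∀ K : Set ℝ, IsCompact K → MemLp (deriv U) 2 (volume.restrict K)) ∧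
    ∀ s t, U t - U s = ∫ x in s..t, deriv U x := by
  choose! g hg hU using h
  have hint : ∀ R, 0 < R → IntegrableOn (g R) (Icc (-R) R) := fun R hR =>
    (hg R hR).integrable (by norm_num)
  have hii : ∀ R, 0 < R → ∀ s ∈ Icc (-R) R, ∀ t ∈ Icc (-R) R,
      IntervalIntegrable (g R) volume s t := by
    intro R hR s hs t ht
    rw [intervalIntegrable_iff']
    exact (hint R hR).mono_set (by
      rw [← uIcc_of_le (by linarith : -R ≤ R)] at hs ht ⊢
      exact uIcc_subset_uIcc hs ht)
  have hd : ∀ R, 0 < R → ∀ᵐ t, t ∈ Ioo (-R) R → HasDerivAt U (g R t) t := by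
    intro R hR
    have h0 : (0:ℝ) ∈ Icc (-R) R := ⟨by linarith, hR.le⟩
    have h1 : -R ∈ Icc (-R) R := ⟨le_rfl, by linarith⟩
    have h2 : R ∈ Icc (-R) R := ⟨by linarith, le_rfl⟩
    filter_upwards [(hii R hR _ h1 _ h2).ae_hasDerivAt_integral] with t ht htm
    rw [uIcc_of_le (by linarith : -R ≤ R)] at ht
    have h3 := (ht (Ioo_subset_Icc_self htm) 0 h0).const_add (U 0)
    refine h3.congr_of_eventuallyEq ?_
    filter_upwards [Ioo_mem_nhds htm.1 htm.2] with s hs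
    rw [← hU R hR 0 h0 s (Ioo_subset_Icc_self hs)]; abel
  have hdR : ∀ R, 0 < R → g R =ᵐ[volume.restrict (Icc (-R) R)] deriv U := by
    intro R hR
    rw [← restrict_Ioo_eq_restrict_Icc]
    rw [EventuallyEq, ae_restrict_iff' measurableSet_Ioo]
    filter_upwards [hd R hR] with t ht htm using (ht htm).deriv.symm
  have hR : ∀ R, 0 < R → MemLp (deriv U) 2 (volume.restrict (Icc (-R) R)) := fun R h =>
    (hg R h).ae_eq (hdR R h)
  have hcpt : ∀ K : Set ℝ, IsCompact K → MemLp (deriv U) 2 (volume.restrict K) := by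
    intro K hK
    obtain ⟨R, hRpos, hKR⟩ : ∃ R : ℝ, 0 < R ∧ K ⊆ Icc (-R) R := by
      obtain ⟨R, hR⟩ := hK.isBounded.subset_closedBall 0
      refine ⟨max R 1, by positivity, fun x hx => ?_⟩
      have := hR hx
      rw [Metric.mem_closedBall, dist_zero_right, Real.norm_eq_abs, abs_le] at this
      constructor <;> linarith [le_max_left R 1, this.1, this.2]
    exact (hR R hRpos).mono_measure (Measure.restrict_mono hKR le_rfl)
  refine ⟨?_, ?_, hcpt, ?_⟩
  · have : ∀ n : ℕ, ∀ᵐ t, t ∈ Ioo (-((n:ℝ)+1)) ((n:ℝ)+1) → HasDerivAt U (g (n+1) t) t :=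
      fun n => hd _ (by positivity)
    filter_upwards [ae_all_iff.2 this] with t ht
    obtain ⟨n, hn⟩ := exists_nat_gt |t|
    have := ht n (abs_lt.1 (by linarith))
    exact this.differentiableAt.hasDerivAt
  · rw [locallyIntegrable_iff]
    intro K hK
    have : IsFiniteMeasure (volume.restrict K) := ⟨by simpa using hK.measure_lt_top⟩
    exact (hcpt K hK).integrable (by norm_num)
  · intro s t
    let R := max |s| |t| + 1
    have hRp : 0 < R := by positivity
    have hs : s ∈ Icc (-R) R := abs_le.1 (by simp only [R]; linarith [le_max_left |s| |t|])
    have ht : t ∈ Icc (-R) R := abs_le.1 (by simp only [R]; linarith [le_max_right |s| |t|])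
    rw [hU R hRp s hs t ht]
    apply intervalIntegral.integral_congr_ae_restrict
    refine ae_restrict_of_ae_restrict_of_subset ?_ (hdR R hRp)
    refine uIoc_subset_uIcc.trans ?_
    rw [← uIcc_of_le (by linarith : -R ≤ R)] at hs ht ⊢
    exact uIcc_subset_uIcc hs ht

theorem MemH1loc.deriv_props {U : ℝ → L} (h : MemH1loc U univ) :
    (∀ᵐ t, HasDerivAt U (deriv U t) t) ∧ LocallyIntegrable (deriv U) ∧
    (∀ K : Set ℝ, IsCompact K → MemLp (deriv U) 2 (volume.restrict K)) ∧
    ∀ s t, U t - U s = ∫ x in s..t, deriv U x := by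
  obtain ⟨g, hg, hU⟩ := h
  exact MemH1loc.of_local fun R _ => ⟨g, hg _ (subset_univ _) isCompact_Icc,
    fun s _ t _ => hU s t (subset_univ _)⟩

theorem memH1loc_of_local {U : ℝ → L}
    (h : ∀ R : ℝ, 0 < R → ∃ g : ℝ → L, MemLp g 2 (volume.restrict (Icc (-R) R)) ∧
      ∀ s ∈ Icc (-R) R, ∀ t ∈ Icc (-R) R, U t - U s = ∫ x in s..t, g x) : MemH1loc U univ :=
  have h := MemH1loc.of_local h
  ⟨deriv U, fun K _ hK => h.2.2.1 K hK, fun s t _ => h.2.2.2 s t⟩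

theorem MemH1loc.ae_hasDerivAt {U : ℝ → L} (h : MemH1loc U univ) :
    ∀ᵐ t, HasDerivAt U (deriv U t) t := h.deriv_props.1

theorem MemH1loc.locallyIntegrable {U : ℝ → L} (h : MemH1loc U univ) :
    LocallyIntegrable (deriv U) := h.deriv_props.2.1

theorem MemH1loc.intervalIntegrable {U : ℝ → L} (h : MemH1loc U univ) (s t : ℝ) :
    IntervalIntegrable (deriv U) volume s t :=
  intervalIntegrable_iff.mpr ((h.locallyIntegrable.integrableOn_isCompact isCompact_uIcc).mono_set
    uIoc_subset_uIcc)

theorem MemH1loc.memLp {U : ℝ → L} (h : MemH1loc U univ) {K : Set ℝ} (hK : IsCompact K) :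
    MemLp (deriv U) 2 (volume.restrict K) := h.deriv_props.2.2.1 K hK

theorem MemH1loc.integral_deriv {U : ℝ → L} (h : MemH1loc U univ) (s t : ℝ) :
    U t - U s = ∫ x in s..t, deriv U x := h.deriv_props.2.2.2 s t

theorem MemH1loc.continuous {U : ℝ → L} (h : MemH1loc U univ) : Continuous U := by
  have h1 : U = fun t => U 0 + ∫ x in (0:ℝ)..t, deriv U x := by
    funext t; rw [← h.integral_deriv]; abel
  rw [h1]
  exact continuous_const.add (intervalIntegral.continuous_primitive (fun a b => h.intervalIntegrable a b) 0)

theorem MemH1loc.add {U V : ℝ → L} (hU : MemH1loc U univ) (hV : MemH1loc V univ) :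
    MemH1loc (fun t => U t + V t) univ := by
  refine ⟨fun t => deriv U t + deriv V t, fun K _ hK => (hU.memLp hK).add (hV.memLp hK),
    fun s t _ => ?_⟩
  rw [intervalIntegral.integral_add (hU.intervalIntegrable s t) (hV.intervalIntegrable s t),
    ← hU.integral_deriv, ← hV.integral_deriv, add_sub_add_comm]

theorem _root_.ContDiff.memH1loc {U : ℝ → L} (h : ContDiff ℝ 1 U) : MemH1loc U univ := by
  have hc : Continuous (deriv U) := h.continuous_deriv le_rfl
  refine ⟨deriv U, fun K _ hK => ?_, fun s t _ => ?_⟩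
  · have : IsFiniteMeasure (volume.restrict K) := ⟨by simpa using hK.measure_lt_top⟩
    obtain ⟨C, hC⟩ := hK.exists_bound_of_continuousOn hc.continuousOn
    refine MemLp.of_bound (stronglyMeasurable_deriv U).aestronglyMeasurable C ?_
    exact (ae_restrict_iff' hK.measurableSet).2 (Eventually.of_forall hC)
  · rw [intervalIntegral.integral_deriv_eq_sub (fun x _ => h.differentiable (by norm_num) x)
      (hc.intervalIntegrable _ _)]

theorem MemH1loc.glue {U V : ℝ → L} (hU : MemH1loc U univ) (hV : MemH1loc V univ) {t₀ : ℝ}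
    (h0 : U t₀ = V t₀) : MemH1loc (fun t => if t ≤ t₀ then U t else V t) univ := by
  set W : ℝ → L := fun t => if t ≤ t₀ then U t else V t with hW
  set g : ℝ → L := fun t => (Iic t₀).indicator (deriv U) t + (Ioi t₀).indicator (deriv V) t with hg
  have hgi : ∀ s t, IntervalIntegrable g volume s t := fun s t => by
    have h1 := hU.intervalIntegrable s t
    have h2 := hV.intervalIntegrable s t
    rw [intervalIntegrable_iff] at h1 h2 ⊢
    exact (h1.indicator measurableSet_Iic).add (h2.indicator measurableSet_Ioi)
  have key : ∀ t, W t - W t₀ = ∫ x in t₀..t, g x := by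
    intro t
    by_cases ht : t ≤ t₀
    · simp only [hW, ht, if_true, le_refl]
      rw [hU.integral_deriv]
      refine intervalIntegral.integral_congr_uIoo fun x hx => ?_
      rw [uIoo_of_ge ht] at hx
      simp [hg, indicator, hx.2.le, not_lt.2 hx.2.le]
    · simp only [hW, ht, if_false, le_refl, if_true]
      rw [h0, hV.integral_deriv]
      refine intervalIntegral.integral_congr_uIoo fun x hx => ?_
      rw [uIoo_of_le (le_of_not_ge ht)] at hx
      simp [hg, indicator, hx.1, not_le.2 hx.1]
  refine ⟨g, fun K _ hK => ((hU.memLp hK).indicator measurableSet_Iic).add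
    ((hV.memLp hK).indicator measurableSet_Ioi), fun s t _ => ?_⟩
  rw [← intervalIntegral.integral_interval_sub_left (hgi t₀ t) (hgi t₀ s), ← key, ← key]
  abel

end H1loc

/-! ### Cauchy-Schwarz, and curves with dominated increments -/

/-- Cauchy-Schwarz for the Lebesgue integral. -/
theorem sq_lintegral_mul_le {α : Type*} [MeasurableSpace α] {μ : Measure α} {f g : α → ENNReal}
    (hf : AEMeasurable f μ) (hg : AEMeasurable g μ) :
    (∫⁻ x, f x * g x ∂μ) ^ 2 ≤ (∫⁻ x, f x ^ 2 ∂μ) * ∫⁻ x, g x ^ 2 ∂μ := by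
  have h := ENNReal.lintegral_mul_le_Lp_mul_Lq μ Real.HolderConjugate.two_two hf hg
  have e : ∀ x : ENNReal, (x ^ (1 / (2:ℝ))) ^ 2 = x := fun x => by
    rw [← ENNReal.rpow_natCast, ← ENNReal.rpow_mul]; norm_num
  simp only [ENNReal.rpow_two] at h
  calc _ ≤ ((∫⁻ x, f x ^ 2 ∂μ) ^ (1 / (2:ℝ)) * (∫⁻ x, g x ^ 2 ∂μ) ^ (1 / (2:ℝ))) ^ 2 :=
        pow_le_pow_left' h 2
    _ = _ := by rw [mul_pow, e, e]

theorem sq_lintegral_le {α : Type*} [MeasurableSpace α] {μ : Measure α} {f : α → ENNReal}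
    (hf : AEMeasurable f μ) : (∫⁻ x, f x ∂μ) ^ 2 ≤ μ univ * ∫⁻ x, f x ^ 2 ∂μ := by
  simpa using sq_lintegral_mul_le (f := fun _ => 1) aemeasurable_const hf

section H1loc

variable {L : Type*} [NormedAddCommGroup L] [InnerProductSpace ℝ L] [CompleteSpace L]

theorem MemH1loc.enorm_sub_le {U : ℝ → L} (h : MemH1loc U univ) {s t : ℝ} (hst : s ≤ t) :
    ‖U t - U s‖ₑ ≤ ∫⁻ x in Ioc s t, ‖deriv U x‖ₑ := by
  rw [h.integral_deriv, intervalIntegral.integral_of_le hst]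
  exact enorm_integral_le_lintegral_enorm _

theorem lintegral_sq_deriv_lt_top {U : ℝ → L} (h : MemH1loc U univ) {K : Set ℝ} (hK : IsCompact K) :
    ∫⁻ x in K, ‖deriv U x‖ₑ ^ 2 < ⊤ := by
  have h1 := (h.memLp hK).2
  have h2 := lintegral_rpow_enorm_lt_top_of_eLpNorm_lt_top (p := 2) (by norm_num) (by norm_num) h1
  simpa using h2

theorem aemeasurable_enorm_deriv (U : ℝ → L) (μ : Measure ℝ) :
    AEMeasurable (fun x => ‖deriv U x‖ₑ) μ :=
  (stronglyMeasurable_deriv U).enorm.aemeasurable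

theorem measurable_enorm_deriv (U : ℝ → L) : Measurable (fun x => ‖deriv U x‖ₑ) :=
  (stronglyMeasurable_deriv U).enorm

/-- A curve whose increments are dominated by those of an `H¹_loc` curve is itself in `H¹_loc`. -/
theorem MemH1loc.of_norm_sub_le {V f : ℝ → L} (hV : MemH1loc V univ)
    (hf : ∀ s t, ‖f t - f s‖ ≤ ‖V t - V s‖) : MemH1loc f univ := by
  have hfc : Continuous f := by
    rw [continuous_iff_continuousAt]
    intro s
    rw [ContinuousAt, tendsto_iff_norm_sub_tendsto_zero]
    refine squeeze_zero (fun _ => norm_nonneg _) (fun t => hf s t) ?_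
    exact tendsto_iff_norm_sub_tendsto_zero.1 (hV.continuous.tendsto s)
  refine memH1loc_of_local fun R hR => ?_
  set μ := volume.restrict (Icc (-R) R) with hμ
  have hfin : IsFiniteMeasure μ := ⟨by simp [hμ]⟩
  set φ : ℝ → ENNReal := (Icc (-R) (R + 1)).indicator (fun x => ‖deriv V x‖ₑ ^ 2) with hφ
  have hφm : Measurable φ := ((measurable_enorm_deriv V).pow_const 2).indicator measurableSet_Icc
  have hφfin : ∫⁻ x, φ x < ⊤ := by
    rw [hφ, lintegral_indicator measurableSet_Icc]
    exact lintegral_sq_deriv_lt_top hV isCompact_Icc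
  -- With steps `h n ≤ 1`, the difference quotients of `f` are bounded in `L²` of `[-R, R]` by the
  -- derivative of `V` on `[-R, R + 1]`. A weak limit of them is the required density.
  let h : ℕ → ℝ := fun n => 1 / ((n:ℝ) + 1)
  have hpos : ∀ n, 0 < h n := fun n => by positivity
  have hle : ∀ n, h n ≤ 1 := fun n => by
    simp only [h]; rw [div_le_one (by positivity)]; linarith [(Nat.cast_nonneg n : (0:ℝ) ≤ n)]
  let D : ℕ → ℝ → L := fun n t => (h n)⁻¹ • (f (t + h n) - f t)
  have hDc : ∀ n, Continuous (D n) := fun n => by fun_prop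
  have hDb : ∀ n, ∀ t ∈ Icc (-R) R, ‖D n t‖ₑ ^ 2 ≤
      ENNReal.ofReal (h n)⁻¹ * ∫⁻ u in Ioc 0 (h n), φ (u + t) := by
    intro n t ht
    have h1 : ‖f (t + h n) - f t‖ₑ ^ 2 ≤
        ENNReal.ofReal (h n) * ∫⁻ x in Ioc t (t + h n), ‖deriv V x‖ₑ ^ 2 := by
      have h2 : ‖f (t + h n) - f t‖ₑ ≤ ‖V (t + h n) - V t‖ₑ := by
        rw [enorm_le_iff_norm_le]; exact hf _ _
      have h3 := hV.enorm_sub_le (by linarith [hpos n] : t ≤ t + h n)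
      refine (pow_le_pow_left' (h2.trans h3) 2).trans ?_
      refine (sq_lintegral_le (aemeasurable_enorm_deriv V _)).trans ?_
      simp
    have h4 : ∫⁻ x in Ioc t (t + h n), ‖deriv V x‖ₑ ^ 2 = ∫⁻ u in Ioc 0 (h n), φ (u + t) := by
      have h5 : ∫⁻ u in Ioc 0 (h n), φ (u + t) =
          ∫⁻ u, (Ioc t (t + h n)).indicator φ (u + t) := by
        rw [← lintegral_indicator measurableSet_Ioc]
        refine lintegral_congr fun u => ?_
        simp only [indicator, mem_Ioc]
        congr 1
        exact propext ⟨fun h => ⟨by linarith [h.1], by linarith [h.2]⟩,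
          fun h => ⟨by linarith [h.1], by linarith [h.2]⟩⟩
      rw [h5, lintegral_add_right_eq_self (μ := volume) _ t, lintegral_indicator measurableSet_Ioc]
      refine setLIntegral_congr_fun measurableSet_Ioc fun x hx => ?_
      have : x ∈ Icc (-R) (R + 1) := ⟨by linarith [hx.1, ht.1], by linarith [hx.2, ht.2, hle n]⟩
      simp [hφ, this]
    rw [← h4]
    simp only [D, enorm_smul, mul_pow]
    have e1 : ‖(h n)⁻¹‖ₑ = ENNReal.ofReal (h n)⁻¹ :=
      Real.enorm_eq_ofReal (inv_nonneg.2 (hpos n).le)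
    rw [e1]
    calc _ ≤ ENNReal.ofReal (h n)⁻¹ ^ 2 *
          (ENNReal.ofReal (h n) * ∫⁻ x in Ioc t (t + h n), ‖deriv V x‖ₑ ^ 2) := by gcongr
      _ = _ := by
        rw [← mul_assoc, pow_two, mul_assoc (ENNReal.ofReal (h n)⁻¹), ← ENNReal.ofReal_mul
          (inv_nonneg.2 (hpos n).le), inv_mul_cancel₀ (hpos n).ne']
        simp
  have hDI : ∀ n, ∫⁻ t, ‖D n t‖ₑ ^ 2 ∂μ ≤ ∫⁻ x, φ x := by
    intro n
    calc ∫⁻ t, ‖D n t‖ₑ ^ 2 ∂μ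
        ≤ ∫⁻ t, (ENNReal.ofReal (h n)⁻¹ * ∫⁻ u in Ioc 0 (h n), φ (u + t)) ∂μ :=
          by rw [hμ]; exact setLIntegral_mono' measurableSet_Icc (hDb n)
      _ ≤ ∫⁻ t, ENNReal.ofReal (h n)⁻¹ * ∫⁻ u in Ioc 0 (h n), φ (u + t) :=
          by rw [hμ]; exact lintegral_mono' Measure.restrict_le_self le_rfl
      _ = ENNReal.ofReal (h n)⁻¹ * ∫⁻ u in Ioc 0 (h n), ∫⁻ t, φ (u + t) := by
          rw [lintegral_const_mul' _ _ ENNReal.ofReal_ne_top, lintegral_lintegral_swap]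
          exact (hφm.comp (measurable_snd.add measurable_fst)).aemeasurable
      _ = ENNReal.ofReal (h n)⁻¹ * (ENNReal.ofReal (h n) * ∫⁻ x, φ x) := by
          congr 1
          have : ∀ u, ∫⁻ t, φ (u + t) = ∫⁻ x, φ x := fun u => lintegral_add_left_eq_self φ u
          simp [this, mul_comm]
      _ = ∫⁻ x, φ x := by
          rw [← mul_assoc, ← ENNReal.ofReal_mul (inv_nonneg.2 (hpos n).le),
            inv_mul_cancel₀ (hpos n).ne']
          simp
  have hDL : ∀ n, MemLp (D n) 2 μ := fun n => by
    obtain ⟨C, hC⟩ := (isCompact_Icc (a := -R) (b := R)).exists_bound_of_continuousOn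
      (hDc n).continuousOn
    exact MemLp.of_bound (hDc n).aestronglyMeasurable C
      ((ae_restrict_iff' measurableSet_Icc).2 (Eventually.of_forall hC))
  let u : ℕ → Lp L 2 μ := fun n => (hDL n).toLp (D n)
  have hu : ∀ n, ‖u n‖ ≤ ((∫⁻ x, φ x) ^ (1 / (2:ℝ))).toReal := by
    intro n
    rw [Lp.norm_toLp]
    refine ENNReal.toReal_mono (ENNReal.rpow_ne_top_of_nonneg (by norm_num) hφfin.ne) ?_
    rw [eLpNorm_eq_lintegral_rpow_enorm_toReal (by norm_num) (by norm_num)]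
    simp only [ENNReal.toReal_ofNat, ENNReal.rpow_two]
    exact ENNReal.rpow_le_rpow (hDI n) (by norm_num)
  obtain ⟨g, ψ, hψ, hg⟩ := exists_subseq_tendsto_inner u _ hu
  refine ⟨g, Lp.memLp g, ?_⟩
  have main : ∀ s ∈ Icc (-R) R, ∀ t ∈ Icc (-R) R, s ≤ t → f t - f s = ∫ x in s..t, g x := by
    intro s hs t ht hst
    refine ext_inner_left ℝ fun z => ?_
    have hsub : Ioc s t ⊆ Icc (-R) R := fun x hx => ⟨hs.1.trans hx.1.le, hx.2.trans ht.2⟩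
    have hres : μ.restrict (Ioc s t) = volume.restrict (Ioc s t) := by
      rw [hμ, Measure.restrict_restrict measurableSet_Ioc, inter_eq_left.2 hsub]
    have hlim := hg (indicatorConstLp 2 (measurableSet_Ioc (a := s) (b := t)) (measure_ne_top μ _) z)
    have e1 : ∀ w : Lp L 2 μ, inner ℝ w (indicatorConstLp 2 (measurableSet_Ioc (a := s) (b := t))
        (measure_ne_top μ _) z) = inner ℝ z (∫ x in s..t, w x) := by
      intro w
      rw [real_inner_comm, L2.inner_indicatorConstLp_eq_inner_setIntegral,
        intervalIntegral.integral_of_le hst]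
      exact congrArg (fun m => inner ℝ z (∫ x, w x ∂m)) hres
    have e2 : ∀ n, ∫ x in s..t, u n x = ∫ x in s..t, D n x := by
      intro n
      rw [intervalIntegral.integral_of_le hst, intervalIntegral.integral_of_le hst]
      exact integral_congr_ae (ae_restrict_of_ae_restrict_of_subset hsub (hDL n).coeFn_toLp)
    simp only [e1, e2] at hlim
    have hFd : ∀ x, HasDerivAt (fun x => ∫ y in (0:ℝ)..x, f y) (f x) x := fun x =>
      (hfc.integral_hasStrictDerivAt 0 x).hasDerivAt
    have hh0 : Tendsto h atTop (𝓝[≠] 0) := by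
      refine tendsto_nhdsWithin_iff.2 ⟨tendsto_one_div_add_atTop_nhds_zero_nat, ?_⟩
      exact Eventually.of_forall fun n => (hpos n).ne'
    have hslope : ∀ x, Tendsto (fun n => (h n)⁻¹ • ((∫ y in (0:ℝ)..(x + h n), f y) -
        ∫ y in (0:ℝ)..x, f y)) atTop (𝓝 (f x)) := fun x =>
      ((hasDerivAt_iff_tendsto_slope_zero.1 (hFd x)).comp hh0)
    -- The integral of a difference quotient of `f` is a difference of two difference quotients of
    -- its primitive, at `t` and at `s`; hence it tends to `f t - f s`.
    have hDint : ∀ n, ∫ x in s..t, D n x = (h n)⁻¹ • ((∫ y in (0:ℝ)..(t + h n), f y) -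
        ∫ y in (0:ℝ)..t, f y) - (h n)⁻¹ • ((∫ y in (0:ℝ)..(s + h n), f y) -
        ∫ y in (0:ℝ)..s, f y) := by
      intro n
      have ii : ∀ a b, IntervalIntegrable f volume a b := fun a b => hfc.intervalIntegrable a b
      have hci : IntervalIntegrable (fun x => f (x + h n)) volume s t :=
        (hfc.comp (continuous_id.add continuous_const)).intervalIntegrable _ _
      simp only [D]
      rw [intervalIntegral.integral_smul, intervalIntegral.integral_sub hci (ii _ _),
        intervalIntegral.integral_comp_add_right (fun x => f x),
        ← intervalIntegral.integral_interval_sub_left (ii 0 (t + h n)) (ii 0 (s + h n)),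
        ← intervalIntegral.integral_interval_sub_left (ii 0 t) (ii 0 s), ← smul_sub]
      congr 1; abel
    have hl2 : Tendsto (fun n => inner ℝ z (∫ x in s..t, D (ψ n) x)) atTop
        (𝓝 (inner ℝ z (f t - f s))) := by
      refine Tendsto.inner tendsto_const_nhds ?_
      refine Tendsto.comp (g := fun n => ∫ x in s..t, D n x) ?_ hψ.tendsto_atTop
      simp only [hDint]
      exact (hslope t).sub (hslope s)
    exact tendsto_nhds_unique hl2 hlim
  intro s hs t ht
  rcases le_total s t with hst | hst
  · exact main s hs t ht hst
  · rw [intervalIntegral.integral_symm, ← main t ht s hs hst]; abel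

/-- Slopes are compared where `f` is differentiable; elsewhere `deriv f` is zero by convention. -/
theorem norm_deriv_le_of_norm_sub_le {L : Type*} [NormedAddCommGroup L] [InnerProductSpace ℝ L]
    {V f : ℝ → L} (hf : ∀ s t, ‖f t - f s‖ ≤ ‖V t - V s‖) {t : ℝ}
    (hV : DifferentiableAt ℝ V t) : ‖deriv f t‖ ≤ ‖deriv V t‖ := by
  by_cases h : DifferentiableAt ℝ f t
  · refine le_of_tendsto_of_tendsto (hasDerivAt_iff_tendsto_slope.1 h.hasDerivAt).norm
      (hasDerivAt_iff_tendsto_slope.1 hV.hasDerivAt).norm (Eventually.of_forall fun s => ?_)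
    simp only [slope, vsub_eq_sub, norm_smul]
    gcongr
    exact hf t s
  · rw [deriv_zero_of_not_differentiableAt h, norm_zero]; exact norm_nonneg _

theorem MemH1loc.ae_norm_deriv_le {V f : ℝ → L} (hV : MemH1loc V univ)
    (hf : ∀ s t, ‖f t - f s‖ ≤ ‖V t - V s‖) : ∀ᵐ t, ‖deriv f t‖ ≤ ‖deriv V t‖ := by
  filter_upwards [hV.ae_hasDerivAt] with t ht using
    norm_deriv_le_of_norm_sub_le hf ht.differentiableAt

theorem MemH1loc.comp_affine {U : ℝ → L} (hU : MemH1loc U univ) {l : ℝ} (hl : l ≠ 0) (b : ℝ) :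
    MemH1loc (fun t => U (l * t + b)) univ := by
  have hsm : StronglyMeasurable (fun t => l • deriv U (l * t + b)) :=
    ((stronglyMeasurable_deriv U).comp_measurable (by fun_prop)).const_smul l
  refine memH1loc_of_local fun R hR => ⟨fun t => l • deriv U (l * t + b), ?_, ?_⟩
  · rw [memLp_two_iff_integrable_sq_norm hsm.aestronglyMeasurable]
    have h1 : IntervalIntegrable (fun t => ‖deriv U t‖ ^ 2) volume (l * (-R) + b) (l * R + b) := by
      rw [intervalIntegrable_iff']
      exact (hU.memLp isCompact_uIcc).integrable_norm_pow (by norm_num)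
    have h2 : IntervalIntegrable (fun t => ‖deriv U (l * t + b)‖ ^ 2) volume (-R) R := by
      have := (h1.comp_add_right b).comp_mul_left (c := l)
      simpa [hl, neg_div] using this
    have h3 := (intervalIntegrable_iff_integrableOn_Icc_of_le (by linarith)).1 h2
    simp only [norm_smul, mul_pow]
    exact h3.const_mul _
  · intro s _ t _
    rw [intervalIntegral.integral_smul, intervalIntegral.integral_comp_mul_add _ hl, smul_smul,
      mul_inv_cancel₀ hl, one_smul, hU.integral_deriv]

end H1loc

/-! ### Exponential integrals and extended-real arithmetic -/

theorem lintegral_comp_affine {F : ℝ → ENNReal} {l : ℝ} (hl : 0 < l) (b : ℝ) :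
    ∫⁻ t, F (l * t + b) = ENNReal.ofReal l⁻¹ * ∫⁻ t, F t := by
  have h := lintegral_map_equiv (μ := volume) (fun t => F (t + b)) (MeasurableEquiv.mulLeft₀ l hl.ne')
  have e : Measure.map (MeasurableEquiv.mulLeft₀ l hl.ne') volume =
      ENNReal.ofReal l⁻¹ • (volume : Measure ℝ) := by
    have := Real.map_volume_mul_left hl.ne'
    rw [abs_of_pos (inv_pos.2 hl)] at this
    exact this
  rw [e, lintegral_smul_measure, lintegral_add_right_eq_self F b] at h
  simpa using h.symm

theorem lintegral_exp_Iic {c : ℝ} (hc : 0 < c) (T : ℝ) :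
    ∫⁻ t in Iic T, ENNReal.ofReal (Real.exp (c * t)) = ENNReal.ofReal (Real.exp (c * T) / c) := by
  rw [← ofReal_integral_eq_lintegral_ofReal (integrableOn_exp_mul_Iic hc T)
    (Eventually.of_forall fun t => (Real.exp_pos _).le), integral_exp_mul_Iic hc]

theorem lintegral_exp_neg_Ioi {c : ℝ} (hc : 0 < c) (T : ℝ) :
    ∫⁻ t in Ioi T, ENNReal.ofReal (Real.exp (-c * t)) = ENNReal.ofReal (Real.exp (-c * T) / c) := by
  rw [← ofReal_integral_eq_lintegral_ofReal (integrableOn_exp_mul_Ioi (neg_lt_zero.2 hc) T)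
    (Eventually.of_forall fun t => (Real.exp_pos _).le), integral_exp_mul_Ioi (neg_lt_zero.2 hc),
    neg_div_neg_eq]

theorem EReal.cases_of_coe_le {x : EReal} {a : ℝ} (hx : (a : EReal) ≤ x) :
    x = ⊤ ∨ ∃ e : ℝ, x = e ∧ a ≤ e := by
  induction x with
  | bot => simp at hx
  | top => exact Or.inl rfl
  | coe e => exact Or.inr ⟨e, rfl, EReal.coe_le_coe_iff.1 hx⟩

theorem toENNReal_coe_real (x : ℝ) : (x : EReal).toENNReal = ENNReal.ofReal x := by simp

/-- With `f = (k + x) w` this reads `f⁺ + w(-a) = wk + w(x - a) + f⁻`. Sums alone occur, so the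
identity includes `x = ⊤` and can be integrated before any finiteness is known. -/
theorem posPart_add_eq {k w a : ℝ} (hk : 0 ≤ k) (hw : 0 < w) (ha : a ≤ 0) {x : EReal}
    (hx : (a : EReal) ≤ x) :
    (((k : EReal) + x) * (w : EReal)).toENNReal + ENNReal.ofReal (w * -a) =
      ENNReal.ofReal (w * k) + ENNReal.ofReal w * (x - (a : EReal)).toENNReal +
        (-(((k : EReal) + x) * (w : EReal))).toENNReal := by
  rcases EReal.cases_of_coe_le hx with rfl | ⟨e, rfl, he⟩
  · rw [EReal.coe_add_top, EReal.top_mul_coe_of_pos hw, EReal.top_sub_coe]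
    simp [ENNReal.mul_top, hw]
  · rw [← EReal.coe_add, ← EReal.coe_mul, ← EReal.coe_sub, ← EReal.coe_neg, toENNReal_coe_real,
      toENNReal_coe_real, toENNReal_coe_real, ← ENNReal.ofReal_mul hw.le]
    rcases le_total 0 ((k + e) * w) with h | h
    · rw [ENNReal.ofReal_of_nonpos (p := -((k + e) * w)) (by linarith), add_zero,
        ← ENNReal.ofReal_add h (by nlinarith), ← ENNReal.ofReal_add (by positivity) (by nlinarith)]
      congr 1; ring
    · rw [ENNReal.ofReal_of_nonpos h, zero_add, ← ENNReal.ofReal_add (by positivity) (by nlinarith),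
        ← ENNReal.ofReal_add (by nlinarith) (by linarith)]
      congr 1; ring

theorem posPart_le {k w : ℝ} (hw : 0 < w) {x : EReal} :
    (((k : EReal) + x) * (w : EReal)).toENNReal ≤
      ENNReal.ofReal (w * k) + ENNReal.ofReal w * x.toENNReal := by
  have hw' : (0 : EReal) ≤ w := EReal.coe_nonneg.2 hw.le
  rw [EReal.toENNReal_mul' hw', toENNReal_coe_real, ENNReal.ofReal_mul hw.le, ← mul_add, mul_comm]
  gcongr
  refine EReal.toENNReal_add_le.trans ?_
  rw [toENNReal_coe_real]

theorem posPart_eq {k w : ℝ} (hk : 0 ≤ k) (hw : 0 < w) {x : EReal} (hx : 0 ≤ x) :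
    (((k : EReal) + x) * (w : EReal)).toENNReal =
      ENNReal.ofReal (w * k) + ENNReal.ofReal w * x.toENNReal ∧
    (-(((k : EReal) + x) * (w : EReal))).toENNReal = 0 := by
  have hw' : (0 : EReal) ≤ w := EReal.coe_nonneg.2 hw.le
  have hk' : (0 : EReal) ≤ k := EReal.coe_nonneg.2 hk
  constructor
  · rw [EReal.toENNReal_mul' hw', toENNReal_coe_real, ENNReal.ofReal_mul hw.le, ← mul_add, mul_comm,
      EReal.toENNReal_add hk' hx, toENNReal_coe_real]
  · apply EReal.toENNReal_of_nonpos
    rw [EReal.neg_le, neg_zero]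
    exact mul_nonneg (add_nonneg hk' hx) hw'

set_option linter.unusedSectionVars false

/-! ### The renormalized form of the energy -/

namespace Setting

variable {L H Ht : Type*} [NormedAddCommGroup L] [InnerProductSpace ℝ L] [CompleteSpace L]
  [NormedAddCommGroup H] [InnerProductSpace ℝ H]
  [NormedAddCommGroup Ht] [InnerProductSpace ℝ Ht]
  {S : Setting L H Ht}

/-- The density of the weighted kinetic energy. -/
noncomputable def kdens (c : ℝ) (U : ℝ → L) (t : ℝ) : ENNReal :=
  ENNReal.ofReal (Real.exp (c * t) * (‖deriv U t‖ ^ 2 / 2))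

/-- The density of the weighted potential energy, relative to the level `a` before time `T`; after
time `T` negative values of the potential are ignored. -/
noncomputable def pdens (S : Setting L H Ht) (c T : ℝ) (U : ℝ → L) (t : ℝ) : ENNReal :=
  ENNReal.ofReal (Real.exp (c * t)) *
    (if t ≤ T then (S.pot (U t) - (S.a : EReal)).toENNReal else (S.pot (U t)).toENNReal)

/-- The weighted kinetic energy. -/
noncomputable def kin (c : ℝ) (U : ℝ → L) : ENNReal := ∫⁻ t, kdens c U t

/-- The renormalized potential energy. -/
noncomputable def potE (S : Setting L H Ht) (c T : ℝ) (U : ℝ → L) : ENNReal :=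
  ∫⁻ t, S.pdens c T U t

theorem Unbalanced.lsc (h : S.Unbalanced) : LowerSemicontinuous S.pot := by
  rw [lowerSemicontinuous_iff_isClosed_preimage]
  intro y
  apply IsSeqClosed.isClosed
  intro x p hx hp
  refine (h.weakly_lsc x p fun z => hp.inner tendsto_const_nhds).trans ?_
  exact liminf_le_of_frequently_le' (Frequently.of_forall hx)

theorem Unbalanced.measurable_pot_comp (h : S.Unbalanced) {U : ℝ → L} (hU : Continuous U) :
    Measurable fun t => S.pot (U t) :=
  (h.lsc.comp hU).measurable

theorem measurable_kdens (c : ℝ) (U : ℝ → L) : Measurable (kdens c U) := by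
  have := (stronglyMeasurable_deriv U).norm.measurable
  unfold kdens
  fun_prop

theorem toENNReal_sub_mono (a : ℝ) : Monotone fun x : EReal => (x - (a : EReal)).toENNReal :=
  fun _ _ h => EReal.toENNReal_le_toENNReal (EReal.sub_le_sub h le_rfl)

theorem Unbalanced.measurable_pdens (h : S.Unbalanced) (c T : ℝ) {U : ℝ → L} (hU : Continuous U) :
    Measurable (S.pdens c T U) := by
  have h1 := h.measurable_pot_comp hU
  have h2 : Monotone EReal.toENNReal := fun _ _ h => EReal.toENNReal_le_toENNReal h
  refine Measurable.mul (by fun_prop) (Measurable.ite measurableSet_Iic ?_ ?_)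
  · exact (toENNReal_sub_mono S.a).measurable.comp h1
  · exact h2.measurable.comp h1

theorem lintegral_neg_level {c : ℝ} (hc : 0 < c) (T a : ℝ) (ha : a ≤ 0) :
    ∫⁻ t, (if t ≤ T then ENNReal.ofReal (Real.exp (c * t) * -a) else 0) =
      ENNReal.ofReal (-a * Real.exp (c * T) / c) := by
  have h1 : (fun t => if t ≤ T then ENNReal.ofReal (Real.exp (c * t) * -a) else 0) =
      (Iic T).indicator fun t => ENNReal.ofReal (-a) * ENNReal.ofReal (Real.exp (c * t)) := by
    funext t
    simp only [indicator, mem_Iic]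
    split_ifs
    · rw [← ENNReal.ofReal_mul (by linarith), mul_comm]
    · rfl
  rw [h1, lintegral_indicator measurableSet_Iic, lintegral_const_mul' _ _ ENNReal.ofReal_ne_top,
    lintegral_exp_Iic hc, ← ENNReal.ofReal_mul (by linarith)]
  congr 1; ring

/-- Only `A` has to be finite: for `n = ⊤` the left side is `⊥` by the convention on `⊤ - ⊤`. -/
theorem ereal_sub_le_of_add_le {P A D n : ENNReal} (hA : A ≠ ⊤) (h : P + A ≤ D + n) :
    (P : EReal) - (n : EReal) ≤ (D : EReal) - (A : EReal) := by
  by_cases hn : n = ⊤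
  · simp [hn]
  by_cases hD : D = ⊤
  · lift A to NNReal using hA
    rw [hD]
    have : ((⊤ : ENNReal) : EReal) - ((A : ENNReal) : EReal) = ⊤ := by
      rw [EReal.coe_ennreal_top]; exact EReal.top_sub_coe A
    rw [this]; exact le_top
  have hP : P ≠ ⊤ := fun hP => by
    rw [hP, top_add, top_le_iff] at h
    exact ENNReal.add_ne_top.2 ⟨hD, hn⟩ h
  lift P to NNReal using hP
  lift A to NNReal using hA
  lift D to NNReal using hD
  lift n to NNReal using hn
  have h' : P + A ≤ D + n := by exact_mod_cast h
  have h2 : (P : ℝ) + A ≤ D + n := by exact_mod_cast h'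
  simp only [EReal.coe_nnreal_eq_coe_real]
  rw [← EReal.coe_sub, ← EReal.coe_sub, EReal.coe_le_coe_iff]
  linarith

theorem ereal_sub_eq_of_add_eq {P A D n : ENNReal} (hA : A ≠ ⊤) (hn : n ≠ ⊤) (h : P + A = D + n) :
    (P : EReal) - (n : EReal) = (D : EReal) - (A : EReal) :=
  le_antisymm (ereal_sub_le_of_add_le hA h.le)
    (ereal_sub_le_of_add_le hn h.ge)

/-- Discarding negative values of the potential after `T` can only raise the right side, so every
`T` is allowed. This is the form used for the weak limit, where the sign of the potential after time
zero is not known. -/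
theorem Unbalanced.energy_le (h : S.Unbalanced) {c : ℝ} (hc : 0 < c) (T : ℝ) {U : ℝ → L}
    (hU : Continuous U) :
    S.energy c U ≤ ((kin c U + S.potE c T U : ENNReal) : EReal) -
      (ENNReal.ofReal (-S.a * Real.exp (c * T) / c) : EReal) := by
  have hm : Measurable fun t : ℝ => if t ≤ T then ENNReal.ofReal (Real.exp (c * t) * -S.a) else 0 :=
    Measurable.ite measurableSet_Iic (by fun_prop) measurable_const
  have hkp : Measurable fun t => kdens c U t + S.pdens c T U t :=
    (measurable_kdens c U).add (h.measurable_pdens c T hU)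
  unfold energy energyOn
  rw [Measure.restrict_univ, ← lintegral_neg_level hc T S.a h.a_neg.le]
  refine ereal_sub_le_of_add_le ?_ ?_
  · rw [lintegral_neg_level hc T S.a h.a_neg.le]; exact ENNReal.ofReal_ne_top
  rw [← lintegral_add_right _ hm, kin, potE, ← lintegral_add_left (measurable_kdens c U),
    ← lintegral_add_left hkp]
  refine lintegral_mono fun t => ?_
  simp only [density, kdens, pdens]
  split_ifs
  · exact (posPart_add_eq (by positivity) (Real.exp_pos _) h.a_neg.le (h.a_le _)).le
  · rw [add_zero]
    exact (posPart_le (Real.exp_pos _)).trans le_self_add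

/-- The negative part of the density vanishes after `T` and is dominated before by the integrable
`-a e^{ct}`. No indeterminate difference can therefore occur. -/
theorem Unbalanced.energy_eq (h : S.Unbalanced) {c : ℝ} (hc : 0 < c) {T : ℝ} {U : ℝ → L}
    (hU : Continuous U) (hT : ∀ t, T < t → 0 ≤ S.pot (U t)) :
    S.energy c U = ((kin c U + S.potE c T U : ENNReal) : EReal) -
      (ENNReal.ofReal (-S.a * Real.exp (c * T) / c) : EReal) := by
  have hm : Measurable fun t : ℝ => if t ≤ T then ENNReal.ofReal (Real.exp (c * t) * -S.a) else 0 :=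
    Measurable.ite measurableSet_Iic (by fun_prop) measurable_const
  have hA : ∫⁻ t, (if t ≤ T then ENNReal.ofReal (Real.exp (c * t) * -S.a) else 0) ≠ ⊤ := by
    rw [lintegral_neg_level hc T S.a h.a_neg.le]; exact ENNReal.ofReal_ne_top
  have hkp : Measurable fun t => kdens c U t + S.pdens c T U t :=
    (measurable_kdens c U).add (h.measurable_pdens c T hU)
  unfold energy energyOn
  rw [Measure.restrict_univ, ← lintegral_neg_level hc T S.a h.a_neg.le]
  refine ereal_sub_eq_of_add_eq hA ?_ ?_
  · refine ne_top_of_le_ne_top hA (lintegral_mono fun t => ?_)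
    simp only [density]
    split_ifs with ht
    · rcases EReal.cases_of_coe_le (h.a_le (U t)) with e | ⟨e, he, hae⟩
      · rw [e, EReal.coe_add_top, EReal.top_mul_coe_of_pos (Real.exp_pos _)]; simp
      · rw [he, ← EReal.coe_add, ← EReal.coe_mul, ← EReal.coe_neg, toENNReal_coe_real]
        refine ENNReal.ofReal_le_ofReal ?_
        nlinarith [Real.exp_pos (c * t), sq_nonneg ‖deriv U t‖]
    · exact (posPart_eq (by positivity) (Real.exp_pos _) (hT t (not_le.1 ht))).2.le
  rw [← lintegral_add_right _ hm, kin, potE, ← lintegral_add_left (measurable_kdens c U),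
    ← lintegral_add_left hkp]
  refine lintegral_congr fun t => ?_
  simp only [density, kdens, pdens]
  split_ifs with ht
  · exact posPart_add_eq (by positivity) (Real.exp_pos _) h.a_neg.le (h.a_le _)
  · have := posPart_eq (k := ‖deriv U t‖ ^ 2 / 2) (by positivity) (Real.exp_pos (c * t))
      (hT t (not_le.1 ht))
    rw [this.1, this.2]

theorem ereal_sub_neg_iff {D A : ENNReal} (hA : A ≠ ⊤) : (D : EReal) - (A : EReal) < 0 ↔ D < A := by
  lift A to NNReal using hA
  by_cases hD : D = ⊤
  · subst hD
    rw [EReal.coe_ennreal_top]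
    have : (⊤ : EReal) - ((A : ENNReal) : EReal) = ⊤ := EReal.top_sub_coe A
    simp [this]
  lift D to NNReal using hD
  have : ((D : ENNReal) : EReal) - ((A : ENNReal) : EReal) = (((D : ℝ) - A : ℝ) : EReal) := by
    norm_cast
  rw [this]
  norm_cast
  rw [sub_neg]
  exact_mod_cast Iff.rfl

theorem ereal_sub_nonpos_iff {D A : ENNReal} (hA : A ≠ ⊤) :
    (D : EReal) - (A : EReal) ≤ 0 ↔ D ≤ A := by
  lift A to NNReal using hA
  by_cases hD : D = ⊤
  · subst hD
    rw [EReal.coe_ennreal_top]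
    have : (⊤ : EReal) - ((A : ENNReal) : EReal) = ⊤ := EReal.top_sub_coe A
    simp [this]
  lift D to NNReal using hD
  have : ((D : ENNReal) : EReal) - ((A : ENNReal) : EReal) = (((D : ℝ) - A : ℝ) : EReal) := by
    norm_cast
  rw [this]
  norm_cast
  rw [sub_nonpos]
  exact_mod_cast Iff.rfl

/-! ### Affine changes of time -/

/-- The factor `l ^ 2` is absent from `potE_comp_affine` and `level_comp_affine`. The comparison
between different speeds rests on this discrepancy. -/
theorem kin_comp_affine (c : ℝ) {l : ℝ} (hl : 0 < l) (b : ℝ) (U : ℝ → L) :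
    kin (c * l) (fun t => U (l * t + b)) =
      ENNReal.ofReal (Real.exp (-(c * b)) * l⁻¹) * (ENNReal.ofReal (l ^ 2) * kin c U) := by
  have hd : ∀ t, deriv (fun t => U (l * t + b)) t = l • deriv U (l * t + b) := by
    intro t
    have := deriv_comp_mul_left l (fun s => U (s + b)) t
    rw [this, deriv_comp_add_const]
  have : ∀ t, kdens (c * l) (fun t => U (l * t + b)) t =
      ENNReal.ofReal (Real.exp (-(c * b)) * l ^ 2) * kdens c U (l * t + b) := by
    intro t
    simp only [kdens, hd, norm_smul, Real.norm_eq_abs, abs_of_pos hl]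
    rw [← ENNReal.ofReal_mul (by positivity)]
    congr 1
    rw [show c * l * t = -(c * b) + c * (l * t + b) by ring, Real.exp_add]
    ring
  simp only [kin, this]
  rw [lintegral_const_mul' _ _ ENNReal.ofReal_ne_top, lintegral_comp_affine hl, ← mul_assoc,
    ← mul_assoc, ← ENNReal.ofReal_mul (by positivity), ← ENNReal.ofReal_mul (by positivity)]
  congr 2; ring

theorem potE_comp_affine (c T : ℝ) {l : ℝ} (hl : 0 < l) (b : ℝ) (U : ℝ → L) :
    S.potE (c * l) ((T - b) / l) (fun t => U (l * t + b)) =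
      ENNReal.ofReal (Real.exp (-(c * b)) * l⁻¹) * S.potE c T U := by
  have : ∀ t, S.pdens (c * l) ((T - b) / l) (fun t => U (l * t + b)) t =
      ENNReal.ofReal (Real.exp (-(c * b))) * S.pdens c T U (l * t + b) := by
    intro t
    simp only [pdens]
    rw [← mul_assoc, ← ENNReal.ofReal_mul (by positivity), ← Real.exp_add]
    congr 1
    · congr 2; ring
    · have : t ≤ (T - b) / l ↔ l * t + b ≤ T := by
        rw [le_div_iff₀ hl]; constructor <;> intro h <;> linarith
      exact if_congr this rfl rfl
  simp only [potE, this]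
  rw [lintegral_const_mul' _ _ ENNReal.ofReal_ne_top, lintegral_comp_affine hl, ← mul_assoc,
    ← ENNReal.ofReal_mul (by positivity)]

theorem level_comp_affine (c T a : ℝ) {l : ℝ} (hl : 0 < l) (b : ℝ) :
    ENNReal.ofReal (-a * Real.exp (c * l * ((T - b) / l)) / (c * l)) =
      ENNReal.ofReal (Real.exp (-(c * b)) * l⁻¹) * ENNReal.ofReal (-a * Real.exp (c * T) / c) := by
  rw [← ENNReal.ofReal_mul (by positivity)]
  congr 1
  rw [show c * l * ((T - b) / l) = -(c * b) + c * T by field_simp; ring, Real.exp_add]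
  by_cases hc : c = 0
  · simp [hc]
  · field_simp

/-! ### Neighbourhoods of the wells and their distance -/

theorem mem_nbhd_iff {w : Well L H} (hne : w.F.Nonempty) {r : ℝ} (hr : 0 ≤ r) {v : L} :
    v ∈ S.nbhd w r ↔ Metric.infDist v w.F ≤ r := by
  rw [nbhd, Metric.mem_cthickening_iff, Metric.infDist,
    ENNReal.le_ofReal_iff_toReal_le (Metric.infEDist_ne_top hne) hr]

theorem mem_nbhdH_iff {w : Well L H} (hne : (S.setH w).Nonempty) {r : ℝ} (hr : 0 ≤ r) {h : H} :
    h ∈ S.nbhdH w r ↔ Metric.infDist h (S.setH w) ≤ r := by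
  rw [nbhdH, Metric.mem_cthickening_iff, Metric.infDist,
    ENNReal.le_ofReal_iff_toReal_le (Metric.infEDist_ne_top hne) hr]

theorem WellHyp.coercive' {w : Well L H} {m : ℝ} (hw : S.WellHyp w m) {v : L}
    (hv : Metric.infDist v w.F ≤ w.r₀) :
    ((m + w.C⁻¹ * Metric.infDist v w.F ^ 2 : ℝ) : EReal) ≤ S.pot v := by
  have h := hw.coercive v ((mem_nbhd_iff hw.nonempty hw.r₀_pos.le).2 hv)
  rw [EReal.le_sub_iff_add_le (Or.inl (EReal.coe_ne_bot _)) (Or.inl (EReal.coe_ne_top _)),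
    ← EReal.coe_add, add_comm] at h
  exact h

theorem Unbalanced.pot_nonneg_plus (h : S.Unbalanced) {v : L}
    (hv : Metric.infDist v S.plus.F ≤ S.plus.r₀ / 2) : 0 ≤ S.pot v := by
  have hr := h.plus_hyp.r₀_pos
  have hC := h.plus_hyp.one_lt_C
  refine le_trans ?_ (h.plus_hyp.coercive' (v := v) (by linarith))
  rw [EReal.coe_nonneg]
  positivity

theorem Unbalanced.pot_neg_mem (h : S.Unbalanced) (hs : S.SmallerSpace) (hl : S.LevelSets) {v : L}
    (hv : S.pot v < 0) : Metric.infDist v S.minus.F ≤ S.minus.r₀ / 2 := by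
  obtain ⟨x, rfl⟩ := (hs.finite_iff v).1 (hv.trans EReal.zero_lt_top)
  exact (mem_nbhd_iff h.minus_hyp.nonempty (by linarith [h.minus_hyp.r₀_pos])).1
    (hl.neg_subset x hv)

theorem d₀_nonneg (S : Setting L H Ht) : 0 ≤ S.d₀ :=
  Real.sInf_nonneg (by rintro _ ⟨x, -, y, -, rfl⟩; exact dist_nonneg)

/-- If `d₀` vanished, `ConvergenceBound` would read `-a < 0`. -/
theorem d₀_pos (ha : S.a < 0) (hb : S.ConvergenceBound) : 0 < S.d₀ := by
  refine lt_of_le_of_ne S.d₀_nonneg fun h => ?_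
  unfold ConvergenceBound at hb
  rw [← h] at hb
  norm_num at hb
  linarith

theorem Unbalanced.d₀_le (h : S.Unbalanced) {u v : L}
    (hu : Metric.infDist u S.plus.F ≤ S.plus.r₀ / 2)
    (hv : Metric.infDist v S.minus.F ≤ S.minus.r₀ / 2) : S.d₀ ≤ ‖u - v‖ := by
  rw [← dist_eq_norm]
  refine csInf_le ⟨0, by rintro _ ⟨x, -, y, -, rfl⟩; exact dist_nonneg⟩ ⟨u, ?_, v, ?_, rfl⟩
  · exact (mem_nbhd_iff h.plus_hyp.nonempty (by linarith [h.plus_hyp.r₀_pos])).2 hu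
  · exact (mem_nbhd_iff h.minus_hyp.nonempty (by linarith [h.minus_hyp.r₀_pos])).2 hv

/-! ### Control of increments, exit time and bound on the speed -/

/-- Cauchy-Schwarz for `e^{cx/2} ‖U'‖` against `e^{-cx/2}`. The bound does not depend on `t`, so
motion after a late time `s` is small. -/
theorem enorm_sub_sq_le {c : ℝ} (hc : 0 < c) {U : ℝ → L} (hU : MemH1loc U univ) {s t : ℝ}
    (hst : s ≤ t) :
    ‖U t - U s‖ₑ ^ 2 ≤ 2 * kin c U * ENNReal.ofReal (Real.exp (-c * s) / c) := by
  have hm := measurable_enorm_deriv U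
  have hsq : ∀ x : ℝ, ENNReal.ofReal (Real.exp x) ^ 2 = ENNReal.ofReal (Real.exp (2 * x)) := by
    intro x; rw [← ENNReal.ofReal_pow (Real.exp_pos _).le, ← Real.exp_nat_mul]; norm_num
  calc ‖U t - U s‖ₑ ^ 2 ≤ (∫⁻ x in Ioc s t, ‖deriv U x‖ₑ) ^ 2 :=
        pow_le_pow_left' (hU.enorm_sub_le hst) 2
    _ = (∫⁻ x in Ioc s t, (ENNReal.ofReal (Real.exp (c * x / 2)) * ‖deriv U x‖ₑ) *
          ENNReal.ofReal (Real.exp (-(c * x) / 2))) ^ 2 := by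
        congr 1
        refine lintegral_congr fun x => ?_
        rw [mul_right_comm, ← ENNReal.ofReal_mul (Real.exp_pos _).le, ← Real.exp_add]
        ring_nf
        simp
    _ ≤ (∫⁻ x in Ioc s t, (ENNReal.ofReal (Real.exp (c * x / 2)) * ‖deriv U x‖ₑ) ^ 2) *
          ∫⁻ x in Ioc s t, ENNReal.ofReal (Real.exp (-(c * x) / 2)) ^ 2 := by
        apply sq_lintegral_mul_le
        · exact (Measurable.mul (by fun_prop) hm).aemeasurable
        · fun_prop
    _ ≤ (2 * kin c U) * ∫⁻ x in Ioi s, ENNReal.ofReal (Real.exp (-c * x)) := by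
        gcongr ?_ * ?_
        · rw [kin, ← lintegral_const_mul' _ _ (by norm_num)]
          refine (setLIntegral_le_lintegral _ _).trans (lintegral_mono fun x => ?_)
          rw [mul_pow, hsq, kdens, ← ofReal_norm, ← ENNReal.ofReal_pow (norm_nonneg _),
            ← ENNReal.ofReal_mul (Real.exp_pos _).le,
            show (2 : ENNReal) = ENNReal.ofReal 2 by norm_num, ← ENNReal.ofReal_mul (by norm_num)]
          apply ENNReal.ofReal_le_ofReal
          rw [show 2 * (c * x / 2) = c * x by ring]
          linarith
        · refine (lintegral_mono_set Ioc_subset_Ioi_self).trans (lintegral_mono fun x => ?_)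
          rw [hsq]
          apply ENNReal.ofReal_le_ofReal
          rw [show 2 * (-(c * x) / 2) = -c * x by ring]
    _ = _ := by rw [lintegral_exp_neg_Ioi hc]

theorem norm_sub_sq_le {c : ℝ} (hc : 0 < c) {U : ℝ → L} (hU : MemH1loc U univ) {k : ℝ} (hk : 0 ≤ k)
    (hkin : kin c U ≤ ENNReal.ofReal k) {s t : ℝ} (hst : s ≤ t) :
    ‖U t - U s‖ ^ 2 ≤ 2 * k * (Real.exp (-c * s) / c) := by
  have h := enorm_sub_sq_le hc hU hst
  have h2 : ‖U t - U s‖ₑ ^ 2 ≤ ENNReal.ofReal (2 * k * (Real.exp (-c * s) / c)) := by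
    refine h.trans ?_
    rw [ENNReal.ofReal_mul (by positivity), ENNReal.ofReal_mul (by norm_num)]
    norm_num
    gcongr
  rw [← ofReal_norm, ← ENNReal.ofReal_pow (norm_nonneg _)] at h2
  exact (ENNReal.ofReal_le_ofReal_iff (by positivity)).1 h2

/-- Curves of finite energy which stay close to the set of minimizers at level `0` converge to it
at an exponential rate. -/
theorem Unbalanced.infDist_plus_sq_le (h : S.Unbalanced) {c : ℝ} (hc : 0 < c) {U : ℝ → L}
    (hU : MemH1loc U univ) {k : ℝ} (hk : 0 ≤ k) (hkin : kin c U ≤ ENNReal.ofReal k) {T : ℝ}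
    (hpot : S.potE c T U ≠ ⊤)
    (hplus : ∃ T', ∀ t, T' ≤ t → Metric.infDist (U t) S.plus.F ≤ S.plus.r₀ / 2) (t : ℝ) :
    Metric.infDist (U t) S.plus.F ≤ √(2 * k * (Real.exp (-c * t) / c)) := by
  obtain ⟨T', hT'⟩ := hplus
  have hr := h.plus_hyp.r₀_pos
  have hC := h.plus_hyp.one_lt_C
  refine le_of_forall_pos_le_add fun ε hε => ?_
  -- Otherwise coercivity keeps the density of `potE` above a positive constant on a half-line, and
  -- `potE` is infinite.
  obtain ⟨s, hts, hs⟩ : ∃ s, t ≤ s ∧ Metric.infDist (U s) S.plus.F < ε := by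
    by_contra! hcon
    apply hpot
    set M := max (max t T') T
    rw [eq_top_iff]
    calc (⊤ : ENNReal) = ∫⁻ s in Ioi M, ENNReal.ofReal (Real.exp (c * M)) *
          ENNReal.ofReal (S.plus.C⁻¹ * ε ^ 2) := by
          rw [setLIntegral_const, Real.volume_Ioi, ENNReal.mul_top]
          rw [← ENNReal.ofReal_mul (Real.exp_pos _).le]
          simp only [ne_eq, ENNReal.ofReal_eq_zero, not_le]
          positivity
      _ ≤ ∫⁻ s in Ioi M, S.pdens c T U s := by
          refine setLIntegral_mono' measurableSet_Ioi fun s hs => ?_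
          have hs : M < s := hs
          have h1 : t ≤ s := ((le_max_left _ _).trans (le_max_left _ _)).trans hs.le
          have h2 : T' ≤ s := ((le_max_right _ _).trans (le_max_left _ _)).trans hs.le
          have h3 : ¬ s ≤ T := not_le.2 ((le_max_right _ _).trans_lt hs)
          rw [pdens, if_neg h3]
          gcongr
          rw [← toENNReal_coe_real]
          apply EReal.toENNReal_le_toENNReal
          refine le_trans ?_ (h.plus_hyp.coercive' (v := U s) (by linarith [hT' s h2]))
          rw [EReal.coe_le_coe_iff, zero_add]
          have := hcon s h1
          gcongr
      _ ≤ S.potE c T U := setLIntegral_le_lintegral _ _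
  have h1 := norm_sub_sq_le hc hU hk hkin hts
  have h2 : ‖U s - U t‖ ≤ √(2 * k * (Real.exp (-c * t) / c)) := Real.le_sqrt_of_sq_le h1
  have h3 := Metric.infDist_le_infDist_add_dist (s := S.plus.F) (x := U t) (y := U s)
  rw [dist_comm, dist_eq_norm] at h3
  linarith

theorem energy_nonneg {c : ℝ} {U : ℝ → L} (hp : ∀ t, 0 ≤ S.pot (U t)) : 0 ≤ S.energy c U := by
  have h0 : ∀ t, (-S.density c U t).toENNReal = 0 := fun t =>
    (posPart_eq (by positivity) (Real.exp_pos _) (hp t)).2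
  unfold energy energyOn
  simp only [h0, lintegral_zero, EReal.coe_ennreal_zero, sub_zero]
  exact EReal.coe_ennreal_nonneg _

/-- The last time at which a curve of negative energy leaves the negative level set. -/
theorem Unbalanced.exists_exit_time (h : S.Unbalanced) (hs : S.SmallerSpace) (hl : S.LevelSets)
    {c : ℝ} {U : ℝ → L} (hU : Continuous U) (hE : S.energy c U < 0)
    (hplus : ∃ T', ∀ t, T' ≤ t → Metric.infDist (U t) S.plus.F ≤ S.plus.r₀ / 2) :
    ∃ t₁, (∀ t, t₁ < t → 0 ≤ S.pot (U t)) ∧ S.pot (U t₁) ≤ 0 ∧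
      Metric.infDist (U t₁) S.minus.F ≤ S.minus.r₀ / 2 := by
  obtain ⟨T', hT'⟩ := hplus
  let Z := {t | S.pot (U t) < 0}
  have hne : Z.Nonempty := by
    by_contra hcon
    rw [not_nonempty_iff_eq_empty, eq_empty_iff_forall_notMem] at hcon
    exact absurd (energy_nonneg (c := c) fun t => not_lt.1 (hcon t)) (not_le.2 hE)
  have hbdd : BddAbove Z := ⟨T', fun t ht => by
    by_contra hlt
    exact absurd (h.pot_nonneg_plus (hT' t (not_le.1 hlt).le)) (not_le.2 ht)⟩
  have hmem := csSup_mem_closure hne hbdd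
  refine ⟨sSup Z, fun t ht => ?_, ?_, ?_⟩
  · by_contra hlt
    exact absurd (le_csSup hbdd (not_le.1 hlt : t ∈ Z)) (not_le.2 ht)
  · have hcl : IsClosed {t | S.pot (U t) ≤ 0} := (h.lsc.comp hU).isClosed_preimage 0
    exact closure_minimal (fun t (ht : S.pot (U t) < 0) => ht.le) hcl hmem
  · have hcl : IsClosed {t | Metric.infDist (U t) S.minus.F ≤ S.minus.r₀ / 2} :=
      isClosed_le ((Metric.continuous_infDist_pt _).comp hU) continuous_const
    exact closure_minimal (fun t ht => h.pot_neg_mem hs hl ht) hcl hmem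

/-- At the exit time `t₁` the curve is near `F⁻`, and later it is near `F⁺`, so it moves by at least
`d₀` after `t₁`. Negative energy gives `kin ≤ -a e^{c t₁} / c`; in `norm_sub_sq_le` the two
exponentials cancel, leaving `d₀² ≤ -2a / c²`. -/
theorem Unbalanced.speed_le (h : S.Unbalanced) (hs : S.SmallerSpace) (hl : S.LevelSets)
    (hb : S.ConvergenceBound) {c : ℝ} (hc : 0 < c) {U : ℝ → L} (hU : MemH1loc U univ)
    (hE : S.energy c U < 0)
    (hplus : ∃ T', ∀ t, T' ≤ t → Metric.infDist (U t) S.plus.F ≤ S.plus.r₀ / 2) :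
    c ≤ √(-2 * S.a) / S.d₀ := by
  obtain ⟨t₁, ht₁, -, hd₁⟩ := h.exists_exit_time hs hl hU.continuous hE hplus
  obtain ⟨T', hT'⟩ := hplus
  have ha := h.a_neg
  have hpos := d₀_pos ha hb
  rw [h.energy_eq hc hU.continuous ht₁, ereal_sub_neg_iff ENNReal.ofReal_ne_top] at hE
  have hk : kin c U ≤ ENNReal.ofReal (-S.a * Real.exp (c * t₁) / c) := le_self_add.trans hE.le
  have h1 := norm_sub_sq_le hc hU (k := -S.a * Real.exp (c * t₁) / c)
    (div_nonneg (mul_nonneg (by linarith) (Real.exp_pos _).le) hc.le) hk (le_max_left t₁ T')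
  have h2 := h.d₀_le (hT' _ (le_max_right t₁ T')) hd₁
  have h3 : 2 * (-S.a * Real.exp (c * t₁) / c) * (Real.exp (-c * t₁) / c) = -2 * S.a / c ^ 2 := by
    have : Real.exp (c * t₁) * Real.exp (-c * t₁) = 1 := by rw [← Real.exp_add]; simp
    generalize Real.exp (c * t₁) = x at this ⊢
    generalize Real.exp (-c * t₁) = y at this ⊢
    field_simp
    linear_combination (-S.a) * this
  rw [h3] at h1
  rw [le_div_iff₀ hpos]
  apply Real.le_sqrt_of_sq_le
  rw [le_div_iff₀ (by positivity)] at h1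
  nlinarith [mul_self_le_mul_self hpos.le h2]

end Setting

/-! ### The constants attached to `F⁻` and what they control -/

theorem lintegral_exp_Ioc {c : ℝ} (hc : 0 < c) {s t : ℝ} (hst : s ≤ t) :
    ∫⁻ x in Ioc s t, ENNReal.ofReal (Real.exp (c * x)) =
      ENNReal.ofReal ((Real.exp (c * t) - Real.exp (c * s)) / c) := by
  have hcont : Continuous fun x : ℝ => Real.exp (c * x) := by fun_prop
  rw [← ofReal_integral_eq_lintegral_ofReal (hcont.integrableOn_Ioc)
    (Eventually.of_forall fun t => (Real.exp_pos _).le), ← intervalIntegral.integral_of_le hst,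
    intervalIntegral.integral_comp_mul_left (fun x => Real.exp x) hc.ne', integral_exp, smul_eq_mul]
  congr 1
  rw [div_eq_inv_mul]

namespace Setting

variable {L H Ht : Type*} [NormedAddCommGroup L] [InnerProductSpace ℝ L] [CompleteSpace L]
  [NormedAddCommGroup H] [InnerProductSpace ℝ H]
  [NormedAddCommGroup Ht] [InnerProductSpace ℝ Ht]
  {S : Setting L H Ht}

/-- One point of finite potential in the annulus makes the infimum a real number, so `toReal` loses
nothing. -/
theorem Unbalanced.kappa_le (h : S.Unbalanced) {v : L} {r : ℝ}
    (hv : Metric.infDist v S.minus.F ∈ Icc r S.minus.r₀) :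
    ((S.kappa S.minus r : ℝ) : EReal) ≤ S.pot v ∨ S.pot v = ⊤ := by
  rcases EReal.cases_of_coe_le (h.a_le v) with e | ⟨e, he, hae⟩
  · exact Or.inr e
  · left
    have h1 : sInf (S.pot '' {v | Metric.infDist v S.minus.F ∈ Icc r S.minus.r₀}) ≤ S.pot v :=
      sInf_le ⟨v, hv, rfl⟩
    refine le_trans (le_of_eq ?_) h1
    refine EReal.coe_toReal ?_ ?_
    · exact ne_top_of_le_ne_top (by rw [he]; exact EReal.coe_ne_top _) h1
    · refine ne_bot_of_le_ne_bot (EReal.coe_ne_bot S.a) (le_sInf ?_)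
      rintro _ ⟨u, -, rfl⟩
      exact h.a_le u

theorem Unbalanced.lt_kappa (h : S.Unbalanced) {r : ℝ} (hr : 0 < r) :
    S.a < S.kappa S.minus r := by
  have hC := h.minus_hyp.one_lt_C
  set I := sInf (S.pot '' {v | Metric.infDist v S.minus.F ∈ Icc r S.minus.r₀})
  have h1 : ((S.a + S.minus.C⁻¹ * r ^ 2 : ℝ) : EReal) ≤ I := by
    refine le_sInf ?_
    rintro _ ⟨u, hu, rfl⟩
    refine le_trans ?_ (h.minus_hyp.coercive' hu.2)
    rw [EReal.coe_le_coe_iff]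
    have := hu.1
    gcongr
  have h2 : 0 < S.minus.C⁻¹ * r ^ 2 := by positivity
  rcases EReal.cases_of_coe_le h1 with e | ⟨e, he, hae⟩
  -- An infinite infimum has `toReal` equal to zero, which still exceeds `a`.
  · change S.a < I.toReal
    rw [e, EReal.toReal_top]; exact h.a_neg
  · change S.a < I.toReal
    rw [he, EReal.toReal_coe]; linarith

theorem Unbalanced.etaMinus_pos (h : S.Unbalanced) : 0 < S.etaMinus := by
  have hr := h.minus_hyp.r₀_pos
  have hk := h.lt_kappa (r := S.minus.r₀ / 4) (by positivity)
  refine lt_min (Real.sqrt_pos.2 ?_) (by positivity)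
  have : 0 < √(2 * (S.kappa S.minus (S.minus.r₀ / 4) - S.a)) := Real.sqrt_pos.2 (by linarith)
  positivity

theorem etaMinus_le (S : Setting L H Ht) : S.etaMinus ≤ S.minus.r₀ / 4 := min_le_right _ _

theorem Unbalanced.etaMinus_sq_le (h : S.Unbalanced) : S.etaMinus ^ 2 ≤
    (Real.exp 1)⁻¹ * (S.minus.r₀ / 4) * √(2 * (S.kappa S.minus (S.minus.r₀ / 4) - S.a)) := by
  have hr := h.minus_hyp.r₀_pos
  have h1 : S.etaMinus ≤ √((Real.exp 1)⁻¹ * (S.minus.r₀ / 4) *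
      √(2 * (S.kappa S.minus (S.minus.r₀ / 4) - S.a))) := min_le_left _ _
  calc _ ≤ √((Real.exp 1)⁻¹ * (S.minus.r₀ / 4) *
      √(2 * (S.kappa S.minus (S.minus.r₀ / 4) - S.a))) ^ 2 :=
        pow_le_pow_left₀ h.etaMinus_pos.le h1 2
    _ = _ := Real.sq_sqrt (by positivity)

/-- The prefactor of `EmaxMinus` is kept in the first bound, where it pays for the constant of the
replacement. In the second it is dropped, being at most one. -/
theorem Unbalanced.level_bounds (h : S.Unbalanced) (hl : S.LevelSets) :
    -S.a * (S.minus.C ^ 2 * (S.minus.C + 1)) < S.etaMinus ^ 2 / 4 ∧ -S.a < S.minus.β S.etaMinus := by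
  have hC := h.minus_hyp.one_lt_C
  have ha := h.a_neg
  have hX : 1 ≤ S.minus.C ^ 2 * (S.minus.C + 1) := by nlinarith
  have h1 := hl.a_bound
  rw [EmaxMinus, one_div, ← div_eq_inv_mul, lt_div_iff₀ (by linarith)] at h1
  have h2 : -S.a * 1 ≤ -S.a * (S.minus.C ^ 2 * (S.minus.C + 1)) :=
    mul_le_mul_of_nonneg_left hX (by linarith)
  constructor
  · exact h1.trans_le ((min_le_left _ _).trans (min_le_left _ _))
  · have := h1.trans_le ((min_le_right _ _).trans (min_le_right _ _))
    linarith

theorem Unbalanced.exists_H_of_nonpos (h : S.Unbalanced) (hl : S.LevelSets) (hp : S.ProjH) {v : L}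
    (hv : S.pot v ≤ 0) (hd : Metric.infDist v S.minus.F ≤ S.minus.r₀) :
    ∃ x ∈ S.nbhdH S.minus S.etaMinus, S.incl x = v := by
  have hr := h.minus_hyp.r₀_pos
  have hη := h.etaMinus_pos
  refine hp.1.β_spec S.etaMinus ⟨hη, by linarith [S.etaMinus_le]⟩ v
    ((mem_nbhd_iff h.minus_hyp.nonempty hr.le).2 hd) (hv.trans ?_)
  rw [EReal.coe_nonneg]
  linarith [(h.level_bounds hl).2]

theorem setH_nonempty (hs : S.SmallerSpace) {w : Well L H} {m : ℝ} (hw : S.WellHyp w m)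
    (hm : ∀ f ∈ w.F, S.pot f = m) : (S.setH w).Nonempty := by
  obtain ⟨f, hf⟩ := hw.nonempty
  obtain ⟨x, rfl⟩ := (hs.finite_iff f).1 (by rw [hm f hf]; exact EReal.coe_lt_top m)
  exact ⟨x, hf⟩

theorem Unbalanced.coe_potH (h : S.Unbalanced) (hs : S.SmallerSpace) (x : H) :
    ((S.potH x : ℝ) : EReal) = S.pot (S.incl x) :=
  EReal.coe_toReal ((hs.finite_iff _).2 ⟨x, rfl⟩).ne (h.pot_ne_bot _)

theorem SmallerSpace.infDist_incl_le (hs : S.SmallerSpace) {w : Well L H} {x p : H}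
    (hp : p ∈ S.setH w) : Metric.infDist (S.incl x) w.F ≤ ‖x - p‖ := by
  refine (Metric.infDist_le_dist_of_mem (show S.incl p ∈ w.F from hp)).trans ?_
  rw [dist_eq_norm, ← map_sub]
  exact hs.incl_norm_le _

/-- A gap property: since `-a < β η`, a point of nonpositive potential is within `H`-distance `η` of
`F⁻`, and the `L`-norm is smaller. As `η ≤ r₀ / 4`, such a point cannot lie near distance `r₀ / 2`.
-/
theorem Unbalanced.infDist_le_of_nonpos (h : S.Unbalanced) (hs : S.SmallerSpace) (hl : S.LevelSets)
    (hp : S.ProjH) {v : L} (hv : S.pot v ≤ 0) (hd : Metric.infDist v S.minus.F ≤ S.minus.r₀) :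
    Metric.infDist v S.minus.F ≤ S.etaMinus := by
  have hne := setH_nonempty hs h.minus_hyp h.pot_minus
  obtain ⟨x, hx, rfl⟩ := h.exists_H_of_nonpos hl hp hv hd
  have hx' := hx
  rw [mem_nbhdH_iff hne h.etaMinus_pos.le] at hx
  have hr := h.minus_hyp.r₀_pos
  have h3 := hp.1.proj x ((mem_nbhdH_iff hne hr.le).2 (by linarith [S.etaMinus_le]))
  exact (hs.infDist_incl_le h3.1).trans (h3.2.1.le.trans hx)

theorem SmallerSpace.continuous_incl (hs : S.SmallerSpace) : Continuous S.incl :=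
  AddMonoidHomClass.continuous_of_bound S.incl 1 fun x => by simpa using hs.incl_norm_le x

/-! ### Replacing the beginning of a curve by a segment -/

theorem contDiff_affine_curve (p q : L) (t₀ r : ℝ) :
    ContDiff ℝ 1 fun t : ℝ => p + (1 + r * (t - t₀)) • q := by fun_prop

theorem kdens_congr {c : ℝ} {U V : ℝ → L} {t : ℝ} (h : U =ᶠ[𝓝 t] V) : kdens c U t = kdens c V t := by
  rw [kdens, kdens, h.deriv_eq]

/-- A curve can be replaced, before a time at which the potential is nonpositive, by a curve which
is constant and then affine, at a controlled cost. -/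
theorem Unbalanced.exists_replacement (h : S.Unbalanced) (hs : S.SmallerSpace) (hl : S.LevelSets)
    (hp : S.ProjH) {c : ℝ} (hc : 0 < c) {U : ℝ → L} (hU : MemH1loc U univ) {t₀ : ℝ}
    (hpot : S.pot (U t₀) ≤ 0) (hd : Metric.infDist (U t₀) S.minus.F ≤ S.minus.r₀) :
    ∃ V : ℝ → L, MemH1loc V univ ∧ (∀ t, t₀ ≤ t → V t = U t) ∧
      (∀ t, t ≤ t₀ → Metric.infDist (V t) S.minus.F ≤ S.etaMinus) ∧
      ∀ T, t₀ ≤ T → ∫⁻ t in Iic t₀, (kdens c V t + S.pdens c T V t) ≤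
        ENNReal.ofReal (3 / 2 * S.minus.C ^ 3 * ((S.pot (U t₀)).toReal - S.a) *
          Real.exp (c * t₀)) := by
  have hne := setH_nonempty hs h.minus_hyp h.pot_minus
  have hr := h.minus_hyp.r₀_pos
  have hC := h.minus_hyp.one_lt_C
  have hη := S.etaMinus_le
  have hη0 := h.etaMinus_pos
  obtain ⟨x, hx, hxU⟩ := h.exists_H_of_nonpos hl hp hpot hd
  rw [mem_nbhdH_iff hne hη0.le] at hx
  have hxr : x ∈ S.nbhdH S.minus S.minus.r₀ := (mem_nbhdH_iff hne hr.le).2 (by linarith)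
  obtain ⟨hpF, hpd, -⟩ := hp.1.proj x hxr
  have hest := (hp.1.local_est x hxr).1
  set p := S.minus.PH x with hpdef
  set C := S.minus.C with hCdef
  set e₀ := (S.pot (U t₀)).toReal - S.a with he₀
  have hee : S.potH x - S.a = e₀ := by rw [he₀, ← hxU]; rfl
  have hxp : ‖x - p‖ ^ 2 ≤ C ^ 2 * e₀ := by
    rw [← hee]
    rwa [inv_mul_le_iff₀ (by positivity)] at hest
  have he₀nn : 0 ≤ e₀ := by
    by_contra hneg
    nlinarith [sq_nonneg ‖x - p‖, sq_nonneg C, mul_pos (sq_pos_of_pos (by linarith : 0 < C))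
      (by linarith : 0 < -e₀)]
  set q : L := S.incl (x - p) with hq
  -- The segment from the `H`-projection `p` to `U t₀` is run in time `1 / C`. Apart from the
  -- weight, the kinetic density on it is at most `C⁴ e₀ / 2` and the potential density at most `C⁴
  -- e₀`; the product with `1 / C` gives `3/2 C³ e₀`.
  let A : ℝ → L := fun t => S.incl p + (1 + C * (t - t₀)) • q
  have hA : MemH1loc A univ := (contDiff_affine_curve _ q t₀ C).memH1loc
  have hB : MemH1loc (fun _ : ℝ => S.incl p) univ := contDiff_const.memH1loc
  let s₀ := t₀ - 1 / C
  have hs₀ : s₀ < t₀ := by simp only [s₀]; linarith [show 0 < 1 / C by positivity]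
  have hA0 : A s₀ = S.incl p := by
    simp only [A, s₀]
    rw [show 1 + C * (t₀ - 1 / C - t₀) = 0 by field_simp; ring]; simp
  have hA1 : A t₀ = U t₀ := by
    simp only [A]; rw [sub_self, mul_zero, add_zero, one_smul, hq, map_sub, ← hxU]; abel
  let W : ℝ → L := fun t => if t ≤ s₀ then S.incl p else A t
  have hW : MemH1loc W univ := hB.glue hA hA0.symm
  have hW1 : W t₀ = U t₀ := by simp only [W, if_neg (not_le.2 hs₀), hA1]
  let V : ℝ → L := fun t => if t ≤ t₀ then W t else U t
  have hVi : ∀ t, t ≤ s₀ → V t = S.incl p := fun t ht => by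
    simp only [V, W, if_pos (ht.trans hs₀.le), if_pos ht]
  have hVm : ∀ t, s₀ < t → t ≤ t₀ → V t = A t := fun t ht ht' => by
    simp only [V, W, if_pos ht', if_neg (not_le.2 ht)]
  -- The segment lifts to `H` and stays within `‖x - p‖` of `p`, so the upper quadratic bound on the
  -- potential holds all along it.
  have hpath : ∀ t, s₀ < t → t ≤ t₀ → ∃ y : H, S.incl y = A t ∧ ‖y - p‖ ≤ ‖x - p‖ := by
    intro t ht ht'
    refine ⟨p + (1 + C * (t - t₀)) • (x - p), by simp only [map_add, map_smul, A, hq], ?_⟩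
    rw [add_sub_cancel_left, norm_smul]
    have h1 : 0 ≤ 1 + C * (t - t₀) := by
      have : -(1 / C) ≤ t - t₀ := by simp only [s₀] at ht; linarith
      have := mul_le_mul_of_nonneg_left this (by linarith : (0:ℝ) ≤ C)
      rw [show C * -(1 / C) = -1 by field_simp] at this
      linarith
    have h2 : 1 + C * (t - t₀) ≤ 1 := by nlinarith
    rw [Real.norm_eq_abs, abs_of_nonneg h1]
    exact mul_le_of_le_one_left (norm_nonneg _) h2
  have hpF' : S.incl p ∈ S.minus.F := hpF
  refine ⟨V, hW.glue hU hW1, fun t ht => ?_, fun t ht => ?_, fun T hT => ?_⟩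
  · rcases ht.eq_or_lt with rfl | h'
    · simp only [V, le_refl, if_true, hW1]
    · simp only [V, if_neg (not_le.2 h')]
  · rcases le_or_gt t s₀ with h' | h'
    · rw [hVi t h', Metric.infDist_zero_of_mem hpF']; exact hη0.le
    · obtain ⟨y, hy, hyp⟩ := hpath t h' ht
      rw [hVm t h' ht, ← hy]
      exact (hs.infDist_incl_le hpF).trans (hyp.trans (hpd.le.trans hx))
  · have hae : ∀ᵐ t : ℝ, t ≠ s₀ ∧ t ≠ t₀ := by
      have h1 : ∀ᵐ t : ℝ, t ≠ s₀ := by simp [ae_iff, measure_singleton]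
      have h2 : ∀ᵐ t : ℝ, t ≠ t₀ := by simp [ae_iff, measure_singleton]
      filter_upwards [h1, h2] with t a b using ⟨a, b⟩
    have hbound : ∀ᵐ t : ℝ, t ∈ Iic t₀ → kdens c V t + S.pdens c T V t ≤
        (Ioc s₀ t₀).indicator
          (fun _ => ENNReal.ofReal (Real.exp (c * t₀) * (3 / 2 * C ^ 4 * e₀))) t := by
      filter_upwards [hae] with t ht htt
      have htt : t < t₀ := lt_of_le_of_ne htt ht.2
      rcases lt_or_gt_of_ne ht.1 with h' | h'
      · have hev : V =ᶠ[𝓝 t] fun _ => S.incl p := by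
          filter_upwards [Iio_mem_nhds h'] with s hs using hVi s (le_of_lt hs)
        have : kdens c V t = 0 := by
          rw [kdens_congr hev]; simp [kdens]
        rw [this, zero_add, pdens, if_pos (htt.le.trans hT), hVi t h'.le, h.pot_minus _ hpF',
          ← EReal.coe_sub, sub_self]
        simp
      · rw [indicator_of_mem (show t ∈ Ioc s₀ t₀ from ⟨h', htt.le⟩)]
        have hev : V =ᶠ[𝓝 t] A := by
          filter_upwards [Ioo_mem_nhds h' htt] with s hs using hVm s hs.1 hs.2.le
        have hdA : deriv A t = C • q := by
          have h1 : HasDerivAt (fun t : ℝ => 1 + C * (t - t₀)) C t := by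
            simpa using (((hasDerivAt_id t).sub_const t₀).const_mul C).const_add 1
          exact ((h1.smul_const q).const_add (S.incl p)).deriv
        obtain ⟨y, hy, hyp⟩ := hpath t h' htt.le
        have hyd : Metric.infDist y (S.setH S.minus) ≤ ‖x - p‖ := by
          rw [← dist_eq_norm] at hyp
          exact (Metric.infDist_le_dist_of_mem hpF).trans hyp
        have hyr : y ∈ S.nbhdH S.minus S.minus.r₀ :=
          (mem_nbhdH_iff hne hr.le).2 (by linarith)
        have hy1 := (hp.1.local_est y hyr).2
        rw [(hp.1.proj y hyr).2.1] at hy1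
        have hy2 : Metric.infDist y (S.setH S.minus) ^ 2 ≤ C ^ 2 * e₀ :=
          (pow_le_pow_left₀ Metric.infDist_nonneg hyd 2).trans hxp
        have hy3 : S.potH y - S.a ≤ C ^ 4 * e₀ := by
          calc _ ≤ C ^ 2 * Metric.infDist y (S.setH S.minus) ^ 2 := hy1
            _ ≤ C ^ 2 * (C ^ 2 * e₀) := by gcongr
            _ = _ := by ring
        have hexp : Real.exp (c * t) ≤ Real.exp (c * t₀) := by gcongr
        have hk : kdens c V t ≤ ENNReal.ofReal (Real.exp (c * t₀) * (1 / 2 * C ^ 4 * e₀)) := by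
          rw [kdens_congr hev, kdens, hdA, norm_smul, Real.norm_eq_abs,
            abs_of_pos (by linarith : 0 < C)]
          apply ENNReal.ofReal_le_ofReal
          refine mul_le_mul hexp ?_ (by positivity) (Real.exp_pos _).le
          have hq2 : ‖q‖ ^ 2 ≤ C ^ 2 * e₀ :=
            (pow_le_pow_left₀ (norm_nonneg _) (hs.incl_norm_le (x - p)) 2).trans hxp
          calc (C * ‖q‖) ^ 2 / 2 = C ^ 2 * ‖q‖ ^ 2 / 2 := by ring
            _ ≤ C ^ 2 * (C ^ 2 * e₀) / 2 := by gcongr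
            _ = _ := by ring
        have hpd : S.pdens c T V t ≤ ENNReal.ofReal (Real.exp (c * t₀) * (C ^ 4 * e₀)) := by
          rw [pdens, if_pos (htt.le.trans hT), hVm t h' htt.le, ← hy, ← h.coe_potH hs,
            ← EReal.coe_sub, toENNReal_coe_real, ENNReal.ofReal_mul (Real.exp_pos _).le]
          gcongr
        refine (add_le_add hk hpd).trans ?_
        rw [← ENNReal.ofReal_add (by positivity) (by positivity)]
        apply ENNReal.ofReal_le_ofReal
        linarith
    refine (lintegral_mono_ae ((ae_restrict_iff' measurableSet_Iic).2 hbound)).trans ?_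
    refine (setLIntegral_le_lintegral _ _).trans ?_
    rw [lintegral_indicator measurableSet_Ioc, setLIntegral_const, Real.volume_Ioc,
      ← ENNReal.ofReal_mul (by positivity)]
    apply ENNReal.ofReal_le_ofReal
    rw [show t₀ - s₀ = 1 / C by simp only [s₀]; ring]
    apply le_of_eq
    field_simp

/-! ### The cost of excursions away from `F⁻` -/

/-- Here `3/2 C³` is the constant of the replacement, and `0.63` lies just below `1 - e⁻¹`, the
share of the integral of `e^{cs}` over `s ≤ t` carried by the last `1 / c` units of time. The
polynomial inequality comes from `C⁴ ≥ 1.4 C³ - 0.49 C²`. -/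
theorem Unbalanced.speed_cost_le (h : S.Unbalanced) {c : ℝ} (hc : 0 < c) (hcγ : c < S.gammaMinus) :
    3 / 2 * S.minus.C ^ 3 * c ≤ 0.63 := by
  have hC := h.minus_hyp.one_lt_C
  set C := S.minus.C with hCdef
  have hden : 0 < C + 1 / 2 * C ^ 2 * (C ^ 2 + (C + 1) ^ 2) := by positivity
  rw [gammaMinus, ← hCdef, lt_div_iff₀ hden] at hcγ
  have h1 : 3 / 2 * C ^ 3 ≤ 0.63 * (C + 1 / 2 * C ^ 2 * (C ^ 2 + (C + 1) ^ 2)) := by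
    have : 0 ≤ C ^ 2 * (C - 0.7) ^ 2 := by positivity
    nlinarith
  nlinarith

theorem exp_neg_one_le : Real.exp (-1) ≤ 0.37 := by
  rw [Real.exp_neg]
  have := Real.exp_one_gt_d9
  rw [inv_le_comm₀ (Real.exp_pos _) (by norm_num)]
  refine le_trans ?_ this.le
  norm_num

/-- The cost of a return from the boundary of the neighbourhood of radius `r₀ / 2` of the set of
global minimizers to the neighbourhood of radius `r₀ / 4`. -/
theorem Unbalanced.return_cost (h : S.Unbalanced) {U : ℝ → L} (hU : MemH1loc U univ) {s t : ℝ}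
    (hst : s ≤ t) (h1 : S.minus.r₀ / 2 ≤ Metric.infDist (U s) S.minus.F)
    (h2 : ∀ x ∈ Icc s t, Metric.infDist (U x) S.minus.F ≤ S.minus.r₀)
    (h3 : Metric.infDist (U t) S.minus.F ≤ S.minus.r₀ / 4) :
    ENNReal.ofReal (Real.exp 1 * S.etaMinus ^ 2) ≤ ∫⁻ x in Ioc s t,
      (ENNReal.ofReal (‖deriv U x‖ ^ 2 / 2) + (S.pot (U x) - (S.a : EReal)).toENNReal) := by
  have hr := h.minus_hyp.r₀_pos
  let D : Set ℝ := {x | x ∈ Icc s t ∧ Metric.infDist (U x) S.minus.F ≤ S.minus.r₀ / 4}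
  have hcont : Continuous fun x => Metric.infDist (U x) S.minus.F :=
    (Metric.continuous_infDist_pt _).comp hU.continuous
  have hDcl : IsClosed D := isClosed_Icc.inter (isClosed_le hcont continuous_const)
  have hDne : D.Nonempty := ⟨t, ⟨hst, le_rfl⟩, h3⟩
  have hDb : BddBelow D := ⟨s, fun x hx => hx.1.1⟩
  -- Until its first arrival `u` at distance `r₀ / 4`, the curve stays where the potential is at
  -- least `κ` (or infinite). By `v² / 2 + k ≥ √(2k) v` the cost is then at least `√(2k)` times a
  -- length of at least `r₀ / 4`; the definition of `etaMinus` makes this at least `e η²`.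
  set u := sInf D
  have hu : u ∈ D := hDcl.csInf_mem hDne hDb
  have hlt : ∀ x ∈ Ico s u, S.minus.r₀ / 4 < Metric.infDist (U x) S.minus.F := by
    intro x hx
    by_contra hcon
    exact absurd (csInf_le hDb ⟨⟨hx.1, hx.2.le.trans hu.1.2⟩, not_lt.1 hcon⟩) (not_le.2 hx.2)
  have hsu : s ≤ u := hu.1.1
  set k := S.kappa S.minus (S.minus.r₀ / 4) - S.a with hk
  have hkpos : 0 < k := by linarith [h.lt_kappa (r := S.minus.r₀ / 4) (by positivity)]
  have hpt : ∀ x ∈ Ioo s u, ENNReal.ofReal √(2 * k) * ‖deriv U x‖ₑ ≤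
      ENNReal.ofReal (‖deriv U x‖ ^ 2 / 2) + (S.pot (U x) - (S.a : EReal)).toENNReal := by
    intro x hx
    have hd := hlt x ⟨hx.1.le, hx.2⟩
    rcases h.kappa_le ⟨hd.le, h2 x ⟨hx.1.le, hx.2.le.trans hu.1.2⟩⟩ with h' | h'
    · have h4 : ENNReal.ofReal k ≤ (S.pot (U x) - (S.a : EReal)).toENNReal := by
        rw [← toENNReal_coe_real, hk, EReal.coe_sub]
        exact EReal.toENNReal_le_toENNReal (EReal.sub_le_sub h' le_rfl)
      refine le_trans ?_ (add_le_add le_rfl h4)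
      rw [← ofReal_norm, ← ENNReal.ofReal_mul (Real.sqrt_nonneg _),
        ← ENNReal.ofReal_add (by positivity) hkpos.le]
      apply ENNReal.ofReal_le_ofReal
      nlinarith [sq_nonneg (‖deriv U x‖ - √(2 * k)), Real.sq_sqrt (by positivity : 0 ≤ 2 * k)]
    · rw [h', EReal.top_sub_coe, EReal.toENNReal_top, add_top]
      exact le_top
  have hη := h.etaMinus_sq_le
  have hdist : S.minus.r₀ / 4 ≤ ‖U u - U s‖ := by
    have := Metric.infDist_le_infDist_add_dist (s := S.minus.F) (x := U s) (y := U u)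
    rw [dist_comm, dist_eq_norm] at this
    linarith [hu.2]
  calc ENNReal.ofReal (Real.exp 1 * S.etaMinus ^ 2)
      ≤ ENNReal.ofReal (√(2 * k) * ‖U u - U s‖) := by
        apply ENNReal.ofReal_le_ofReal
        calc _ ≤ Real.exp 1 * ((Real.exp 1)⁻¹ * (S.minus.r₀ / 4) * √(2 * k)) := by gcongr
          _ = √(2 * k) * (S.minus.r₀ / 4) := by field_simp
          _ ≤ _ := by gcongr
    _ = ENNReal.ofReal √(2 * k) * ‖U u - U s‖ₑ := by
        rw [ENNReal.ofReal_mul (Real.sqrt_nonneg _), ofReal_norm]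
    _ ≤ ENNReal.ofReal √(2 * k) * ∫⁻ x in Ioc s u, ‖deriv U x‖ₑ := by
        gcongr; exact hU.enorm_sub_le hsu
    _ = ∫⁻ x in Ioo s u, ENNReal.ofReal √(2 * k) * ‖deriv U x‖ₑ := by
        rw [lintegral_const_mul' _ _ ENNReal.ofReal_ne_top, restrict_Ioo_eq_restrict_Ioc]
    _ ≤ _ := by
        refine (setLIntegral_mono' measurableSet_Ioo hpt).trans (lintegral_mono_set ?_)
        exact fun x hx => ⟨hx.1, hx.2.le.trans hu.1.2⟩

/-- If a curve returns to the set of global minimizers, then what precedes the return costs more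
than the replacement. -/
theorem Unbalanced.excursion_cost (h : S.Unbalanced) (hl : S.LevelSets) {c : ℝ} (hc : 0 < c)
    (hcγ : c < S.gammaMinus) {U : ℝ → L} (hU : MemH1loc U univ) {s t T : ℝ}
    (hst : s < t) (htT : t ≤ T) (h1 : S.minus.r₀ / 2 ≤ Metric.infDist (U s) S.minus.F)
    (h2 : ∀ x ∈ Icc s t, Metric.infDist (U x) S.minus.F ≤ S.minus.r₀)
    (h3 : Metric.infDist (U t) S.minus.F ≤ S.minus.r₀ / 4)
    (h4 : ∀ x ∈ Ioo s t, 0 ≤ S.pot (U x)) :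
    ENNReal.ofReal (3 / 2 * S.minus.C ^ 3 * -S.a * Real.exp (c * t)) ≤
      ∫⁻ x in Iic t, (kdens c U x + S.pdens c T U x) := by
  have ha := h.a_neg
  have hC := h.minus_hyp.one_lt_C
  -- A long excursion pays through the potential, which exceeds `a` by at least `-a` during the last
  -- `1 / c` units of time. A short one pays the return cost under a weight of at least `e^{ct -
  -- 1}`, and the factor `e` of `return_cost` compensates for `e⁻¹`.
  rcases le_or_gt s (t - 1 / c) with hcase | hcase
  · have hle : t - 1 / c ≤ t := by linarith [show 0 < 1 / c by positivity]
    calc _ ≤ ENNReal.ofReal (-S.a) *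
          ENNReal.ofReal ((Real.exp (c * t) - Real.exp (c * (t - 1 / c))) / c) := by
          rw [← ENNReal.ofReal_mul (by linarith)]
          apply ENNReal.ofReal_le_ofReal
          rw [show c * (t - 1 / c) = c * t + -1 by field_simp; ring, Real.exp_add]
          have h5 := h.speed_cost_le hc hcγ
          have h6 := exp_neg_one_le
          have h7 := Real.exp_pos (c * t)
          have : 3 / 2 * S.minus.C ^ 3 ≤ (1 - Real.exp (-1)) / c := by
            rw [le_div_iff₀ hc]; linarith
          have h8 : 0 ≤ -S.a * Real.exp (c * t) := by nlinarith
          calc _ = 3 / 2 * S.minus.C ^ 3 * (-S.a * Real.exp (c * t)) := by ring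
            _ ≤ (1 - Real.exp (-1)) / c * (-S.a * Real.exp (c * t)) := by gcongr
            _ = _ := by ring
      _ = ∫⁻ x in Ioo (t - 1 / c) t,
            ENNReal.ofReal (-S.a) * ENNReal.ofReal (Real.exp (c * x)) := by
          rw [lintegral_const_mul' _ _ ENNReal.ofReal_ne_top, restrict_Ioo_eq_restrict_Ioc,
            lintegral_exp_Ioc hc hle]
      _ ≤ ∫⁻ x in Ioo (t - 1 / c) t, (kdens c U x + S.pdens c T U x) := by
          refine setLIntegral_mono' measurableSet_Ioo fun x hx => le_add_left ?_
          rw [pdens, if_pos (hx.2.le.trans htT), mul_comm]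
          gcongr
          rw [← toENNReal_coe_real]
          apply EReal.toENNReal_le_toENNReal
          have := EReal.sub_le_sub (h4 x ⟨hcase.trans_lt hx.1, hx.2⟩) (le_refl (S.a : EReal))
          rwa [zero_sub, ← EReal.coe_neg] at this
      _ ≤ _ := lintegral_mono_set fun x hx => hx.2.le
  · have h5 := h.return_cost hU hst.le h1 h2 h3
    have h6 := (h.level_bounds hl).1
    calc _ ≤ ENNReal.ofReal (Real.exp (c * t - 1)) *
          ENNReal.ofReal (Real.exp 1 * S.etaMinus ^ 2) := by
          rw [← ENNReal.ofReal_mul (Real.exp_pos _).le]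
          apply ENNReal.ofReal_le_ofReal
          rw [← mul_assoc, ← Real.exp_add, sub_add_cancel, mul_comm]
          gcongr
          have : 3 / 2 * S.minus.C ^ 3 ≤ 4 * (S.minus.C ^ 2 * (S.minus.C + 1)) := by nlinarith
          nlinarith
      _ ≤ ENNReal.ofReal (Real.exp (c * t - 1)) * ∫⁻ x in Ioc s t,
          (ENNReal.ofReal (‖deriv U x‖ ^ 2 / 2) + (S.pot (U x) - (S.a : EReal)).toENNReal) := by
          gcongr
      _ = ∫⁻ x in Ioc s t, ENNReal.ofReal (Real.exp (c * t - 1)) *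
          (ENNReal.ofReal (‖deriv U x‖ ^ 2 / 2) + (S.pot (U x) - (S.a : EReal)).toENNReal) := by
          rw [lintegral_const_mul' _ _ ENNReal.ofReal_ne_top]
      _ ≤ ∫⁻ x in Ioc s t, (kdens c U x + S.pdens c T U x) := by
          refine setLIntegral_mono' measurableSet_Ioc fun x hx => ?_
          rw [kdens, pdens, if_pos (hx.2.trans htT), ENNReal.ofReal_mul (Real.exp_pos _).le,
            ← mul_add]
          gcongr
          have : c * (t - 1 / c) ≤ c * x := by gcongr; linarith [hx.1]
          rwa [show c * (t - 1 / c) = c * t - 1 by field_simp] at this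
      _ ≤ _ := lintegral_mono_set fun x hx => hx.2

/-! ### Removing excursions from curves of negative energy -/

theorem lintegral_split (f : ℝ → ENNReal) (t : ℝ) :
    ∫⁻ x, f x = (∫⁻ x in Iic t, f x) + ∫⁻ x in Ioi t, f x := by
  rw [← lintegral_add_compl f (measurableSet_Iic (a := t)), compl_Iic]

theorem kin_add_potE {c T : ℝ} {U : ℝ → L} :
    kin c U + S.potE c T U = ∫⁻ t, (kdens c U t + S.pdens c T U t) := by
  rw [kin, potE, lintegral_add_left (measurable_kdens c U)]

theorem kin_add_potE_le {c T : ℝ} {U V : ℝ → L} {t₀ : ℝ}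
    (hUV : ∀ t, t₀ ≤ t → V t = U t)
    (hle : ∫⁻ x in Iic t₀, (kdens c V x + S.pdens c T V x) ≤
      ∫⁻ x in Iic t₀, (kdens c U x + S.pdens c T U x)) :
    kin c V + S.potE c T V ≤ kin c U + S.potE c T U := by
  rw [kin_add_potE, kin_add_potE, lintegral_split _ t₀, lintegral_split (fun t => _ + _) t₀]
  refine add_le_add hle (le_of_eq (setLIntegral_congr_fun measurableSet_Ioi fun x hx => ?_))
  have hev : V =ᶠ[𝓝 x] U := by
    filter_upwards [Ioi_mem_nhds (show t₀ < x from hx)] with s hs using hUV s (le_of_lt hs)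
  simp only [kdens_congr hev, pdens, hUV x (le_of_lt hx)]

/-- A curve of negative energy can be modified in such a way that it stays close to the set of
global minimizers before some time, the potential being nonnegative after that time. -/
theorem Unbalanced.exists_modification (h : S.Unbalanced) (hs : S.SmallerSpace) (hl : S.LevelSets)
    (hp : S.ProjH) {c : ℝ} (hc : 0 < c) (hcγ : c < S.gammaMinus) {U : ℝ → L}
    (hU : MemH1loc U univ) (hE : S.energy c U < 0)
    (hplus : ∃ T', ∀ t, T' ≤ t → Metric.infDist (U t) S.plus.F ≤ S.plus.r₀ / 2) :
    ∃ (V : ℝ → L) (t₁ : ℝ), MemH1loc V univ ∧ S.energy c V < 0 ∧ (∀ t, t₁ ≤ t → V t = U t) ∧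
      (∀ t, t₁ < t → 0 ≤ S.pot (V t)) ∧
      (∀ t, t ≤ t₁ → Metric.infDist (V t) S.minus.F ≤ S.minus.r₀ / 2) := by
  obtain ⟨t₁, hpos, hp₁, hd₁⟩ := h.exists_exit_time hs hl hU.continuous hE hplus
  have hr := h.minus_hyp.r₀_pos
  have hη := S.etaMinus_le
  by_cases hgood : ∀ t, t ≤ t₁ → Metric.infDist (U t) S.minus.F ≤ S.minus.r₀ / 2
  · exact ⟨U, t₁, hU, hE, fun _ _ => rfl, hpos, hgood⟩
  push Not at hgood
  obtain ⟨tb, htb, hdb⟩ := hgood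
  have hcont : Continuous fun x => Metric.infDist (U x) S.minus.F :=
    (Metric.continuous_infDist_pt _).comp hU.continuous
  -- The last time `s ≤ t₁` at distance at least `r₀ / 2`, and then the first time `t₀` after `s` of
  -- nonpositive potential, delimit an excursion to which `excursion_cost` applies. All that
  -- precedes `t₀` is replaced, so no control of the curve near `-∞` is required.
  let B : Set ℝ := {t | t ≤ t₁ ∧ S.minus.r₀ / 2 ≤ Metric.infDist (U t) S.minus.F}
  have hBcl : IsClosed B := isClosed_Iic.inter (isClosed_le continuous_const hcont)
  have hBne : B.Nonempty := ⟨tb, htb, hdb.le⟩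
  have hBb : BddAbove B := ⟨t₁, fun x hx => hx.1⟩
  set s := sSup B
  have hsB : s ∈ B := hBcl.csSup_mem hBne hBb
  have hafter : ∀ t, s < t → t ≤ t₁ → Metric.infDist (U t) S.minus.F < S.minus.r₀ / 2 := by
    intro t ht ht'
    by_contra hcon
    exact absurd (le_csSup hBb ⟨ht', not_lt.1 hcon⟩) (not_le.2 ht)
  have hst₁ : s < t₁ := by
    refine lt_of_le_of_ne hsB.1 fun heq => ?_
    have := h.infDist_le_of_nonpos hs hl hp hp₁ (by linarith)
    rw [← heq] at this
    linarith [hsB.2]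
  have hds : Metric.infDist (U s) S.minus.F ≤ S.minus.r₀ / 2 := by
    have hcl : IsClosed {t | Metric.infDist (U t) S.minus.F ≤ S.minus.r₀ / 2} :=
      isClosed_le hcont continuous_const
    have hsub : Ioc s t₁ ⊆ {t | Metric.infDist (U t) S.minus.F ≤ S.minus.r₀ / 2} :=
      fun t ht => (hafter t ht.1 ht.2).le
    have := closure_minimal hsub hcl
    rw [closure_Ioc hst₁.ne] at this
    exact this ⟨le_rfl, hst₁.le⟩
  have hd : ∀ t ∈ Icc s t₁, Metric.infDist (U t) S.minus.F ≤ S.minus.r₀ / 2 := by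
    intro t ht
    rcases ht.1.eq_or_lt with rfl | h'
    · exact hds
    · exact (hafter t h' ht.2).le
  let Z : Set ℝ := {t | t ∈ Icc s t₁ ∧ S.pot (U t) ≤ 0}
  have hZcl : IsClosed Z :=
    isClosed_Icc.inter ((h.lsc.comp hU.continuous).isClosed_preimage 0)
  have hZne : Z.Nonempty := ⟨t₁, ⟨hst₁.le, le_rfl⟩, hp₁⟩
  have hZb : BddBelow Z := ⟨s, fun x hx => hx.1.1⟩
  set t₀ := sInf Z
  have ht₀ : t₀ ∈ Z := hZcl.csInf_mem hZne hZb
  have hd₀ := h.infDist_le_of_nonpos hs hl hp ht₀.2 (by linarith [hd t₀ ht₀.1])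
  have hst₀ : s < t₀ := by
    refine lt_of_le_of_ne ht₀.1.1 fun heq => ?_
    rw [← heq] at hd₀
    linarith [hsB.2]
  have hbefore : ∀ x ∈ Ioo s t₀, 0 ≤ S.pot (U x) := by
    intro x hx
    by_contra hcon
    exact absurd (csInf_le hZb ⟨⟨hx.1.le, hx.2.le.trans ht₀.1.2⟩, (not_le.1 hcon).le⟩)
      (not_le.2 hx.2)
  obtain ⟨V, hV, hVU, hVd, hVc⟩ := h.exists_replacement hs hl hp hc hU ht₀.2
    (by linarith [hd t₀ ht₀.1])
  have hle : kin c V + S.potE c t₁ V ≤ kin c U + S.potE c t₁ U := by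
    refine kin_add_potE_le hVU ((hVc t₁ ht₀.1.2).trans ?_)
    refine le_trans ?_ (h.excursion_cost hl hc hcγ hU hst₀ ht₀.1.2 hsB.2
      (fun x hx => by linarith [hd x ⟨hx.1, hx.2.trans ht₀.1.2⟩]) (by linarith) hbefore)
    apply ENNReal.ofReal_le_ofReal
    have hC := h.minus_hyp.one_lt_C
    gcongr
    have : (S.pot (U t₀)).toReal ≤ 0 := by
      have := EReal.toReal_le_toReal ht₀.2 (h.pot_ne_bot _) EReal.zero_ne_top
      simpa using this
    linarith
  have hV0 : ∀ t, t₁ < t → 0 ≤ S.pot (V t) := fun t ht => by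
    rw [hVU t (ht₀.1.2.trans ht.le)]; exact hpos t ht
  refine ⟨V, t₁, hV, ?_, fun t ht => hVU t (ht₀.1.2.trans ht), hV0, fun t ht => ?_⟩
  · rw [h.energy_eq hc hU.continuous hpos, ereal_sub_neg_iff ENNReal.ofReal_ne_top] at hE
    rw [h.energy_eq hc hV.continuous hV0, ereal_sub_neg_iff ENNReal.ofReal_ne_top]
    exact hle.trans_lt hE
  · rcases le_total t t₀ with h' | h'
    · linarith [hVd t h']
    · rw [hVU t h']; exact hd t ⟨hst₀.le.trans h', ht⟩

/-! ### The space `X` and the dependence of the infimum on the speed -/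

theorem energy_mono {c : ℝ} {U V : ℝ → L} (hd : ∀ᵐ t, ‖deriv V t‖ ≤ ‖deriv U t‖)
    (hp : ∀ t, S.pot (V t) ≤ S.pot (U t)) : S.energy c V ≤ S.energy c U := by
  have h1 : ∀ᵐ t, S.density c V t ≤ S.density c U t := by
    filter_upwards [hd] with t ht
    refine mul_le_mul_of_nonneg_right (add_le_add ?_ (hp t)) (EReal.coe_nonneg.2 (Real.exp_pos _).le)
    rw [EReal.coe_le_coe_iff]
    gcongr
  unfold energy energyOn
  rw [Measure.restrict_univ]
  refine EReal.sub_le_sub ?_ ?_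
  · rw [EReal.coe_ennreal_le_coe_ennreal_iff]
    exact lintegral_mono_ae (h1.mono fun t ht => EReal.toENNReal_le_toENNReal ht)
  · rw [EReal.coe_ennreal_le_coe_ennreal_iff]
    exact lintegral_mono_ae (h1.mono fun t ht =>
      EReal.toENNReal_le_toENNReal (EReal.neg_le_neg_iff.2 ht))

/-- The condition at `+∞` in the definition of `X`. -/
def NearPlus (S : Setting L H Ht) (U : ℝ → L) : Prop :=
  ∃ T, ∀ t, T ≤ t → Metric.infDist (U t) S.plus.F ≤ S.plus.r₀ / 2

theorem nearPlus_of_mem_X {U : ℝ → L} (hU : U ∈ S.X) : S.NearPlus U := by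
  obtain ⟨-, T, -, h, -⟩ := hU
  exact ⟨T, h⟩

theorem mem_X_iff {U : ℝ → L} : U ∈ S.X ↔ MemH1loc U univ ∧ S.NearPlus U ∧
    ∃ T, ∀ t, t ≤ T → Metric.infDist (U t) S.minus.F ≤ S.minus.r₀ / 2 := by
  constructor
  · rintro ⟨h1, T, -, h2, h3⟩
    exact ⟨h1, ⟨T, h2⟩, -T, h3⟩
  · rintro ⟨h1, ⟨T, h2⟩, T', h3⟩
    refine ⟨h1, max 1 (max T (-T')), le_max_left _ _, fun t ht => h2 t ?_, fun t ht => h3 t ?_⟩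
    · exact ((le_max_left _ _).trans (le_max_right _ _)).trans ht
    · linarith [(le_max_right T (-T')).trans (le_max_right 1 (max T (-T')))]

theorem NearPlus.comp_affine {U : ℝ → L} (h : S.NearPlus U) {l : ℝ} (hl : 0 < l) (b : ℝ) :
    S.NearPlus fun t => U (l * t + b) := by
  obtain ⟨T, hT⟩ := h
  refine ⟨(T - b) / l, fun t ht => hT _ ?_⟩
  rw [div_le_iff₀ hl] at ht
  linarith

theorem mem_X_comp_affine {U : ℝ → L} (h : U ∈ S.X) {l : ℝ} (hl : 0 < l) (b : ℝ) :
    (fun t => U (l * t + b)) ∈ S.X := by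
  rw [mem_X_iff] at h ⊢
  obtain ⟨h1, h2, T, hT⟩ := h
  refine ⟨h1.comp_affine hl.ne' b, h2.comp_affine hl b, (T - b) / l, fun t ht => hT _ ?_⟩
  rw [le_div_iff₀ hl] at ht
  linarith

theorem Unbalanced.nonneg_of_nearPlus (h : S.Unbalanced) {U : ℝ → L} (hU : S.NearPlus U) :
    ∃ T, ∀ t, T < t → 0 ≤ S.pot (U t) := by
  obtain ⟨T, hT⟩ := hU
  exact ⟨T, fun t ht => h.pot_nonneg_plus (hT t ht.le)⟩

/-- The common factor does not affect the sign, so the shift `b` disappears and `l` survives only as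
`l ^ 2` before the kinetic part. -/
theorem Unbalanced.energy_comp_affine_neg_iff (h : S.Unbalanced) {c : ℝ} (hc : 0 < c) {U : ℝ → L}
    (hU : MemH1loc U univ) {T : ℝ} (hT : ∀ t, T < t → 0 ≤ S.pot (U t)) {l : ℝ} (hl : 0 < l)
    (b : ℝ) : S.energy (c * l) (fun t => U (l * t + b)) < 0 ↔
      ENNReal.ofReal (l ^ 2) * kin c U + S.potE c T U <
        ENNReal.ofReal (-S.a * Real.exp (c * T) / c) := by
  have hT' : ∀ t, (T - b) / l < t → 0 ≤ S.pot (U (l * t + b)) := fun t ht => hT _ (by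
    rw [div_lt_iff₀ hl] at ht; linarith)
  rw [h.energy_eq (mul_pos hc hl) (hU.comp_affine hl.ne' b).continuous hT',
    ereal_sub_neg_iff ENNReal.ofReal_ne_top, kin_comp_affine c hl b U, potE_comp_affine c T hl b U,
    level_comp_affine c T S.a hl b, ← mul_add, ENNReal.mul_lt_mul_iff_right]
  · simp only [ne_eq, ENNReal.ofReal_eq_zero, not_le]; positivity
  · exact ENNReal.ofReal_ne_top

/-- Without kinetic energy the curve is constant, whereas its two ends are at distance at least `d₀
> 0`. -/
theorem Unbalanced.kin_ne_zero (h : S.Unbalanced) (hb : S.ConvergenceBound) {c : ℝ} {U : ℝ → L}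
    (hU : U ∈ S.X) : kin c U ≠ 0 := by
  intro h0
  obtain ⟨hU, ⟨T, hT⟩, T', hT'⟩ := mem_X_iff.1 hU
  rw [kin, lintegral_eq_zero_iff (measurable_kdens c U)] at h0
  have hd : deriv U =ᵐ[volume] 0 := by
    filter_upwards [h0] with t ht
    simp only [kdens, Pi.zero_apply, ENNReal.ofReal_eq_zero] at ht
    have := Real.exp_pos (c * t)
    have h2 : ‖deriv U t‖ ^ 2 / 2 ≤ 0 := by
      by_contra hcon
      push Not at hcon
      nlinarith [mul_pos this hcon]
    simpa using le_antisymm (by linarith) (sq_nonneg ‖deriv U t‖)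
  have h1 := hU.integral_deriv T' T
  rw [intervalIntegral.integral_congr_ae (g := fun _ => (0 : L)) (hd.mono fun t ht _ => ht),
    intervalIntegral.integral_zero] at h1
  have h2 := h.d₀_le (hT T le_rfl) (hT' T' le_rfl)
  rw [h1, norm_zero] at h2
  exact absurd (d₀_pos h.a_neg hb) (not_lt.2 h2)

/-- Slowing down by `l = c' / c < 1` strictly lowers the kinetic part, which is finite and nonzero,
relative to the other terms. -/
theorem Unbalanced.exists_neg_of_lt (h : S.Unbalanced) (hb : S.ConvergenceBound) {c c' : ℝ}
    (hc' : 0 < c') (hcc : c' < c) {U : ℝ → L} (hU : U ∈ S.X) (hE : S.energy c U ≤ 0) :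
    ∃ V ∈ S.X, S.energy c' V < 0 := by
  have hc : 0 < c := hc'.trans hcc
  obtain ⟨T, hT⟩ := h.nonneg_of_nearPlus (nearPlus_of_mem_X hU)
  have hl : 0 < c' / c := by positivity
  refine ⟨_, mem_X_comp_affine hU hl 0, ?_⟩
  have := h.energy_comp_affine_neg_iff hc hU.1 hT hl 0
  rw [mul_div_cancel₀ _ hc.ne'] at this
  rw [this]
  rw [h.energy_eq hc hU.1.continuous hT, ereal_sub_nonpos_iff ENNReal.ofReal_ne_top] at hE
  refine lt_of_lt_of_le ?_ hE
  have hfin := ENNReal.add_ne_top.1 (ne_top_of_le_ne_top ENNReal.ofReal_ne_top hE)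
  refine ENNReal.add_lt_add_right hfin.2 ?_
  calc _ < 1 * kin c U := by
        rw [ENNReal.mul_lt_mul_iff_left (h.kin_ne_zero hb hU) hfin.1, ENNReal.ofReal_lt_one]
        have : c' / c < 1 := (div_lt_one hc).2 hcc
        nlinarith
    _ = _ := one_mul _

/-- For a fixed curve the sign criterion is continuous in `l`, so the strict inequality survives for
`l` slightly above one. Hence no energy is negative at the supremum of the speeds admitting a
negative one. -/
theorem Unbalanced.exists_gt_neg (h : S.Unbalanced) {c : ℝ} (hc : 0 < c) {U : ℝ → L}
    (hU : U ∈ S.X) (hE : S.energy c U < 0) :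
    ∃ c', c < c' ∧ ∃ V ∈ S.X, S.energy c' V < 0 := by
  obtain ⟨T, hT⟩ := h.nonneg_of_nearPlus (nearPlus_of_mem_X hU)
  rw [h.energy_eq hc hU.1.continuous hT, ereal_sub_neg_iff ENNReal.ofReal_ne_top] at hE
  have hfin := ENNReal.add_ne_top.1 (ne_top_of_le_ne_top ENNReal.ofReal_ne_top hE.le)
  have hcont : ContinuousAt (fun l : ℝ => ENNReal.ofReal (l ^ 2) * kin c U + S.potE c T U) 1 := by
    refine ContinuousAt.add ?_ continuousAt_const
    refine ENNReal.Tendsto.mul_const ?_ (Or.inr hfin.1)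
    exact (ENNReal.continuous_ofReal.comp (continuous_pow 2)).continuousAt
  have hev : ∀ᶠ l : ℝ in 𝓝[>] 1, ENNReal.ofReal (l ^ 2) * kin c U + S.potE c T U <
      ENNReal.ofReal (-S.a * Real.exp (c * T) / c) := by
    refine (hcont.tendsto.mono_left nhdsWithin_le_nhds).eventually_lt_const ?_
    simpa using hE
  obtain ⟨l, hl, hl1⟩ := (hev.and self_mem_nhdsWithin).exists
  have hl1 : 1 < l := hl1
  refine ⟨c * l, by nlinarith, _, mem_X_comp_affine hU (by linarith) 0, ?_⟩
  rwa [h.energy_comp_affine_neg_iff hc hU.1 hT (by linarith) 0]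

/-- Translation by `b` multiplies the energy by `e^{-cb}`; a negative energy is driven to `-∞` by `b
→ -∞`. -/
theorem Unbalanced.infX_eq_bot_iff (h : S.Unbalanced) {c : ℝ} (hc : 0 < c) :
    S.infX c = ⊥ ↔ ∃ U ∈ S.X, S.energy c U < 0 := by
  constructor
  · intro hbot
    have : S.infX c < 0 := by rw [hbot]; exact EReal.bot_lt_zero
    simpa [infX, iInf_lt_iff] using this
  · rintro ⟨U, hU, hE⟩
    obtain ⟨T, hT⟩ := h.nonneg_of_nearPlus (nearPlus_of_mem_X hU)
    rw [h.energy_eq hc hU.1.continuous hT, ereal_sub_neg_iff ENNReal.ofReal_ne_top] at hE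
    set D := kin c U + S.potE c T U
    set A := ENNReal.ofReal (-S.a * Real.exp (c * T) / c)
    have hA : A ≠ ⊤ := ENNReal.ofReal_ne_top
    have hD : D ≠ ⊤ := (hE.trans_le le_top).ne
    have hr : D.toReal - A.toReal < 0 := by
      have := (ENNReal.toReal_lt_toReal hD hA).2 hE
      linarith
    have hEb : ∀ b : ℝ, S.energy c (fun t => U (1 * t + b)) =
        ((Real.exp (-(c * b)) * (D.toReal - A.toReal) : ℝ) : EReal) := by
      intro b
      have hT' : ∀ t, (T - b) / 1 < t → 0 ≤ S.pot (U (1 * t + b)) := fun t ht => hT _ (by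
        rw [div_lt_iff₀ one_pos] at ht; linarith)
      have h1 := kin_comp_affine c one_pos b U
      have h2 := potE_comp_affine (S := S) c T one_pos b U
      have h3 := level_comp_affine c T S.a one_pos b
      rw [mul_one] at h1 h2 h3
      rw [h.energy_eq hc (hU.1.comp_affine one_ne_zero b).continuous hT', h1, h2, h3, ← mul_add]
      simp only [inv_one, mul_one, one_pow, ENNReal.ofReal_one, one_mul]
      change ((ENNReal.ofReal (Real.exp (-(c * b))) * D : ENNReal) : EReal) -
        ((ENNReal.ofReal (Real.exp (-(c * b))) * A : ENNReal) : EReal) = _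
      rw [← ENNReal.ofReal_toReal hD, ← ENNReal.ofReal_toReal hA,
        ← ENNReal.ofReal_mul (Real.exp_pos _).le, ← ENNReal.ofReal_mul (Real.exp_pos _).le,
        EReal.coe_ennreal_ofReal, EReal.coe_ennreal_ofReal, max_eq_left (by positivity),
        max_eq_left (by positivity), ← EReal.coe_sub, ENNReal.toReal_ofReal ENNReal.toReal_nonneg,
        ENNReal.toReal_ofReal ENNReal.toReal_nonneg]
      congr 1; ring
    rw [EReal.eq_bot_iff_forall_lt]
    intro y
    have htend : Tendsto (fun b : ℝ => Real.exp (-(c * b)) * (D.toReal - A.toReal)) atBot atBot := by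
      refine Tendsto.atTop_mul_const_of_neg hr (Real.tendsto_exp_atTop.comp ?_)
      exact tendsto_neg_atBot_atTop.comp (tendsto_id.const_mul_atBot hc)
    obtain ⟨b, hb⟩ := (htend.eventually_lt_atBot y).exists
    refine lt_of_le_of_lt (iInf₂_le _ (mem_X_comp_affine hU one_pos b)) ?_
    rw [hEb b, EReal.coe_lt_coe_iff]
    exact hb

/-- The energy is unbounded from below for small speeds. -/
theorem Unbalanced.exists_speed (h : S.Unbalanced) (hs : S.SmallerSpace) :
    ∃ c, 0 < c ∧ ∃ U ∈ S.X, S.energy c U < 0 := by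
  have ha := h.a_neg
  obtain ⟨p, hp⟩ := setH_nonempty hs h.minus_hyp h.pot_minus
  obtain ⟨q, hq⟩ := setH_nonempty hs h.plus_hyp fun f hf => (h.pot_plus f hf).1
  have hp' : S.incl p ∈ S.minus.F := hp
  have hq' : S.incl q ∈ S.plus.F := hq
  set z : L := S.incl (q - p) with hz
  let A : ℝ → L := fun t => S.incl p + t • z
  have hA : MemH1loc A univ := by
    have : ContDiff ℝ 1 A := by fun_prop
    exact this.memH1loc
  let W : ℝ → L := fun t => if t ≤ 0 then S.incl p else A t
  have hW : MemH1loc W univ := (contDiff_const.memH1loc).glue hA (by simp [A])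
  let V : ℝ → L := fun t => if t ≤ 1 then W t else S.incl q
  have hV : MemH1loc V univ := hW.glue contDiff_const.memH1loc (by simp [W, A, hz])
  have hVp : ∀ t, t ≤ 0 → V t = S.incl p := fun t ht => by
    simp only [V, W, if_pos ht, if_pos (ht.trans zero_le_one)]
  have hVq : ∀ t, 1 < t → V t = S.incl q := fun t ht => by simp only [V, if_neg (not_le.2 ht)]
  have hVA : ∀ t, 0 < t → t ≤ 1 → V t = A t := fun t ht ht' => by
    simp only [V, W, if_pos ht', if_neg (not_le.2 ht)]
  have hVX : V ∈ S.X := mem_X_iff.2 ⟨hV, ⟨2, fun t ht => by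
    rw [hVq t (by linarith), Metric.infDist_zero_of_mem hq']
    linarith [h.plus_hyp.r₀_pos]⟩, 0, fun t ht => by
    rw [hVp t ht, Metric.infDist_zero_of_mem hp']
    linarith [h.minus_hyp.r₀_pos]⟩
  obtain ⟨M, hM⟩ := (isCompact_Icc (a := (0:ℝ)) (b := 1)).exists_bound_of_continuousOn
    (f := fun t : ℝ => S.potH (p + t • (q - p)))
    ((hs.pot_C1.continuous.comp (by fun_prop)).continuousOn)
  have hpot : ∀ t ∈ Icc (0:ℝ) 1, S.pot (A t) ≤ (M : EReal) := by
    intro t ht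
    have e : A t = S.incl (p + t • (q - p)) := by simp [A, hz]
    rw [e, ← h.coe_potH hs, EReal.coe_le_coe_iff]
    exact (le_abs_self _).trans (hM t ht)
  have hMa : S.a ≤ M := by
    have := (h.a_le (A 0)).trans (hpot 0 (by simp))
    exact EReal.coe_le_coe_iff.1 this
  set B := ‖z‖ ^ 2 / 2 + (M - S.a) with hB
  have hBnn : 0 ≤ B := by have := sq_nonneg ‖z‖; linarith
  -- The transition during `(0, 1]` costs at most `e^c B`. For this `c` the subtracted level term is
  -- `-a e^c / c = e^c (B + 1)`.
  set c := -S.a / (B + 1) with hcdef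
  have hc : 0 < c := by apply div_pos <;> linarith
  have hT : ∀ t, 1 < t → 0 ≤ S.pot (V t) := fun t ht => by
    rw [hVq t ht, (h.pot_plus _ hq').1]
  refine ⟨c, hc, V, hVX, ?_⟩
  rw [h.energy_eq hc hV.continuous hT, ereal_sub_neg_iff ENNReal.ofReal_ne_top, kin_add_potE]
  have hae : ∀ᵐ t : ℝ, t ≠ 0 ∧ t ≠ 1 := by
    have h1 : ∀ᵐ t : ℝ, t ≠ 0 := by simp [ae_iff, measure_singleton]
    have h2 : ∀ᵐ t : ℝ, t ≠ 1 := by simp [ae_iff, measure_singleton]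
    filter_upwards [h1, h2] with t a b using ⟨a, b⟩
  have hbound : ∀ᵐ t : ℝ, kdens c V t + S.pdens c 1 V t ≤
      (Ioc (0:ℝ) 1).indicator (fun _ => ENNReal.ofReal (Real.exp c * B)) t := by
    filter_upwards [hae] with t ht
    rcases lt_or_gt_of_ne ht.1 with h' | h'
    · have hev : V =ᶠ[𝓝 t] fun _ => S.incl p := by
        filter_upwards [Iio_mem_nhds h'] with s hs using hVp s (le_of_lt hs)
      rw [kdens_congr hev, pdens, if_pos (by linarith), hVp t h'.le, h.pot_minus _ hp',
        ← EReal.coe_sub, sub_self]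
      simp [kdens]
    rcases lt_or_gt_of_ne ht.2 with h'' | h''
    · rw [indicator_of_mem (show t ∈ Ioc (0:ℝ) 1 from ⟨h', h''.le⟩)]
      have hev : V =ᶠ[𝓝 t] A := by
        filter_upwards [Ioo_mem_nhds h' h''] with s hs using hVA s hs.1 hs.2.le
      have hdA : deriv A t = z := by
        have : HasDerivAt A ((1 : ℝ) • z) t :=
          ((hasDerivAt_id t).smul_const z).const_add (S.incl p)
        rw [this.deriv, one_smul]
      have hexp : Real.exp (c * t) ≤ Real.exp c := by
        rw [Real.exp_le_exp]; nlinarith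
      rw [kdens_congr hev, kdens, pdens, if_pos h''.le, hVA t h' h''.le, hdA, hB, mul_add,
        ENNReal.ofReal_add (by positivity) (mul_nonneg (Real.exp_pos _).le (by linarith)),
        ENNReal.ofReal_mul (p := Real.exp c) (q := M - S.a) (Real.exp_pos _).le]
      gcongr
      rw [← toENNReal_coe_real, EReal.coe_sub]
      exact EReal.toENNReal_le_toENNReal (EReal.sub_le_sub (hpot t ⟨h'.le, h''.le⟩) le_rfl)
    · have hev : V =ᶠ[𝓝 t] fun _ => S.incl q := by
        filter_upwards [Ioi_mem_nhds h''] with s hs using hVq s hs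
      rw [kdens_congr hev, pdens, if_neg (not_le.2 h''), hVq t h'', (h.pot_plus _ hq').1]
      simp [kdens]
  refine (lintegral_mono_ae hbound).trans_lt ?_
  rw [lintegral_indicator measurableSet_Ioc, setLIntegral_const, Real.volume_Ioc]
  simp only [sub_zero, ENNReal.ofReal_one, mul_one]
  rw [ENNReal.ofReal_lt_ofReal_iff_of_nonneg (by positivity)]
  have : -S.a * Real.exp c / c = Real.exp c * (B + 1) := by
    rw [div_eq_iff hc.ne', hcdef]
    field_simp
  rw [this]
  have := Real.exp_pos c
  nlinarith

/-! ### Weak limits of curves -/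

/-- Closed neighbourhoods of a minimizing set are weakly sequentially closed. -/
theorem infDist_le_of_tendsto_inner (hs : S.SmallerSpace) {w : Well L H} {m : ℝ}
    (hw : S.WellHyp w m) (hm : ∀ f ∈ w.F, S.pot f = m) (hcomp : S.CompactnessAt w)
    {v : ℕ → L} {v₀ : L} {R r : ℝ} (hr : r ≤ w.r₀) (hv : ∀ n, ‖v n‖ ≤ R)
    (hd : ∀ n, Metric.infDist (v n) w.F ≤ r)
    (hlim : ∀ y : L, Tendsto (fun n => inner ℝ (v n) y) atTop (𝓝 (inner ℝ v₀ y))) :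
    Metric.infDist v₀ w.F ≤ r := by
  -- The nearest points form a bounded sequence, so a subsequence converges strongly to a point of
  -- the set. The differences `v - P v` then converge weakly, and the bound `r` on their norms
  -- passes to the limit.
  have hP : ∀ n, w.P (v n) ∈ w.F ∧ ‖v n - w.P (v n)‖ ≤ r := fun n => by
    have := hw.proj (v n) ((mem_nbhd_iff hw.nonempty hw.r₀_pos.le).2 ((hd n).trans hr))
    exact ⟨this.1, this.2.1.le.trans (hd n)⟩
  have hlift : ∀ n, ∃ x : H, S.incl x = w.P (v n) := fun n =>
    (hs.finite_iff _).1 (by rw [hm _ (hP n).1]; exact EReal.coe_lt_top m)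
  choose x hx using hlift
  have hbdd : Bornology.IsBounded (range fun n => w.P (v n)) := by
    rw [isBounded_iff_forall_norm_le]
    refine ⟨R + r, ?_⟩
    rintro _ ⟨n, rfl⟩
    calc ‖w.P (v n)‖ = ‖v n - (v n - w.P (v n))‖ := by rw [sub_sub_cancel]
      _ ≤ ‖v n‖ + ‖v n - w.P (v n)‖ := norm_sub_le _ _
      _ ≤ R + r := add_le_add (hv n) (hP n).2
  have hK := hcomp (range fun n => w.P (v n)) (by rintro _ ⟨n, rfl⟩; exact (hP n).1) hbdd
  obtain ⟨x₀, -, φ, hφ, hx₀⟩ := hK.isSeqCompact (x := x) fun n =>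
    subset_closure ⟨n, (hx n).symm⟩
  have hp : Tendsto (fun n => w.P (v (φ n))) atTop (𝓝 (S.incl x₀)) := by
    have := (hs.continuous_incl.tendsto x₀).comp hx₀
    simpa only [Function.comp_def, hx] using this
  have hpF : S.incl x₀ ∈ w.F := hw.isClosed.mem_of_tendsto hp (Eventually.of_forall fun n => (hP _).1)
  refine (Metric.infDist_le_dist_of_mem hpF).trans ?_
  rw [dist_eq_norm]
  refine norm_le_of_tendsto_inner (l := atTop) (u := fun n => v (φ n) - w.P (v (φ n)))
    (k := fun _ => r) (fun y => ?_) (fun n => (hP _).2) tendsto_const_nhds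
  simp only [inner_sub_left]
  exact ((hlim y).comp hφ.tendsto_atTop).sub (hp.inner tendsto_const_nhds)

theorem two_mul_ofReal (x : ℝ) : 2 * ENNReal.ofReal x = ENNReal.ofReal (2 * x) := by
  rw [ENNReal.ofReal_mul (by norm_num)]
  norm_num

theorem enorm_sq_eq (x : L) : ‖x‖ₑ ^ 2 = ENNReal.ofReal (‖x‖ ^ 2) := by
  rw [← ofReal_norm, ENNReal.ofReal_pow (norm_nonneg _)]

/-- Curves with bounded weighted kinetic energy have weakly convergent subsequences. -/
theorem exists_weak_limit {c : ℝ} {V : ℕ → ℝ → L} (hV : ∀ n, MemH1loc (V n) univ) {R k : ℝ}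
    (hR : ∀ n, ‖V n 0‖ ≤ R) (hfin : ∀ n, kin c (V n) ≠ ⊤)
    (hk : Tendsto (fun n => (kin c (V n)).toReal) atTop (𝓝 k)) :
    ∃ (U : ℝ → L) (φ : ℕ → ℕ), StrictMono φ ∧ MemH1loc U univ ∧
      (∀ t y, Tendsto (fun n => inner ℝ (V (φ n) t) y) atTop (𝓝 (inner ℝ (U t) y))) ∧
      kin c U ≤ ENNReal.ofReal k := by
  -- With half of the weight attached to the derivative, `2 * kin` is a squared norm in the
  -- unweighted `L²(ℝ)`, where bounded sequences have weak limits and the norm is weakly lower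
  -- semicontinuous.
  let w : ℝ → ℝ := fun t => Real.exp (c * t / 2)
  have hwc : Continuous w := by fun_prop
  have hwpos : ∀ t, 0 < w t := fun t => Real.exp_pos _
  have hw2 : ∀ t, w t ^ 2 = Real.exp (c * t) := fun t => by
    simp only [w]; rw [← Real.exp_nat_mul]; congr 1; push_cast; ring
  have hlint : ∀ n, ∫⁻ t, ‖w t • deriv (V n) t‖ₑ ^ 2 = 2 * kin c (V n) := by
    intro n
    rw [kin, ← lintegral_const_mul' _ _ (by norm_num)]
    refine lintegral_congr fun t => ?_
    rw [enorm_sq_eq, kdens, two_mul_ofReal, norm_smul, mul_pow, Real.norm_eq_abs, sq_abs, hw2]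
    congr 1; ring
  have hmem : ∀ n, MemLp (fun t => w t • deriv (V n) t) 2 volume := by
    intro n
    refine ⟨(hwc.stronglyMeasurable.smul (stronglyMeasurable_deriv _)).aestronglyMeasurable, ?_⟩
    rw [eLpNorm_lt_top_iff_lintegral_rpow_enorm_lt_top (by norm_num) (by norm_num)]
    simp only [ENNReal.toReal_ofNat, ENNReal.rpow_two, hlint]
    exact ENNReal.mul_lt_top (by norm_num) (hfin n).lt_top
  let u : ℕ → Lp L 2 (volume : Measure ℝ) := fun n => (hmem n).toLp _
  have hnorm : ∀ (f : ℝ → L) (hf : MemLp f 2 volume),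
      ENNReal.ofReal (‖hf.toLp f‖ ^ 2) = ∫⁻ t, ‖f t‖ₑ ^ 2 := by
    intro f hf
    rw [Lp.norm_toLp, ← ENNReal.toReal_pow, ENNReal.ofReal_toReal (ENNReal.pow_ne_top hf.2.ne),
      eLpNorm_eq_lintegral_rpow_enorm_toReal (by norm_num) (by norm_num)]
    simp only [ENNReal.toReal_ofNat, ENNReal.rpow_two]
    rw [← ENNReal.rpow_natCast, ← ENNReal.rpow_mul]
    norm_num
  have hu : ∀ n, ‖u n‖ = √(2 * (kin c (V n)).toReal) := by
    intro n
    have h1 := hnorm _ (hmem n)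
    rw [hlint] at h1
    have h2 : ‖u n‖ ^ 2 = 2 * (kin c (V n)).toReal := by
      have := congrArg ENNReal.toReal h1
      rwa [ENNReal.toReal_ofReal (sq_nonneg _), ENNReal.toReal_mul, ENNReal.toReal_ofNat] at this
    rw [← h2, Real.sqrt_sq (norm_nonneg _)]
  have hulim : Tendsto (fun n => ‖u n‖) atTop (𝓝 √(2 * k)) := by
    simp only [hu]
    exact (Real.continuous_sqrt.tendsto _).comp (hk.const_mul 2)
  obtain ⟨M, hM⟩ := hulim.bddAbove_range
  obtain ⟨u₀, ψ, hψ, hu₀⟩ := exists_subseq_tendsto_inner (fun n => V n 0) R hR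
  obtain ⟨g, χ, hχ, hg⟩ := exists_subseq_tendsto_inner (fun n => u (ψ n)) M
    fun n => hM (mem_range_self _)
  have hgmem : MemLp g 2 volume := Lp.memLp g
  let f : ℝ → L := fun t => (w t)⁻¹ • g t
  have hwinv : Continuous fun t => (w t)⁻¹ := hwc.inv₀ fun t => (hwpos t).ne'
  have hfK : ∀ K : Set ℝ, IsCompact K → MemLp f 2 (volume.restrict K) := by
    intro K hK
    obtain ⟨C, hC⟩ := hK.exists_bound_of_continuousOn hwinv.continuousOn
    refine (hgmem.restrict K).of_le_mul (c := C)
      (hwinv.aestronglyMeasurable.smul (hgmem.restrict K).1) ?_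
    refine (ae_restrict_iff' hK.measurableSet).2 (Eventually.of_forall fun t ht => ?_)
    rw [norm_smul]
    exact mul_le_mul_of_nonneg_right (hC t ht) (norm_nonneg _)
  have hfint : ∀ s t, IntervalIntegrable f volume s t := fun s t => by
    rw [intervalIntegrable_iff']
    have : IsFiniteMeasure (volume.restrict (uIcc s t)) :=
      ⟨by simp⟩
    exact (hfK _ isCompact_uIcc).integrable (by norm_num)
  let U : ℝ → L := fun t => u₀ + ∫ x in (0:ℝ)..t, f x
  have hU : MemH1loc U univ := ⟨f, fun K _ hK => hfK K hK, fun s t _ => by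
    simp only [U]
    rw [add_sub_add_left_eq_sub, intervalIntegral.integral_interval_sub_left (hfint 0 t) (hfint 0 s)]⟩
  have hUd : ∀ᵐ t, deriv U t = f t := by
    have hloc : LocallyIntegrable f := by
      rw [locallyIntegrable_iff]
      intro K hK
      have : IsFiniteMeasure (volume.restrict K) := ⟨by simpa using hK.measure_lt_top⟩
      exact (hfK K hK).integrable (by norm_num)
    filter_upwards [LocallyIntegrable.ae_hasDerivAt_integral hloc] with t ht
    exact ((ht 0).const_add u₀).deriv
  have key : ∀ s t, s ≤ t → ∀ y, Tendsto
      (fun n => inner ℝ (V (ψ (χ n)) t - V (ψ (χ n)) s) y) atTop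
      (𝓝 (inner ℝ (∫ x in s..t, f x) y)) := by
    intro s t hst y
    -- Testing against `w⁻¹ y` on `(s, t]` undoes the weight and recovers the increments of the
    -- curves in the direction `y`.
    have hym : MemLp ((Ioc s t).indicator fun x => (w x)⁻¹ • y) 2 volume := by
      rw [memLp_indicator_iff_restrict measurableSet_Ioc]
      obtain ⟨C, hC⟩ := (isCompact_Icc (a := s) (b := t)).exists_bound_of_continuousOn
        (hwinv.smul continuous_const : Continuous fun x => (w x)⁻¹ • y).continuousOn
      refine MemLp.of_bound (hwinv.smul continuous_const).aestronglyMeasurable C ?_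
      exact (ae_restrict_iff' measurableSet_Ioc).2
        (Eventually.of_forall fun x hx => hC x (Ioc_subset_Icc_self hx))
    have hinner : ∀ (z : Lp L 2 (volume : Measure ℝ)) (q : ℝ → L), (z =ᵐ[volume] fun t => w t • q t) →
        IntegrableOn q (Ioc s t) → inner ℝ z (hym.toLp _) = inner ℝ (∫ x in s..t, q x) y := by
      intro z q hz hq
      rw [L2.inner_def, intervalIntegral.integral_of_le hst, real_inner_comm,
        ← integral_inner hq, ← integral_indicator measurableSet_Ioc]
      refine integral_congr_ae ?_
      filter_upwards [hz, hym.coeFn_toLp] with x h1 h2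
      rw [h1, h2]
      by_cases hx : x ∈ Ioc s t
      · rw [indicator_of_mem hx, indicator_of_mem hx, real_inner_smul_left, real_inner_smul_right,
          ← mul_assoc, mul_inv_cancel₀ (hwpos x).ne', one_mul, real_inner_comm]
      · rw [indicator_of_notMem hx, indicator_of_notMem hx, inner_zero_right]
    have h1 := hg (hym.toLp _)
    have e2 : inner ℝ g (hym.toLp _) = inner ℝ (∫ x in s..t, f x) y := by
      refine hinner g f (Eventually.of_forall fun t => ?_) ((intervalIntegrable_iff_integrableOn_Ioc_of_le hst).1 (hfint s t))
      simp only [f]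
      rw [smul_smul, mul_inv_cancel₀ (hwpos t).ne', one_smul]
    rw [e2] at h1
    refine h1.congr fun n => ?_
    rw [(hV _).integral_deriv]
    exact hinner _ _ (hmem _).coeFn_toLp
      ((intervalIntegrable_iff_integrableOn_Ioc_of_le hst).1 ((hV _).intervalIntegrable s t))
  refine ⟨U, fun n => ψ (χ n), hψ.comp hχ, hU, fun t y => ?_, ?_⟩
  · have h0 := (hu₀ y).comp hχ.tendsto_atTop
    rcases le_total 0 t with ht | ht
    · have h1 := h0.add (key 0 t ht y)
      simp only [U, inner_add_left]
      refine h1.congr fun n => ?_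
      rw [inner_sub_left]
      simp
    · have h1 := h0.sub (key t 0 ht y)
      simp only [U]
      rw [intervalIntegral.integral_symm, ← sub_eq_add_neg, inner_sub_left]
      refine h1.congr fun n => ?_
      rw [inner_sub_left]
      simp
  · have hkn : 0 ≤ k := ge_of_tendsto' hk fun n => ENNReal.toReal_nonneg
    have hgk : ‖g‖ ≤ √(2 * k) := norm_le_of_tendsto_inner hg (fun n => le_rfl)
      (hulim.comp (hψ.comp hχ).tendsto_atTop)
    have h1 : ∫⁻ t, ‖g t‖ₑ ^ 2 = ENNReal.ofReal (‖g‖ ^ 2) := by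
      rw [← hnorm _ hgmem, Lp.toLp_coeFn]
    have h2 : 2 * kin c U = ∫⁻ t, ‖g t‖ₑ ^ 2 := by
      rw [kin, ← lintegral_const_mul' _ _ (by norm_num)]
      refine lintegral_congr_ae ?_
      filter_upwards [hUd] with t ht
      rw [enorm_sq_eq, kdens, ht, two_mul_ofReal, norm_smul, norm_inv, mul_pow, Real.norm_eq_abs,
        inv_pow, sq_abs, hw2]
      congr 1
      have := (Real.exp_pos (c * t)).ne'
      field_simp
    have h3 : 2 * kin c U ≤ 2 * ENNReal.ofReal k := by
      rw [h2, h1, two_mul_ofReal]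
      apply ENNReal.ofReal_le_ofReal
      calc ‖g‖ ^ 2 ≤ √(2 * k) ^ 2 := pow_le_pow_left₀ (norm_nonneg _) hgk 2
        _ = 2 * k := Real.sq_sqrt (by positivity)
    exact (ENNReal.mul_le_mul_iff_right (by norm_num) (by norm_num)).1 h3

theorem toENNReal_sub_le_liminf {x : EReal} {u : ℕ → EReal} {a : ℝ} (h : x ≤ liminf u atTop) :
    (x - (a : EReal)).toENNReal ≤ liminf (fun n => (u n - (a : EReal)).toENNReal) atTop := by
  have hc : Continuous fun x : EReal => (x - (a : EReal)).toENNReal := by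
    refine EReal.continuous_toENNReal.comp (continuous_iff_continuousAt.2 fun x => ?_)
    have h1 := EReal.continuousAt_add (p := (x, -(a : EReal)))
      (Or.inr (by rw [← EReal.coe_neg]; exact EReal.coe_ne_bot _))
      (Or.inr (by rw [← EReal.coe_neg]; exact EReal.coe_ne_top _))
    exact ContinuousAt.comp (f := fun x : EReal => (x, -(a : EReal))) h1
      (by fun_prop)
  refine (toENNReal_sub_mono a h).trans (le_of_eq ?_)
  exact (toENNReal_sub_mono a).map_liminf_of_continuousAt _ hc.continuousAt

/-- Fatou's lemma on top of the weak lower semicontinuity of the potential at each time. -/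
theorem Unbalanced.potE_le_liminf (h : S.Unbalanced) {c T : ℝ} {V : ℕ → ℝ → L} {U : ℝ → L}
    (hV : ∀ n, Continuous (V n))
    (hlim : ∀ t y, Tendsto (fun n => inner ℝ (V n t) y) atTop (𝓝 (inner ℝ (U t) y))) :
    S.potE c T U ≤ liminf (fun n => S.potE c T (V n)) atTop := by
  refine le_trans (lintegral_mono fun t => ?_)
    (lintegral_liminf_le fun n => h.measurable_pdens c T (hV n))
  have h1 := h.weakly_lsc _ _ (hlim t)
  have hcm : Continuous fun x : ENNReal => ENNReal.ofReal (Real.exp (c * t)) * x :=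
    ENNReal.continuous_const_mul ENNReal.ofReal_ne_top
  have hmono : Monotone fun x : ENNReal => ENNReal.ofReal (Real.exp (c * t)) * x :=
    fun _ _ h => by dsimp only; gcongr
  simp only [pdens]
  split_ifs
  · refine (hmono (toENNReal_sub_le_liminf (a := S.a) h1)).trans (le_of_eq ?_)
    exact hmono.map_liminf_of_continuousAt _ hcm.continuousAt
  · have h2 := toENNReal_sub_le_liminf (a := 0) h1
    simp only [EReal.coe_zero, sub_zero] at h2
    refine (hmono h2).trans (le_of_eq ?_)
    exact hmono.map_liminf_of_continuousAt _ hcm.continuousAt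

/-! ### Normalized curves and existence of a minimizer -/

/-- Curves can be transformed, without increasing the energy, so that they pass through a fixed
bounded region. -/
theorem Unbalanced.exists_anchored (h : S.Unbalanced) (hinv : S.InverseProjAt S.plus) :
    ∃ R : ℝ, ∀ U : ℝ → L, MemH1loc U univ → S.NearPlus U → ∃ W : ℝ → L, MemH1loc W univ ∧
      (∀ c, S.energy c W ≤ S.energy c U) ∧
      ∃ T, (∀ t, T ≤ t → Metric.infDist (W t) S.plus.F ≤ S.plus.r₀ / 2) ∧ ‖W T‖ ≤ R := by
  have hr := h.plus_hyp.r₀_pos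
  have hmem : ∀ {v : L}, Metric.infDist v S.plus.F ≤ S.plus.r₀ / 2 →
      v ∈ S.nbhd S.plus S.plus.r₀ := fun hv =>
    (mem_nbhd_iff h.plus_hyp.nonempty hr.le).2 (by linarith)
  rcases hinv with hb | hQ
  · obtain ⟨R₀, hR₀⟩ := isBounded_iff_forall_norm_le.1 hb
    refine ⟨R₀ + S.plus.r₀ / 2, fun U hU hUp => ⟨U, hU, fun _ => le_rfl, ?_⟩⟩
    obtain ⟨T, hT⟩ := hUp
    refine ⟨T, hT, ?_⟩
    have hd := hT T le_rfl
    obtain ⟨h1, h2, -⟩ := h.plus_hyp.proj (U T) (hmem hd)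
    calc ‖U T‖ = ‖S.plus.P (U T) + (U T - S.plus.P (U T))‖ := by rw [add_sub_cancel]
      _ ≤ ‖S.plus.P (U T)‖ + ‖U T - S.plus.P (U T)‖ := norm_add_le _ _
      _ ≤ _ := add_le_add (hR₀ _ h1) (h2.le.trans hd)
  · obtain ⟨f, hf⟩ := h.plus_hyp.nonempty
    refine ⟨‖f‖ + S.plus.r₀ / 2, fun U hU hUp => ?_⟩
    obtain ⟨T, hT⟩ := hUp
    have hd := hT T le_rfl
    -- The map makes a fixed `f` the nearest point of the curve at time `T`. Applying it to the
    -- whole curve may destroy the condition at `-∞`, which `exists_modification` provides afresh.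
    obtain ⟨Q, hQP, hQd, hQdiff, hQn, hQpot⟩ := hQ (U T) (hmem hd) f hf
    -- By the mean value inequality a norm-preserving differential makes `Q` 1-Lipschitz, so
    -- composition does not raise the kinetic energy.
    have hlip : ∀ x y, ‖Q y - Q x‖ ≤ ‖y - x‖ := fun x y => by
      have := convex_univ.norm_image_sub_le_of_norm_fderiv_le (𝕜 := ℝ) (f := Q) (C := 1)
        (fun z _ => hQdiff z)
        (fun z _ => ContinuousLinearMap.opNorm_le_bound _ zero_le_one fun y => by
          rw [hQn, one_mul]) (mem_univ x) (mem_univ y)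
      simpa using this
    refine ⟨fun t => Q (U t), hU.of_norm_sub_le fun s t => hlip _ _, fun c => ?_, T,
      fun t ht => ?_, ?_⟩
    · exact energy_mono (hU.ae_norm_deriv_le fun s t => hlip _ _) fun t => (hQpot _).le
    · rw [hQd]; exact hT t ht
    · have hd' : Metric.infDist (Q (U T)) S.plus.F ≤ S.plus.r₀ / 2 := by rw [hQd]; exact hd
      obtain ⟨-, h2, -⟩ := h.plus_hyp.proj (Q (U T)) (hmem hd')
      rw [hQP] at h2
      calc ‖Q (U T)‖ = ‖f + (Q (U T) - f)‖ := by rw [add_sub_cancel]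
        _ ≤ ‖f‖ + ‖Q (U T) - f‖ := norm_add_le _ _
        _ ≤ _ := by gcongr; exact h2.le.trans hd'

/-- Curves of negative energy yield normalized curves for a larger speed. -/
theorem Unbalanced.exists_normalized (h : S.Unbalanced) (hs : S.SmallerSpace) (hl : S.LevelSets)
    (hp : S.ProjH) (hb : S.ConvergenceBound) {R : ℝ}
    (hR : ∀ U : ℝ → L, MemH1loc U univ → S.NearPlus U → ∃ W : ℝ → L, MemH1loc W univ ∧
      (∀ c, S.energy c W ≤ S.energy c U) ∧
      ∃ T, (∀ t, T ≤ t → Metric.infDist (W t) S.plus.F ≤ S.plus.r₀ / 2) ∧ ‖W T‖ ≤ R)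
    {c c₀ : ℝ} (hc : 0 < c) (hc₀ : 0 < c₀) (hcγ : c < S.gammaMinus) {U : ℝ → L}
    (hU : U ∈ S.X) (hE : S.energy c U < 0) :
    ∃ V : ℝ → L, MemH1loc V univ ∧ S.NearPlus V ∧
      (∀ t, t ≤ 0 → Metric.infDist (V t) S.minus.F ≤ S.minus.r₀ / 2) ∧
      (∃ T, 0 ≤ T ∧ ‖V T‖ ≤ R) ∧
      ENNReal.ofReal ((c / c₀) ^ 2) * kin c₀ V + S.potE c₀ 0 V < ENNReal.ofReal (-S.a / c₀) := by
  obtain ⟨W, hW, hWE, T, hT, hWT⟩ := hR U hU.1 (nearPlus_of_mem_X hU)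
  obtain ⟨V, t₁, hV, hVE, hVW, hV0, hVd⟩ :=
    h.exists_modification hs hl hp hc hcγ hW ((hWE c).trans_lt hE) ⟨T, hT⟩
  have hVp : S.NearPlus V := ⟨max T t₁, fun t ht => by
    rw [hVW t ((le_max_right _ _).trans ht)]; exact hT t ((le_max_left _ _).trans ht)⟩
  -- The curve is near `F⁻` at `t₁` and near `F⁺` from `T` on, and these neighbourhoods are at
  -- positive distance. The anchor thus survives the modification and sits at a positive time once
  -- `t₁` is moved to zero.
  have htT : t₁ < T := by
    by_contra hcon
    have h1 := h.d₀_le (hT t₁ (not_lt.1 hcon)) (hVW t₁ le_rfl ▸ hVd t₁ le_rfl)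
    rw [sub_self, norm_zero] at h1
    exact absurd (d₀_pos h.a_neg hb) (not_lt.2 h1)
  -- Besides moving `t₁` to zero, time is rescaled so that all curves carry the weight of speed
  -- `c₀`. What remains of their own speed is the factor `(c / c₀)²`.
  set l := c₀ / c with hldef
  have hlpos : 0 < l := by positivity
  have hcl : c * l = c₀ := by rw [hldef]; field_simp
  have h1 := kin_comp_affine c hlpos t₁ V
  have h2 := potE_comp_affine (S := S) c t₁ hlpos t₁ V
  have h3 := level_comp_affine c t₁ S.a hlpos t₁
  rw [sub_self, zero_div, hcl] at h2 h3
  rw [hcl] at h1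
  rw [mul_zero, Real.exp_zero, mul_one] at h3
  refine ⟨fun t => V (l * t + t₁), hV.comp_affine hlpos.ne' t₁, hVp.comp_affine hlpos t₁,
    fun t ht => hVd _ ?_, ⟨(T - t₁) / l, ?_, ?_⟩, ?_⟩
  · nlinarith [mul_nonneg hlpos.le (neg_nonneg.2 ht)]
  · exact div_nonneg (by linarith) hlpos.le
  · dsimp only
    rw [mul_div_cancel₀ _ hlpos.ne', sub_add_cancel, hVW T htT.le]; exact hWT
  · rw [h.energy_eq hc hV.continuous hV0, ereal_sub_neg_iff ENNReal.ofReal_ne_top] at hVE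
    set k := ENNReal.ofReal (Real.exp (-(c * t₁)) * l⁻¹) with hk
    have hk0 : k ≠ 0 := by
      simp only [hk, ne_eq, ENNReal.ofReal_eq_zero, not_le]; positivity
    rw [h1, h2, h3]
    have e : ENNReal.ofReal ((c / c₀) ^ 2) * (k * (ENNReal.ofReal (l ^ 2) * kin c V)) =
        k * kin c V := by
      rw [mul_left_comm, ← mul_assoc (ENNReal.ofReal ((c / c₀) ^ 2)),
        ← ENNReal.ofReal_mul (by positivity)]
      have : (c / c₀) ^ 2 * l ^ 2 = 1 := by rw [hldef]; field_simp
      rw [this, ENNReal.ofReal_one, one_mul]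
    rw [e, ← mul_add, ENNReal.mul_lt_mul_iff_right hk0 ENNReal.ofReal_ne_top]
    exact hVE

/-- Passage to the limit in sequences of normalized curves. -/
theorem Unbalanced.exists_limit (h : S.Unbalanced) (hs : S.SmallerSpace) (hcomp : S.Compactness)
    {c : ℝ} (hc : 0 < c) {R : ℝ} {μ : ℕ → ℝ} (hμ : ∀ n, 1 / 4 ≤ μ n)
    (hμlim : Tendsto μ atTop (𝓝 1)) {V : ℕ → ℝ → L} (hV : ∀ n, MemH1loc (V n) univ)
    (hplus : ∀ n, S.NearPlus (V n))
    (hminus : ∀ n t, t ≤ 0 → Metric.infDist (V n t) S.minus.F ≤ S.minus.r₀ / 2)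
    (hR : ∀ n, ∃ T, 0 ≤ T ∧ ‖V n T‖ ≤ R)
    (hE : ∀ n, ENNReal.ofReal (μ n) * kin c (V n) + S.potE c 0 (V n) <
      ENNReal.ofReal (-S.a / c)) :
    ∃ U ∈ S.X, S.energy c U ≤ 0 := by
  have ha := h.a_neg
  set A := -S.a / c with hA
  have hApos : 0 < A := div_pos (by linarith) hc
  have hμpos : ∀ n, 0 < μ n := fun n => by linarith [hμ n]
  have hkinle : ∀ n, kin c (V n) ≤ ENNReal.ofReal (4 * A) := by
    intro n
    have h1 : ENNReal.ofReal (1 / 4) * kin c (V n) ≤ ENNReal.ofReal A := by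
      refine le_trans ?_ (hE n).le
      refine le_trans ?_ le_self_add
      gcongr
      exact hμ n
    calc kin c (V n) = ENNReal.ofReal 4 * (ENNReal.ofReal (1 / 4) * kin c (V n)) := by
          rw [← mul_assoc, ← ENNReal.ofReal_mul (by norm_num)]; norm_num
      _ ≤ ENNReal.ofReal 4 * ENNReal.ofReal A := by gcongr
      _ = _ := by rw [← ENNReal.ofReal_mul (by norm_num)]
  have hkinfin : ∀ n, kin c (V n) ≠ ⊤ := fun n => ne_top_of_le_ne_top ENNReal.ofReal_ne_top (hkinle n)
  have hpotfin : ∀ n, S.potE c 0 (V n) ≠ ⊤ := fun n =>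
    (ENNReal.add_ne_top.1 (ne_top_of_le_ne_top ENNReal.ofReal_ne_top (hE n).le)).2
  have hmove : ∀ n s t, s ≤ t → ‖V n t - V n s‖ ≤ √(2 * (4 * A) * (Real.exp (-c * s) / c)) :=
    fun n s t hst => Real.le_sqrt_of_sq_le (norm_sub_sq_le hc (hV n) (by positivity) (hkinle n) hst)
  have hbound : ∀ t, ∃ M, ∀ n, ‖V n t‖ ≤ M := by
    have h0 : ∀ n, ‖V n 0‖ ≤ R + √(2 * (4 * A) * (Real.exp (-c * 0) / c)) := by
      intro n
      obtain ⟨T, hT, hTR⟩ := hR n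
      calc ‖V n 0‖ = ‖V n T - (V n T - V n 0)‖ := by rw [sub_sub_cancel]
        _ ≤ ‖V n T‖ + ‖V n T - V n 0‖ := norm_sub_le _ _
        _ ≤ _ := add_le_add hTR (hmove n 0 T hT)
    intro t
    refine ⟨R + √(2 * (4 * A) * (Real.exp (-c * 0) / c)) +
      max √(2 * (4 * A) * (Real.exp (-c * 0) / c)) √(2 * (4 * A) * (Real.exp (-c * t) / c)),
      fun n => ?_⟩
    calc ‖V n t‖ = ‖V n 0 + (V n t - V n 0)‖ := by rw [add_sub_cancel]
      _ ≤ ‖V n 0‖ + ‖V n t - V n 0‖ := norm_add_le _ _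
      _ ≤ _ := by
        refine add_le_add (h0 n) ?_
        rcases le_total 0 t with ht | ht
        · exact (hmove n 0 t ht).trans (le_max_left _ _)
        · rw [norm_sub_rev]; exact (hmove n t 0 ht).trans (le_max_right _ _)
  -- Once the kinetic energies converge to some `k`, the two parts pass to the limit separately: the
  -- kinetic part is at most `k` and the potential part at most `A - k`.
  obtain ⟨k, -, φ, hφ, hk⟩ := (isCompact_Icc (a := (0:ℝ)) (b := 4 * A)).tendsto_subseq
    (x := fun n => (kin c (V n)).toReal) fun n =>
      ⟨ENNReal.toReal_nonneg, by
        have := ENNReal.toReal_mono ENNReal.ofReal_ne_top (hkinle n)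
        rwa [ENNReal.toReal_ofReal (by positivity)] at this⟩
  obtain ⟨R₀, hR₀⟩ := hbound 0
  obtain ⟨U, ψ, hψ, hU, hlim, hkU⟩ := exists_weak_limit (fun n => hV (φ n))
    (fun n => hR₀ (φ n)) (fun n => hkinfin (φ n)) hk
  have hpotle : ∀ n, S.potE c 0 (V n) ≤ ENNReal.ofReal (A - μ n * (kin c (V n)).toReal) ∧
      0 ≤ A - μ n * (kin c (V n)).toReal := by
    intro n
    have h1 := hE n
    rw [← ENNReal.ofReal_toReal (hkinfin n), ← ENNReal.ofReal_mul (hμpos n).le,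
      ← ENNReal.ofReal_toReal (hpotfin n), ← ENNReal.ofReal_add
        (mul_nonneg (hμpos n).le ENNReal.toReal_nonneg) ENNReal.toReal_nonneg,
      ENNReal.ofReal_lt_ofReal_iff hApos] at h1
    constructor
    · rw [← ENNReal.ofReal_toReal (hpotfin n)]
      exact ENNReal.ofReal_le_ofReal (by linarith)
    · linarith [ENNReal.toReal_nonneg (a := S.potE c 0 (V n))]
  have hAlim : Tendsto (fun n => A - μ (φ (ψ n)) * (kin c (V (φ (ψ n)))).toReal) atTop
      (𝓝 (A - k)) := by
    have h1 := (hμlim.comp (hφ.comp hψ).tendsto_atTop).mul (hk.comp hψ.tendsto_atTop)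
    rw [one_mul] at h1
    exact tendsto_const_nhds.sub h1
  have hAk : 0 ≤ A - k := ge_of_tendsto' hAlim fun n => (hpotle _).2
  have hpotU : S.potE c 0 U ≤ ENNReal.ofReal (A - k) := by
    refine (h.potE_le_liminf (fun n => (hV (φ (ψ n))).continuous) hlim).trans ?_
    refine (liminf_le_liminf (Eventually.of_forall fun n => (hpotle (φ (ψ n))).1)).trans ?_
    exact ((ENNReal.continuous_ofReal.tendsto _).comp hAlim).liminf_eq.le
  have hk0 : 0 ≤ k := ge_of_tendsto' hk fun n => ENNReal.toReal_nonneg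
  refine ⟨U, mem_X_iff.2 ⟨hU, ?_, 0, fun t ht => ?_⟩, ?_⟩
  -- The exponential bound on the distance to `F⁺` is the same for all curves, so a single time `T`
  -- serves for the limit.
  · have hdecay : Tendsto (fun t => √(2 * (4 * A) * (Real.exp (-c * t) / c))) atTop (𝓝 0) := by
      have h1 : Tendsto (fun t => -c * t) atTop atBot :=
        tendsto_id.const_mul_atTop_of_neg (neg_lt_zero.2 hc)
      have h2 := ((Real.tendsto_exp_atBot.comp h1).div_const c).const_mul (2 * (4 * A))
      have h3 := (Real.continuous_sqrt.tendsto _).comp h2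
      simpa [Function.comp_def] using h3
    have hr := h.plus_hyp.r₀_pos
    obtain ⟨T, hT⟩ := (hdecay.eventually_le_const (half_pos hr)).exists_forall_of_atTop
    refine ⟨T, fun t ht => ?_⟩
    obtain ⟨M, hM⟩ := hbound t
    refine infDist_le_of_tendsto_inner hs h.plus_hyp (fun f hf => (h.pot_plus f hf).1) hcomp.2
      (by linarith) (fun n => hM (φ (ψ n))) (fun n => ?_) (hlim t)
    exact (h.infDist_plus_sq_le hc (hV _) (by positivity) (hkinle _) (hpotfin _) (hplus _) t).trans
      (hT t ht)
  · obtain ⟨M, hM⟩ := hbound t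
    have hr := h.minus_hyp.r₀_pos
    exact infDist_le_of_tendsto_inner hs h.minus_hyp h.pot_minus hcomp.1
      (by linarith) (fun n => hM (φ (ψ n))) (fun n => hminus _ t ht) (hlim t)
  · refine (h.energy_le hc 0 hU.continuous).trans ?_
    rw [ereal_sub_nonpos_iff ENNReal.ofReal_ne_top, mul_zero, Real.exp_zero, mul_one, ← hA]
    refine (add_le_add hkU hpotU).trans ?_
    rw [← ENNReal.ofReal_add hk0 hAk]
    exact ENNReal.ofReal_le_ofReal (by linarith)

theorem speed_bound_lt (ha : S.a < 0) (hb : S.ConvergenceBound)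
    (hγ : 0 < S.gammaMinus) : √(-2 * S.a) / S.d₀ < S.gammaMinus := by
  have hpos := d₀_pos ha hb
  rw [div_lt_iff₀ hpos, Real.sqrt_lt' (by positivity)]
  unfold ConvergenceBound at hb
  linarith

theorem Unbalanced.gammaMinus_pos (h : S.Unbalanced) : 0 < S.gammaMinus := by
  have hC := h.minus_hyp.one_lt_C
  unfold gammaMinus
  positivity

/-- There is a speed for which the minimum of the energy in `X` is attained and equal to zero. -/
theorem Unbalanced.exists_minimizer (h : S.Unbalanced) (hs : S.SmallerSpace) (hl : S.LevelSets)
    (hp : S.ProjH) (hb : S.ConvergenceBound) (hcomp : S.Compactness)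
    (hinv : S.InverseProjAt S.plus) :
    ∃ c, 0 < c ∧ (∃ U ∈ S.X, S.energy c U = 0) ∧ ∀ V ∈ S.X, 0 ≤ S.energy c V := by
  obtain ⟨R, hR⟩ := h.exists_anchored hinv
  let B : Set ℝ := {c | 0 < c ∧ ∃ U ∈ S.X, S.energy c U < 0}
  have hBne : B.Nonempty := h.exists_speed hs
  have hBle : ∀ c ∈ B, c ≤ √(-2 * S.a) / S.d₀ := by
    rintro c ⟨hc, U, hU, hE⟩
    exact h.speed_le hs hl hb hc hU.1 hE (nearPlus_of_mem_X hU)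
  have hBb : BddAbove B := ⟨_, hBle⟩
  have hγ : ∀ c ∈ B, c < S.gammaMinus := fun c hc =>
    (hBle c hc).trans_lt (speed_bound_lt h.a_neg hb h.gammaMinus_pos)
  set c₀ := sSup B
  have hc₀ : 0 < c₀ := by
    obtain ⟨c, hc⟩ := hBne
    exact hc.1.trans_le (le_csSup hBb hc)
  have hmin : ∀ V ∈ S.X, 0 ≤ S.energy c₀ V := by
    intro V hV
    by_contra hcon
    obtain ⟨c', hc', W, hW, hWE⟩ := h.exists_gt_neg hc₀ hV (not_le.1 hcon)
    exact absurd (le_csSup hBb ⟨hc₀.trans hc', W, hW, hWE⟩) (not_le.2 hc')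
  -- The shift by 2 keeps the ratios `c n / c₀` above `1 / 2`, whence the bound `1 / 4` on their
  -- squares required by `exists_limit`.
  have hseq : ∀ n : ℕ, ∃ c ∈ B, c₀ * (1 - 1 / ((n : ℝ) + 2)) < c := fun n => by
    refine exists_lt_of_lt_csSup hBne ?_
    have : 0 < 1 / ((n : ℝ) + 2) := by positivity
    change c₀ * (1 - 1 / ((n : ℝ) + 2)) < c₀
    nlinarith
  choose c hcB hcl using hseq
  have hcle : ∀ n, c n ≤ c₀ := fun n => le_csSup hBb (hcB n)
  choose W hWX hWE using fun n => (hcB n).2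
  choose V hV hVp hVm hVR hVE using fun n =>
    h.exists_normalized hs hl hp hb hR (hcB n).1 hc₀ (hγ _ (hcB n)) (hWX n) (hWE n)
  have hratio : ∀ n : ℕ, 1 - 1 / ((n : ℝ) + 2) ≤ c n / c₀ := fun n => by
    rw [le_div_iff₀ hc₀]; linarith [hcl n]
  have hratio' : ∀ n, c n / c₀ ≤ 1 := fun n => (div_le_one hc₀).2 (hcle n)
  have hlim : Tendsto (fun n => c n / c₀) atTop (𝓝 1) := by
    have h1 : Tendsto (fun n : ℕ => 1 - 1 / ((n : ℝ) + 2)) atTop (𝓝 (1 - 0)) := by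
      refine tendsto_const_nhds.sub ?_
      exact tendsto_const_nhds.div_atTop
        (tendsto_atTop_add_const_right _ _ tendsto_natCast_atTop_atTop)
    rw [sub_zero] at h1
    exact tendsto_of_tendsto_of_tendsto_of_le_of_le h1 tendsto_const_nhds hratio hratio'
  have hhalf : ∀ n, 1 / 4 ≤ (c n / c₀) ^ 2 := fun n => by
    have h1 : 1 / ((n : ℝ) + 2) ≤ 1 / 2 := by
      apply one_div_le_one_div_of_le (by norm_num)
      linarith [(Nat.cast_nonneg n : (0:ℝ) ≤ n)]
    have h2 : 1 / 2 ≤ c n / c₀ := by linarith [hratio n]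
    nlinarith
  have hlim2 : Tendsto (fun n => (c n / c₀) ^ 2) atTop (𝓝 1) := by
    simpa using hlim.pow 2
  obtain ⟨U, hU, hUE⟩ := h.exists_limit hs hcomp hc₀ hhalf hlim2 hV hVp hVm hVR hVE
  exact ⟨c₀, hc₀, ⟨U, hU, le_antisymm hUE (hmin U hU)⟩, hmin⟩

/-! ### Minimizers are fixed by the truncation -/

theorem Regularity.infDist_trunc_le (hreg : S.Regularity) {F : Set L} (hne : F.Nonempty)
    (hF : ∀ f ∈ F, S.trunc f = f) (v : L) :
    Metric.infDist (S.trunc v) F ≤ Metric.infDist v F := by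
  refine (Metric.le_infDist hne).2 fun {f} hf => (Metric.infDist_le_dist_of_mem hf).trans ?_
  rw [dist_eq_norm, dist_eq_norm]
  nth_rewrite 1 [← hF f hf]
  exact hreg.trunc_lipschitz v f

theorem Regularity.trunc_mem_X (h : S.Unbalanced) (hreg : S.Regularity) {U : ℝ → L} (hU : U ∈ S.X) :
    (fun t => S.trunc (U t)) ∈ S.X := by
  obtain ⟨h1, T, hT, h2, h3⟩ := hU
  refine ⟨h1.of_norm_sub_le fun s t => hreg.trunc_lipschitz _ _, T, hT, fun t ht => ?_, fun t ht => ?_⟩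
  · exact (hreg.infDist_trunc_le h.plus_hyp.nonempty hreg.trunc_plus _).trans (h2 t ht)
  · exact (hreg.infDist_trunc_le h.minus_hyp.nonempty hreg.trunc_minus _).trans (h3 t ht)

theorem eq_of_toENNReal_sub_eq {x y : EReal} {a : ℝ} (hx : (a : EReal) ≤ x) (hy : (a : EReal) ≤ y)
    (hxy : (x - (a : EReal)).toENNReal = (y - (a : EReal)).toENNReal)
    (hfin : (y - (a : EReal)).toENNReal ≠ ⊤) : x = y ∧ y < ⊤ := by
  rcases EReal.cases_of_coe_le hy with rfl | ⟨e, rfl, he⟩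
  · simp at hfin
  rcases EReal.cases_of_coe_le hx with rfl | ⟨f, rfl, hf⟩
  · rw [← hxy, EReal.top_sub_coe] at hfin
    simp at hfin
  rw [← EReal.coe_sub, ← EReal.coe_sub, toENNReal_coe_real, toENNReal_coe_real,
    ENNReal.ofReal_eq_ofReal_iff (by linarith) (by linarith)] at hxy
  exact ⟨by rw [EReal.coe_eq_coe_iff]; linarith, EReal.coe_lt_top _⟩

/-- Curves of minimal energy are fixed by the truncation. -/
theorem Unbalanced.trunc_fixed (h : S.Unbalanced) (hreg : S.Regularity) {c : ℝ} (hc : 0 < c)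
    {U : ℝ → L} (hU : U ∈ S.X) (hE : S.energy c U = 0) (hmin : ∀ V ∈ S.X, 0 ≤ S.energy c V) (t : ℝ) :
    S.trunc (U t) = U t := by
  set W : ℝ → L := fun t => S.trunc (U t) with hWdef
  have hW : W ∈ S.X := hreg.trunc_mem_X h hU
  have hlip : ∀ s t, ‖W t - W s‖ ≤ ‖U t - U s‖ := fun s t => hreg.trunc_lipschitz _ _
  have hWd := hU.1.ae_norm_deriv_le hlip
  have hWE : S.energy c W = 0 :=
    le_antisymm ((energy_mono hWd fun t => hreg.trunc_le _).trans hE.le) (hmin W hW)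
  obtain ⟨T₁, hT₁⟩ := h.nonneg_of_nearPlus (nearPlus_of_mem_X hU)
  obtain ⟨T₂, hT₂⟩ := h.nonneg_of_nearPlus (nearPlus_of_mem_X hW)
  set T := max T₁ T₂
  have hTU : ∀ t, T < t → 0 ≤ S.pot (U t) := fun t ht => hT₁ t ((le_max_left _ _).trans_lt ht)
  have hTW : ∀ t, T < t → 0 ≤ S.pot (W t) := fun t ht => hT₂ t ((le_max_right _ _).trans_lt ht)
  have e1 := hE.le
  have e2 := hWE.ge
  rw [h.energy_eq hc hU.1.continuous hTU, ereal_sub_nonpos_iff ENNReal.ofReal_ne_top] at e1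
  rw [h.energy_eq hc hW.1.continuous hTW, ← not_lt, ereal_sub_neg_iff ENNReal.ofReal_ne_top,
    not_lt] at e2
  have hfin := ENNReal.add_ne_top.1 (ne_top_of_le_ne_top ENNReal.ofReal_ne_top e1)
  have hkle : kin c W ≤ kin c U := by
    refine lintegral_mono_ae (hWd.mono fun t ht => ?_)
    unfold kdens
    gcongr
  have hple : ∀ t, S.pdens c T W t ≤ S.pdens c T U t := fun t => by
    unfold pdens
    gcongr
    split_ifs
    · exact toENNReal_sub_mono _ (hreg.trunc_le _)
    · exact EReal.toENNReal_le_toENNReal (hreg.trunc_le _)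
  -- Both curves have energy zero and truncation increases neither part, so the potential parts
  -- coincide; finiteness allows the kinetic part to be cancelled.
  have hpge : S.potE c T U ≤ S.potE c T W := by
    have h1 : kin c U + S.potE c T U ≤ kin c U + S.potE c T W :=
      (e1.trans e2).trans (add_le_add hkle le_rfl)
    exact (ENNReal.add_le_add_iff_left hfin.1).1 h1
  have hmW := h.measurable_pdens c T hW.1.continuous
  have hmU := h.measurable_pdens c T hU.1.continuous
  have hae := ae_eq_of_ae_le_of_lintegral_le (Eventually.of_forall hple)
    (ne_top_of_le_ne_top hfin.2 (lintegral_mono hple)) hmU.aemeasurable hpge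
  have hlt := ae_lt_top hmU hfin.2
  have hfix : W =ᵐ[volume] U := by
    filter_upwards [hae, hlt] with t ht htl
    have hw0 : ENNReal.ofReal (Real.exp (c * t)) ≠ 0 := by
      simp only [ne_eq, ENNReal.ofReal_eq_zero, not_le]; exact Real.exp_pos _
    have key : S.pot (W t) = S.pot (U t) ∧ S.pot (U t) < ⊤ := by
      unfold pdens at ht htl
      rw [ENNReal.mul_right_inj hw0 ENNReal.ofReal_ne_top] at ht
      have htl' := fun hh => htl.ne (ENNReal.mul_eq_top.2 (Or.inl ⟨hw0, hh⟩))
      by_cases hle : t ≤ T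
      · simp only [if_pos hle] at ht htl'
        exact eq_of_toENNReal_sub_eq (h.a_le _) (h.a_le _) ht htl'
      · simp only [if_neg hle] at ht htl'
        have := eq_of_toENNReal_sub_eq (x := S.pot (W t)) (y := S.pot (U t)) (a := 0)
          (hTW t (not_le.1 hle)) (hTU t (not_le.1 hle))
        simp only [EReal.coe_zero, sub_zero] at this
        exact this ht htl'
    exact (hreg.trunc_eq_iff _ key.2).1 key.1
  exact congrFun ((hW.1.continuous.ae_eq_iff_eq volume hU.1.continuous).1 hfix) t

/-! ### Local minimality and regularity -/

/-- The inclusion of the smaller space, as a continuous linear map. -/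
noncomputable def SmallerSpace.inclL (hs : S.SmallerSpace) : H →L[ℝ] L :=
  S.incl.mkContinuous 1 fun x => by simpa using hs.incl_norm_le x

theorem ereal_ne_top_of_sub_eq_zero {P N : ENNReal} (h : (P : EReal) - (N : EReal) = 0) :
    P ≠ ⊤ ∧ N ≠ ⊤ ∧ P = N := by
  have hN : N ≠ ⊤ := by
    rintro rfl
    simp at h
  have h1 := (ereal_sub_nonpos_iff hN).1 h.le
  have h2 := not_lt.1 fun hlt => absurd h ((ereal_sub_neg_iff (D := P) hN).2 hlt).ne
  exact ⟨ne_top_of_le_ne_top hN h1, hN, le_antisymm h1 h2⟩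

/-- A perturbation supported in `(α, β)` stays in `X` and leaves the density outside unchanged.
Global minimality thus descends to the interval by cancelling the outer contributions, which are
finite because the energy is zero. -/
theorem isLocalMinimizer (hs : S.SmallerSpace) {c : ℝ}
    {U : ℝ → L} (hU : U ∈ S.X) (hE : S.energy c U = 0) (hmin : ∀ V ∈ S.X, 0 ≤ S.energy c V)
    (α β : ℝ) : S.IsLocalMinimizer c α β U := by
  set I := Ioo α β
  have hI : MeasurableSet I := measurableSet_Ioo
  have hsplit : ∀ f : ℝ → ENNReal, ∫⁻ t in univ, f t = (∫⁻ t in I, f t) + ∫⁻ t in Iᶜ, f t := fun f => by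
    rw [lintegral_add_compl f hI, Measure.restrict_univ]
  have hE0 := hE
  unfold energy energyOn at hE0
  obtain ⟨hP, hN, hPN⟩ := ereal_ne_top_of_sub_eq_zero hE0
  rw [hsplit] at hP hN
  rw [hsplit, hsplit] at hPN
  rw [ENNReal.add_ne_top] at hP hN
  refine ⟨hU.1.mono _, ?_, ?_, 1, one_pos, fun φ hφ hφc hφI _ => ?_⟩
  · unfold energyOn
    have := ereal_sub_le_of_add_le (P := 0) (A := ∫⁻ t in I, (-S.density c U t).toENNReal)
      (D := ∫⁻ t in I, (S.density c U t).toENNReal)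
      (n := ∫⁻ t in I, (-S.density c U t).toENNReal) hN.1 (by rw [zero_add]; exact le_add_self)
    refine ne_bot_of_le_ne_bot ?_ this
    lift (∫⁻ t in I, (-S.density c U t).toENNReal) to NNReal using hN.1 with n
    simp only [EReal.coe_ennreal_zero, zero_sub]
    exact EReal.coe_ne_bot (-(n : ℝ))
  · unfold energyOn
    have := ereal_sub_le_of_add_le (P := ∫⁻ t in I, (S.density c U t).toENNReal)
      (A := 0) (D := ∫⁻ t in I, (S.density c U t).toENNReal)
      (n := ∫⁻ t in I, (-S.density c U t).toENNReal) ENNReal.zero_ne_top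
      (by rw [add_zero]; exact le_self_add)
    refine ne_top_of_le_ne_top ?_ this
    simp only [EReal.coe_ennreal_zero, sub_zero]
    simpa using hP.1
  · set V : ℝ → L := fun t => U t + S.incl (φ t) with hVdef
    have hV1 : MemH1loc V univ := by
      refine hU.1.add ?_
      have : ContDiff ℝ 1 fun t => hs.inclL (φ t) := hs.inclL.contDiff.comp hφ
      exact this.memH1loc
    have hVU : ∀ t, t ∉ tsupport φ → V t = U t := fun t ht => by
      simp only [hVdef]; rw [image_eq_zero_of_notMem_tsupport ht, map_zero, add_zero]
    have hVX : V ∈ S.X := by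
      obtain ⟨-, ⟨T, hT⟩, T', hT'⟩ := mem_X_iff.1 hU
      refine mem_X_iff.2 ⟨hV1, ⟨max T β, fun t ht => ?_⟩, min T' α, fun t ht => ?_⟩
      · rw [hVU t fun hh => absurd (hφI hh).2 (not_lt.2 ((le_max_right _ _).trans ht))]
        exact hT t ((le_max_left _ _).trans ht)
      · rw [hVU t fun hh => absurd (hφI hh).1 (not_lt.2 (ht.trans (min_le_right _ _)))]
        exact hT' t (ht.trans (min_le_left _ _))
    have hdens : ∀ t ∈ Iᶜ, S.density c V t = S.density c U t := by
      intro t ht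
      have htt : t ∉ tsupport φ := fun hh => ht (hφI hh)
      have hev : V =ᶠ[𝓝 t] U := by
        filter_upwards [(isClosed_tsupport φ).isOpen_compl.mem_nhds htt] with s hs using hVU s hs
      rw [density, density, hev.deriv_eq, hVU t htt]
    have hPc : ∫⁻ t in Iᶜ, (S.density c V t).toENNReal = ∫⁻ t in Iᶜ, (S.density c U t).toENNReal :=
      setLIntegral_congr_fun hI.compl fun t ht => by simp only [hdens t ht]
    have hNc : ∫⁻ t in Iᶜ, (-S.density c V t).toENNReal = ∫⁻ t in Iᶜ, (-S.density c U t).toENNReal :=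
      setLIntegral_congr_fun hI.compl fun t ht => by simp only [hdens t ht]
    have hVE := hmin V hVX
    unfold energy energyOn at hVE
    -- An infinite negative part would give the energy the value `⊥`, against its nonnegativity on
    -- `X`.
    have hNV : ∫⁻ t in univ, (-S.density c V t).toENNReal ≠ ⊤ := fun hh => by
      rw [hh] at hVE
      simp at hVE
    have hle := not_lt.1 fun hlt => absurd hVE (not_le.2 ((ereal_sub_neg_iff hNV).2 hlt))
    rw [hsplit] at hNV
    rw [hsplit, hsplit, hPc, hNc] at hle
    rw [ENNReal.add_ne_top] at hNV
    refine ereal_sub_le_of_add_le hNV.1 ?_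
    have hfin := ENNReal.add_ne_top.2 ⟨hP.2, hN.2⟩
    refine (ENNReal.add_le_add_iff_right hfin).1 ?_
    calc _ = ((∫⁻ t in I, (S.density c U t).toENNReal) + ∫⁻ t in Iᶜ, (S.density c U t).toENNReal) +
          ((∫⁻ t in I, (-S.density c V t).toENNReal) +
            ∫⁻ t in Iᶜ, (-S.density c U t).toENNReal) := by ring
      _ ≤ ((∫⁻ t in I, (-S.density c U t).toENNReal) + ∫⁻ t in Iᶜ, (-S.density c U t).toENNReal) +
          ((∫⁻ t in I, (S.density c V t).toENNReal) +
            ∫⁻ t in Iᶜ, (S.density c U t).toENNReal) := add_le_add hPN.le hle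
      _ = _ := by ring

/-- Injectivity of the inclusions forces the lifts given on different intervals to agree on
overlaps, so they patch together. -/
theorem SmallerSpace.memA_univ (hs : S.SmallerSpace) {U : ℝ → L}
    (hA : ∀ n : ℕ, S.MemA (Ioo (-((n : ℝ) + 1)) ((n : ℝ) + 1)) U) : S.MemA univ U := by
  have hcov : ∀ t : ℝ, ∃ n : ℕ, t ∈ Ioo (-((n : ℝ) + 1)) ((n : ℝ) + 1) := fun t => by
    obtain ⟨n, hn⟩ := exists_nat_gt |t|
    exact ⟨n, abs_lt.1 (by linarith)⟩
  choose N hN using hcov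
  choose h2 UH Ut hUH hUHc hUt hUtc using hA
  have hnhds : ∀ t, Ioo (-((N t : ℝ) + 1)) ((N t : ℝ) + 1) ∈ 𝓝 t := fun t =>
    Ioo_mem_nhds (hN t).1 (hN t).2
  have hUHeq : ∀ n : ℕ, ∀ t ∈ Ioo (-((n : ℝ) + 1)) ((n : ℝ) + 1), UH (N t) t = UH n t := fun n t ht =>
    hs.incl_injective ((hUH _ t (hN t)).trans (hUH n t ht).symm)
  have hUteq : ∀ n : ℕ, ∀ t ∈ Ioo (-((n : ℝ) + 1)) ((n : ℝ) + 1), Ut (N t) t = Ut n t := fun n t ht =>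
    hs.inclt_injective (by rw [hUt _ t (hN t), hUt n t ht, hUHeq n t ht])
  refine ⟨fun t _ => ((h2 (N t)).contDiffAt (hnhds t)).contDiffWithinAt, fun t => UH (N t) t,
    fun t => Ut (N t) t, fun t _ => hUH _ t (hN t), fun t _ => ?_, fun t _ => hUt _ t (hN t),
    fun t _ => ?_⟩
  · refine (((hUHc (N t)).contDiffAt (hnhds t)).congr_of_eventuallyEq ?_).contDiffWithinAt
    filter_upwards [hnhds t] with s hs using hUHeq _ s hs
  · refine (((hUtc (N t)).continuousAt (hnhds t)).congr ?_).continuousWithinAt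
    filter_upwards [hnhds t] with s hs using (hUteq _ s hs).symm

theorem Unbalanced.minimizer_regular (h : S.Unbalanced) (hs : S.SmallerSpace) (hreg : S.Regularity)
    {c : ℝ} (hc : 0 < c) {U : ℝ → L} (hU : U ∈ S.X) (hE : S.energy c U = 0)
    (hmin : ∀ V ∈ S.X, 0 ≤ S.energy c V) : S.MemA univ U ∧ S.Solves c U univ := by
  have hloc : ∀ n : ℕ, S.MemA (Ioo (-((n : ℝ) + 1)) ((n : ℝ) + 1)) U ∧
      S.Solves c U (Ioo (-((n : ℝ) + 1)) ((n : ℝ) + 1)) := fun n =>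
    hreg.regular c _ _ hc (by linarith [(Nat.cast_nonneg n : (0 : ℝ) ≤ n)]) U
      (isLocalMinimizer hs hU hE hmin _ _)
      fun t _ => h.trunc_fixed hreg hc hU hE hmin t
  refine ⟨hs.memA_univ fun n => (hloc n).1, fun t _ => ?_⟩
  obtain ⟨n, hn⟩ := exists_nat_gt |t|
  exact (hloc n).2 t (abs_lt.1 (by linarith))

end Setting

/-! ### The Hamiltonian along a wave -/

/-- A differential inequality for the Hamiltonian `e - v / 2` of a wave of speed `c`, where `e` is the
potential along the wave and `v` is the square of its velocity. -/
theorem hamiltonian_integral {c a K : ℝ} (hc : 0 < c) (hKc : K * c ≤ 0.63) {e v : ℝ → ℝ}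
    (hvc : Continuous v) (hv0 : ∀ t, 0 ≤ v t) (hne : ∃ t, v t ≠ 0)
    (hq : ∀ t, HasDerivAt (fun t => e t - v t / 2) (c * v t) t) (hea : ∀ t, a ≤ e t)
    (hiv : Integrable fun t => Real.exp (c * t) * v t)
    (hie : Integrable fun t => Real.exp (c * t) * e t)
    (hrep : ∃ T, ∀ t ≤ T, e t ≤ 0 →
      ∫ s in Iic t, Real.exp (c * s) * (v s / 2 + (e s - a)) ≤ K * (e t - a) * Real.exp (c * t)) :
    Integrable v ∧ ∫ t, v t = -a / c := by
  set q : ℝ → ℝ := fun t => e t - v t / 2 with hqdef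
  have hexp : ∀ t, HasDerivAt (fun t => Real.exp (c * t)) (c * Real.exp (c * t)) t := fun t => by
    simpa [mul_comm] using ((hasDerivAt_id t).const_mul c).exp
  have hmono : Monotone q := monotone_of_hasDerivAt_nonneg hq fun t => mul_nonneg hc.le (hv0 t)
  -- Multiplied by the weight, the Hamiltonian relative to a level `b` is, up to the factor `c`, a
  -- primitive of the energy density relative to `b`. The level `a` is used at `-∞` and the level
  -- `0` at `+∞`.
  have hshift : ∀ b t, HasDerivAt (fun t => Real.exp (c * t) * (q t - b))
      (c * (Real.exp (c * t) * (v t / 2 + (e t - b)))) t := fun b t =>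
    ((hexp t).mul ((hq t).sub_const b)).congr_deriv (by simp only [hqdef]; ring)
  have hint0 : Integrable fun t => Real.exp (c * t) * (v t / 2 + e t) :=
    ((hiv.div_const 2).add hie).congr (Eventually.of_forall fun t => by
      simp only [Pi.add_apply]; ring)
  have hintq : Integrable fun t => Real.exp (c * t) * q t :=
    (hie.sub (hiv.div_const 2)).congr (Eventually.of_forall fun t => by
      simp only [hqdef, Pi.sub_apply]; ring)
  have hinta : ∀ t, IntegrableOn (fun s => Real.exp (c * s) * (v s / 2 + (e s - a))) (Iic t) :=
    fun t => (hint0.integrableOn.sub ((integrableOn_exp_mul_Iic hc t).mul_const a)).congr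
      (Eventually.of_forall fun s => by simp only [Pi.sub_apply]; ring)
  have hintqa : ∀ t, IntegrableOn (fun s => Real.exp (c * s) * (q s - a)) (Iic t) :=
    fun t => (hintq.integrableOn.sub ((integrableOn_exp_mul_Iic hc t).mul_const a)).congr
      (Eventually.of_forall fun s => by simp only [Pi.sub_apply]; ring)
  have hGlim : Tendsto (fun t => Real.exp (c * t) * (q t - a)) atBot (𝓝 0) :=
    tendsto_zero_of_hasDerivAt_of_integrableOn_Iic (a := 0) (fun t _ => hshift a t)
      ((hinta 0).const_mul c) (hintqa 0)
  have hFlim : Tendsto (fun t => Real.exp (c * t) * (q t - 0)) atTop (𝓝 0) :=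
    tendsto_zero_of_hasDerivAt_of_integrableOn_Ioi (a := 0) (fun t _ => hshift 0 t)
      ((hint0.integrableOn.const_mul c).congr (Eventually.of_forall fun s => by simp))
      (hintq.integrableOn.congr (Eventually.of_forall fun s => by simp))
  have hGmono : Monotone fun t => Real.exp (c * t) * (q t - a) :=
    monotone_of_hasDerivAt_nonneg (hshift a) fun t =>
      mul_nonneg hc.le (mul_nonneg (Real.exp_pos _).le (by linarith [hv0 t, hea t]))
  have hqa : ∀ t, a ≤ q t := fun t => by
    have := hGmono.le_of_tendsto hGlim t
    linarith [nonneg_of_mul_nonneg_right this (Real.exp_pos _)]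
  have hexptop : Tendsto (fun t => Real.exp (c * t)) atTop atTop :=
    Real.tendsto_exp_atTop.comp (tendsto_id.const_mul_atTop hc)
  have hqtop : Tendsto q atTop (𝓝 0) := by
    have := hFlim.mul hexptop.inv_tendsto_atTop
    rw [zero_mul] at this
    refine this.congr fun t => ?_
    simp only [sub_zero, Pi.inv_apply]
    field_simp
  have hq0 : ∀ t, q t ≤ 0 := fun t => hmono.ge_of_tendsto hqtop t
  obtain ⟨q₀, hbot⟩ : ∃ q₀, Tendsto q atBot (𝓝 q₀) :=
    ⟨_, tendsto_atBot_ciInf hmono ⟨a, by rintro _ ⟨t, rfl⟩; exact hqa t⟩⟩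
  have hq₀le : ∀ t, q₀ ≤ q t := fun t => hmono.le_of_tendsto hbot t
  have hq₀a : a ≤ q₀ := ge_of_tendsto' hbot hqa
  have hq₀neg : q₀ < 0 := by
    by_contra hcon
    obtain ⟨t, ht⟩ := hne
    have hz : q = fun _ => 0 := funext fun s => le_antisymm (hq0 s) ((not_lt.1 hcon).trans (hq₀le s))
    have h1 := hq t
    rw [hz] at h1
    have := h1.unique (hasDerivAt_const t (0 : ℝ))
    exact ht ((mul_eq_zero.1 this).resolve_left hc.ne')
  have hq₀eq : q₀ = a := by
    refine le_antisymm (le_of_forall_pos_le_add fun ε hε => ?_) hq₀a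
    obtain ⟨T, hT⟩ := hrep
    set δ := min ε (-q₀ / 2) with hδ
    have hδpos : 0 < δ := lt_min hε (by linarith)
    have hev : ∀ᶠ t in atBot, q t < q₀ + min (c * δ) (-q₀ / 2) :=
      hbot.eventually_lt_const (by
        have := lt_min (mul_pos hc hδpos) (show 0 < -q₀ / 2 by linarith)
        linarith)
    obtain ⟨t, ht, htT⟩ := (hev.and (eventually_le_atBot T)).exists
    -- The mean value theorem yields a time where `v < δ`; there `e ≤ 0` because `q` is close to its
    -- negative limit. The replacement bound then reads `q - a ≤ 0.63 (e - a)` with `e = q + v / 2`,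
    -- so `q - a` is at most `v`.
    obtain ⟨ξ, hξ, hslope⟩ := exists_hasDerivAt_eq_slope q (fun t => c * v t)
      (show t - 1 < t by linarith) (fun s _ => (hq s).continuousAt.continuousWithinAt)
      fun s _ => hq s
    rw [sub_sub_cancel, div_one] at hslope
    have h1 := hq₀le (t - 1)
    have h2 := min_le_left (c * δ) (-q₀ / 2)
    have h3 := min_le_right (c * δ) (-q₀ / 2)
    have hvδ : v ξ < δ := by
      have : c * v ξ < c * δ := by linarith
      exact lt_of_mul_lt_mul_left this hc.le
    have h4 := min_le_left ε (-q₀ / 2)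
    have h5 := min_le_right ε (-q₀ / 2)
    have h6 := hmono hξ.2.le
    have hqe : q ξ = e ξ - v ξ / 2 := rfl
    have heξ : e ξ ≤ 0 := by linarith
    have h7 := hT ξ (hξ.2.le.trans htT) heξ
    have h8 := integral_Iic_of_hasDerivAt_of_tendsto' (a := ξ) (fun t _ => hshift a t)
      ((hinta ξ).const_mul c) hGlim
    rw [integral_const_mul, sub_zero] at h8
    have h9 : q ξ - a ≤ 0.63 * (e ξ - a) := by
      have hE := Real.exp_pos (c * ξ)
      have h10 : Real.exp (c * ξ) * (q ξ - a) ≤ Real.exp (c * ξ) * (K * c * (e ξ - a)) := by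
        rw [← h8]
        calc _ ≤ c * (K * (e ξ - a) * Real.exp (c * ξ)) := by gcongr
          _ = _ := by ring
      have h11 := le_of_mul_le_mul_left h10 hE
      have h12 : 0 ≤ e ξ - a := by linarith [hea ξ]
      nlinarith
    have := hq₀le ξ
    linarith [hv0 ξ]
  subst hq₀eq
  have hqv : ∀ t, HasDerivAt (fun t => q t / c) (v t) t := fun t =>
    ((hq t).div_const c).congr_deriv (by field_simp)
  have hv : Integrable v := by
    refine integrable_of_intervalIntegral_norm_bounded (a := fun n : ℕ => -(n : ℝ))
      (b := fun n : ℕ => (n : ℝ)) (l := atTop) (-q₀ / c)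
      (fun n => hvc.integrableOn_Ioc) (tendsto_neg_atTop_atBot.comp tendsto_natCast_atTop_atTop)
      tendsto_natCast_atTop_atTop (Eventually.of_forall fun n => ?_)
    simp only [Real.norm_eq_abs, abs_of_nonneg (hv0 _)]
    rw [intervalIntegral.integral_eq_sub_of_hasDerivAt (fun t _ => hqv t)
      (hvc.intervalIntegrable _ _), ← sub_div]
    gcongr
    linarith [hq0 n, hq₀le (-n)]
  refine ⟨hv, ?_⟩
  rw [integral_of_hasDerivAt_of_tendsto hqv hv (hbot.div_const c) (hqtop.div_const c)]
  ring

/-! ### The formula for the speed -/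

namespace Setting

variable {L H Ht : Type*} [NormedAddCommGroup L] [InnerProductSpace ℝ L] [CompleteSpace L]
  [NormedAddCommGroup H] [InnerProductSpace ℝ H]
  [NormedAddCommGroup Ht] [InnerProductSpace ℝ Ht]
  {S : Setting L H Ht}

/-- The curves agree after `t₀`, so their common tail can be cancelled, being finite. -/
theorem setLIntegral_le_of_kin_add_potE_le {c T : ℝ} {U V : ℝ → L} {t₀ : ℝ}
    (hUV : ∀ t, t₀ ≤ t → V t = U t) (hfin : kin c U + S.potE c T U ≠ ⊤)
    (hle : kin c U + S.potE c T U ≤ kin c V + S.potE c T V) :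
    ∫⁻ x in Iic t₀, (kdens c U x + S.pdens c T U x) ≤
      ∫⁻ x in Iic t₀, (kdens c V x + S.pdens c T V x) := by
  have heq : ∫⁻ x in Ioi t₀, (kdens c V x + S.pdens c T V x) =
      ∫⁻ x in Ioi t₀, (kdens c U x + S.pdens c T U x) := by
    refine setLIntegral_congr_fun measurableSet_Ioi fun x hx => ?_
    have hev : V =ᶠ[𝓝 x] U := by
      filter_upwards [Ioi_mem_nhds (show t₀ < x from hx)] with s hs using hUV s (le_of_lt hs)
    simp only [kdens_congr hev, pdens, hUV x (le_of_lt hx)]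
  rw [kin_add_potE, lintegral_split _ t₀] at hfin
  rw [kin_add_potE, kin_add_potE, lintegral_split _ t₀, lintegral_split (fun t => _ + _) t₀, heq]
    at hle
  exact (ENNReal.add_le_add_iff_right (ENNReal.add_ne_top.1 hfin).2).1 hle

/-- Before a time at which the potential is nonpositive, the energy of a minimizer relative to the
level `a` is controlled by the potential at that time. -/
theorem Unbalanced.initial_energy_le (h : S.Unbalanced) (hs : S.SmallerSpace) (hl : S.LevelSets)
    (hp : S.ProjH) {c : ℝ} (hc : 0 < c) {U : ℝ → L} (hU : U ∈ S.X) (hE : S.energy c U = 0)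
    (hmin : ∀ V ∈ S.X, 0 ≤ S.energy c V) {t T : ℝ} (htT : t ≤ T)
    (hT : ∀ s, T < s → 0 ≤ S.pot (U s)) (hpot : S.pot (U t) ≤ 0)
    (hd : Metric.infDist (U t) S.minus.F ≤ S.minus.r₀) :
    ∫⁻ s in Iic t, (kdens c U s + S.pdens c T U s) ≤
      ENNReal.ofReal (3 / 2 * S.minus.C ^ 3 * ((S.pot (U t)).toReal - S.a) * Real.exp (c * t)) := by
  obtain ⟨V, hV, hVU, hVd, hVc⟩ := h.exists_replacement hs hl hp hc hU.1 hpot hd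
  have hr := h.minus_hyp.r₀_pos
  have hη := S.etaMinus_le
  have hVX : V ∈ S.X := by
    obtain ⟨-, ⟨T', hT'⟩, -⟩ := mem_X_iff.1 hU
    refine mem_X_iff.2 ⟨hV, ⟨max T' t, fun s hs => ?_⟩, t, fun s hs => by linarith [hVd s hs]⟩
    rw [hVU s ((le_max_right _ _).trans hs)]
    exact hT' s ((le_max_left _ _).trans hs)
  have e1 := hE.le
  have e2 := hmin V hVX
  rw [h.energy_eq hc hU.1.continuous hT, ereal_sub_nonpos_iff ENNReal.ofReal_ne_top] at e1
  rw [h.energy_eq hc hV.continuous fun s hs => by rw [hVU s (htT.trans hs.le)]; exact hT s hs,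
    ← not_lt, ereal_sub_neg_iff ENNReal.ofReal_ne_top, not_lt] at e2
  exact (setLIntegral_le_of_kin_add_potE_le hVU (ne_top_of_le_ne_top ENNReal.ofReal_ne_top e1)
    (e1.trans e2)).trans (hVc T htT)

/-- Chain rule in `H`: the derivative is the gradient tested against the velocity, and the equation
expresses the gradient as `V'' + c V'`. -/
theorem SmallerSpace.hasDerivAt_potential (hs : S.SmallerSpace) {c : ℝ} {V : ℝ → L} {UH : ℝ → H}
    (hVd : Differentiable ℝ V) (hUH : ∀ t, S.incl (UH t) = V t) (hUHd : Differentiable ℝ UH)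
    (hsol : S.Solves c V univ) (t : ℝ) :
    HasDerivAt (fun t => S.potH (UH t)) (inner ℝ (deriv (deriv V) t + c • deriv V t) (deriv V t)) t := by
  obtain ⟨x, hx, heq⟩ := hsol t (mem_univ t)
  have hxU : S.inclt x = UH t := hs.incl_injective (hx.trans (hUH t).symm)
  have hd : S.incl (deriv UH t) = deriv V t := by
    have h1 : HasDerivAt (fun t => hs.inclL (UH t)) (hs.inclL (deriv UH t)) t :=
      hs.inclL.hasFDerivAt.comp_hasDerivAt t (hUHd t).hasDerivAt
    have h2 : (fun t => hs.inclL (UH t)) = V := funext hUH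
    rw [h2] at h1
    exact h1.unique (hVd t).hasDerivAt
  have hgrad : deriv (deriv V) t + c • deriv V t = S.grad x := by
    rw [sub_eq_iff_eq_add] at heq
    rw [heq]; abel
  rw [hgrad, ← hd, hs.grad_spec, hxU]
  exact ((hs.pot_C1.differentiable one_ne_zero) (UH t)).hasFDerivAt.comp_hasDerivAt t
    (hUHd t).hasDerivAt

/-- Reduction to `hamiltonian_integral`: finite energy supplies the weighted integrability, and
`initial_energy_le` the bound near `-∞` with `K = 3/2 C³`. -/
theorem Unbalanced.speed_eq (h : S.Unbalanced) (hs : S.SmallerSpace) (hl : S.LevelSets)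
    (hp : S.ProjH) (hb : S.ConvergenceBound) {c : ℝ} (hc : 0 < c) (hcγ : c < S.gammaMinus)
    {V : ℝ → L} (hA : S.MemA univ V) (hV : V ∈ S.X) (hE : S.energy c V = 0)
    (hmin : ∀ W ∈ S.X, 0 ≤ S.energy c W) (hsol : S.Solves c V univ) :
    Integrable (fun t => ‖deriv V t‖ ^ 2) ∧ c = -S.a / ∫ t, ‖deriv V t‖ ^ 2 := by
  obtain ⟨h2, UH, -, hUH, hUHc, -⟩ := hA
  rw [contDiffOn_univ] at h2 hUHc
  replace hUH : ∀ t, S.incl (UH t) = V t := fun t => hUH t (mem_univ t)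
  have hVd : Differentiable ℝ V := h2.differentiable two_ne_zero
  have h1 : ContDiff ℝ 1 (deriv V) := by
    have : ContDiff ℝ (1 + 1) V := by simpa [one_add_one_eq_two] using h2
    exact (contDiff_succ_iff_deriv.1 this).2.2
  set e : ℝ → ℝ := fun t => S.potH (UH t) with hedef
  set v : ℝ → ℝ := fun t => ‖deriv V t‖ ^ 2 with hvdef
  have hpe : ∀ t, S.pot (V t) = (e t : EReal) := fun t => by rw [← hUH t, ← h.coe_potH hs]
  have hec : Continuous e := hs.pot_C1.continuous.comp hUHc.continuous
  have hvc : Continuous v := h1.continuous.norm.pow 2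
  have hv0 : ∀ t, 0 ≤ v t := fun t => sq_nonneg _
  have hea : ∀ t, S.a ≤ e t := fun t => EReal.coe_le_coe_iff.1 (hpe t ▸ h.a_le (V t))
  have hq : ∀ t, HasDerivAt (fun t => e t - v t / 2) (c * v t) t := fun t => by
    have hd1 := ((h1.differentiable one_ne_zero) t).hasDerivAt.norm_sq
    refine ((hs.hasDerivAt_potential hVd hUH (hUHc.differentiable one_ne_zero) hsol t).sub
      (hd1.div_const 2)).congr_deriv ?_
    rw [inner_add_left, real_inner_smul_left, real_inner_self_eq_norm_sq,
      real_inner_comm (deriv (deriv V) t)]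
    ring
  obtain ⟨T₀, hT₀⟩ := h.nonneg_of_nearPlus (nearPlus_of_mem_X hV)
  obtain ⟨-, -, T₁, hT₁⟩ := mem_X_iff.1 hV
  set T := max T₀ T₁
  have hT : ∀ t, T < t → 0 ≤ S.pot (V t) := fun t ht => hT₀ t ((le_max_left _ _).trans_lt ht)
  have hfin := hE.le
  rw [h.energy_eq hc hV.1.continuous hT, ereal_sub_nonpos_iff ENNReal.ofReal_ne_top] at hfin
  obtain ⟨hkfin, hpfin⟩ := ENNReal.add_ne_top.1 (ne_top_of_le_ne_top ENNReal.ofReal_ne_top hfin)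
  have hiv : Integrable fun t => Real.exp (c * t) * v t := by
    have : Integrable fun t => Real.exp (c * t) * (v t / 2) := by
      refine ⟨(by fun_prop : Continuous _).aestronglyMeasurable, ?_⟩
      rw [hasFiniteIntegral_iff_ofReal (Eventually.of_forall fun t =>
        mul_nonneg (Real.exp_pos _).le (by linarith [hv0 t]))]
      exact hkfin.lt_top
    exact (this.const_mul 2).congr (Eventually.of_forall fun t => by ring)
  have hpd : ∀ t, t ≤ T → S.pdens c T V t = ENNReal.ofReal (Real.exp (c * t) * (e t - S.a)) :=
    fun t ht => by
      rw [pdens, if_pos ht, hpe, ← EReal.coe_sub, toENNReal_coe_real,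
        ← ENNReal.ofReal_mul (Real.exp_pos _).le]
  have hpd' : ∀ t, T < t → S.pdens c T V t = ENNReal.ofReal (Real.exp (c * t) * e t) :=
    fun t ht => by
      rw [pdens, if_neg (not_le.2 ht), hpe, toENNReal_coe_real,
        ← ENNReal.ofReal_mul (Real.exp_pos _).le]
  have hie : Integrable fun t => Real.exp (c * t) * e t := by
    rw [← integrableOn_univ, ← Iic_union_Ioi (a := T), integrableOn_union]
    constructor
    · have : IntegrableOn (fun t => Real.exp (c * t) * (e t - S.a)) (Iic T) := by
        refine ⟨(by fun_prop : Continuous _).aestronglyMeasurable, ?_⟩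
        rw [hasFiniteIntegral_iff_ofReal (Eventually.of_forall fun t =>
          mul_nonneg (Real.exp_pos _).le (by linarith [hea t])),
          ← setLIntegral_congr_fun measurableSet_Iic hpd]
        exact (setLIntegral_le_lintegral _ _).trans_lt hpfin.lt_top
      exact (this.add ((integrableOn_exp_mul_Iic hc T).mul_const S.a)).congr
        (Eventually.of_forall fun t => by simp only [Pi.add_apply]; ring)
    · refine ⟨(by fun_prop : Continuous _).aestronglyMeasurable, ?_⟩
      rw [hasFiniteIntegral_iff_ofReal ((ae_restrict_iff' measurableSet_Ioi).2
        (Eventually.of_forall fun t ht => mul_nonneg (Real.exp_pos _).le ?_)),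
        ← setLIntegral_congr_fun measurableSet_Ioi hpd']
      · exact (setLIntegral_le_lintegral _ _).trans_lt hpfin.lt_top
      · have := hT t ht
        rwa [hpe, EReal.coe_nonneg] at this
  have hne : ∃ t, v t ≠ 0 := by
    by_contra! hcon
    refine h.kin_ne_zero hb (c := c) hV ?_
    rw [kin, lintegral_congr (g := fun _ => 0), lintegral_zero]
    intro t
    have : ‖deriv V t‖ ^ 2 = 0 := hcon t
    simp [kdens, this]
  have hrep : ∀ t ≤ T₁, e t ≤ 0 → ∫ s in Iic t, Real.exp (c * s) * (v s / 2 + (e s - S.a)) ≤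
      3 / 2 * S.minus.C ^ 3 * (e t - S.a) * Real.exp (c * t) := by
    intro t ht het
    have hC := h.minus_hyp.one_lt_C
    have hr := h.minus_hyp.r₀_pos
    have htT : t ≤ T := ht.trans (le_max_right _ _)
    have hle := h.initial_energy_le hs hl hp hc hV hE hmin htT hT
      (by rw [hpe]; exact_mod_cast het) (by linarith [hT₁ t ht])
    rw [hpe, EReal.toReal_coe] at hle
    rw [integral_eq_lintegral_of_nonneg_ae (Eventually.of_forall fun s =>
      mul_nonneg (Real.exp_pos _).le (by linarith [hea s, hv0 s]))
      (by fun_prop : Continuous _).aestronglyMeasurable]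
    refine ENNReal.toReal_le_of_le_ofReal (mul_nonneg (mul_nonneg (by positivity)
      (by linarith [hea t])) (Real.exp_pos _).le) (le_trans (le_of_eq ?_) hle)
    refine setLIntegral_congr_fun measurableSet_Iic fun s hs => ?_
    simp only [hpd s (le_trans hs htT), kdens]
    rw [← ENNReal.ofReal_add (by positivity)
      (mul_nonneg (Real.exp_pos _).le (by linarith [hea s])), mul_add]
  obtain ⟨hvi, hint⟩ := hamiltonian_integral hc (h.speed_cost_le hc hcγ) hvc hv0 hne hq hea hiv hie
    ⟨T₁, hrep⟩
  refine ⟨hvi, ?_⟩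
  have ha := h.a_neg
  rw [hint, div_div_cancel₀ (by linarith : -S.a ≠ 0)]

/-- `speed_le` requires negative energy, which is available at every smaller speed; the bound is
obtained as these increase to `c`. -/
theorem Unbalanced.le_speed_bound (h : S.Unbalanced) (hs : S.SmallerSpace) (hl : S.LevelSets)
    (hb : S.ConvergenceBound) {c : ℝ} {U : ℝ → L} (hU : U ∈ S.X) (hc : 0 < c)
    (hE : S.energy c U ≤ 0) : c ≤ √(-2 * S.a) / S.d₀ := by
  refine le_of_forall_lt fun c' hlt => ?_
  obtain ⟨c'', h1, h2⟩ := exists_between (max_lt hlt hc)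
  obtain ⟨h1, h3⟩ := max_lt_iff.1 h1
  obtain ⟨V, hV, hVE⟩ := h.exists_neg_of_lt hb h3 h2 hU hE
  refine h1.trans_le ?_
  exact h.speed_le hs hl hb h3 hV.1 hVE (nearPlus_of_mem_X hV)

end Setting

end AbstractWave

/-! ### The main theorem -/

theorem mainTheorem7 {L H Ht : Type*}
    [NormedAddCommGroup L] [InnerProductSpace ℝ L] [CompleteSpace L]
    [NormedAddCommGroup H] [InnerProductSpace ℝ H] [CompleteSpace H]
    [NormedAddCommGroup Ht] [InnerProductSpace ℝ Ht]
    (S : AbstractWave.Setting L H Ht)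
    (h_unbalanced : S.Unbalanced) (h_smaller : S.SmallerSpace) (h_compact : S.Compactness)
    (h_inverse : S.InverseProj) (h_projH : S.ProjH) (h_regular : S.Regularity)
    (h_levels : S.LevelSets) (h_bound : S.ConvergenceBound) :
    (∃ (c : ℝ) (U : ℝ → L), S.IsMinimizingWave c U) ∧
    ∀ (c : ℝ) (U : ℝ → L), S.IsMinimizingWave c U →
      (∀ V : ℝ → L, S.MemA Set.univ V → V ∈ S.X → S.energy c V = 0 →
        S.Solves c V Set.univ ∧
        MeasureTheory.Integrable (fun t => ‖deriv V t‖ ^ 2) MeasureTheory.volume ∧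
        c = -S.a / ∫ t, ‖deriv V t‖ ^ 2) ∧
      IsLUB {c' : ℝ | 0 < c' ∧ S.infX c' = ⊥} c ∧
      IsGLB {c' : ℝ | 0 < c' ∧ S.infX c' = 0} c ∧
      c ≤ √(-2 * S.a) / S.d₀ ∧
      √(-2 * S.a) / S.d₀ < min (√(2 * S.EmaxMinus) / S.d₀) S.gammaMinus := by
  have hd := AbstractWave.Setting.d₀_pos h_unbalanced.a_neg h_bound
  have hγ := AbstractWave.Setting.speed_bound_lt h_unbalanced.a_neg h_bound
    h_unbalanced.gammaMinus_pos
  constructor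
  · obtain ⟨c, hc, ⟨U, hU, hE⟩, hmin⟩ := h_unbalanced.exists_minimizer h_smaller h_levels h_projH
      h_bound h_compact h_inverse.2
    obtain ⟨hA, hsol⟩ := h_unbalanced.minimizer_regular h_smaller h_regular hc hU hE hmin
    exact ⟨c, U, hc, hA, hU, hsol, hE, fun V hV => hE.trans_le (hmin V hV),
      h_unbalanced.trunc_fixed h_regular hc hU hE hmin⟩
  intro c U hw
  have hc := hw.pos
  have hmin : ∀ V ∈ S.X, 0 ≤ S.energy c V := fun V hV => hw.energy_eq.ge.trans (hw.minimal V hV)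
  have hle := h_unbalanced.le_speed_bound h_smaller h_levels h_bound hw.memX hc hw.energy_eq.le
  have hbot : ∀ c', 0 < c' → c' < c → S.infX c' = ⊥ := fun c' h0 hlt =>
    (h_unbalanced.infX_eq_bot_iff h0).2
      (h_unbalanced.exists_neg_of_lt h_bound h0 hlt hw.memX hw.energy_eq.le)
  have hzero : S.infX c = 0 :=
    le_antisymm ((iInf₂_le U hw.memX).trans hw.energy_eq.le) (le_iInf₂ hmin)
  refine ⟨fun V hVA hV hVE => ?_, ⟨?_, ?_⟩, ⟨?_, ?_⟩, hle, lt_min ?_ hγ⟩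
  -- A zero-energy element of `X` is itself a minimizer, so it is fixed by the truncation and the
  -- regularity hypothesis yields the equation.
  · obtain ⟨-, hsol⟩ := h_unbalanced.minimizer_regular h_smaller h_regular hc hV hVE hmin
    exact ⟨hsol, h_unbalanced.speed_eq h_smaller h_levels h_projH h_bound hc (hle.trans_lt hγ) hVA hV
      hVE hmin hsol⟩
  -- A negative energy at a speed above `c` would give one at `c`, where all energies are
  -- nonnegative.
  · rintro c' ⟨h0, hc'⟩
    by_contra! hlt
    obtain ⟨V, hV, hVE⟩ := (h_unbalanced.infX_eq_bot_iff h0).1 hc'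
    obtain ⟨W, hW, hWE⟩ := h_unbalanced.exists_neg_of_lt h_bound hc hlt hV hVE.le
    exact absurd (hmin W hW) (not_le.2 hWE)
  · intro b hb
    refine le_of_forall_lt fun c' hlt => ?_
    obtain ⟨c'', h1, h2⟩ := exists_between (max_lt hlt hc)
    obtain ⟨h1, h3⟩ := max_lt_iff.1 h1
    exact h1.trans_le (hb ⟨h3, hbot c'' h3 h2⟩)
  · rintro c' ⟨h0, hc'⟩
    by_contra! hlt
    rw [hbot c' h0 hlt] at hc'
    exact absurd hc' (by simp)
  · exact fun b hb => hb ⟨hc, hzero⟩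
  · have := h_levels.a_bound
    have ha := h_unbalanced.a_neg
    exact div_lt_div_of_pos_right (Real.sqrt_lt_sqrt (by linarith) (by linarith)) hd
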